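/- Fix an integer $m\ge 1$ and real numbers $r>1$, $\tau>1$. For $\alpha>0$, $\lambda\ge 0$ let $$g_\alpha(\lambda)=\frac{(\alpha+\lambda)^m-\alpha^m}{\lambda(\alpha+\lambda)^m}\quad(\lambda>0),\qquad g_\alpha(0)=\frac m\alpha ,\qquad r_\alpha(\lambda)=1-\lambda g_\alpha(\lambda)=\frac{\alpha^m}{(\alpha+\lambda)^m},$$ (iterated Tikhonov regularization of order $m$; for $m=1$ the method below is the iteratively regularized Gauss–Newton method) and put $$c_3=\frac1{\sqrt{2m-1}}\Big(\frac{2m-1}{2m}\Big)^m,\qquad c_4=\Big(1-\Big(\frac{m+1}{m+3}\Big)^m\Big)\sqrt m .$$ **Setting.** Let $X,Y$ be (real or complex) Hilbert spaces, $F:D(F)\subset X\to Y$ Fréchet differentiable with derivative $F'$, $F(x^\dagger)=y$, $x_0\in X$, $e_0:=x_0-x^\dagger$, and $B_\rho(x^\dagger)\subset D(F)$ for some $\rho>0$, where $B_\rho(x^\dagger)$ is the open ball. Let $\{\alpha_k\}_{k\ge0}$ satisfy $\alpha_k>0$, $1\le\alpha_k/\alpha_{k+1}\le r$ and $\alpha_k\to0$.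 Assume $$\|F'(x)\|\le\min\{c_3\alpha_0^{1/2},\beta_0^{1/2}\}\quad\text{for all }x\in B_\rho(x^\dagger),$$ where $0<\beta_0\le 1/2$ is such that $r_{\alpha_0}(\lambda)\ge 3/4$ for $\lambda\in[0,\beta_0]$. For $\delta>0$ and $y^\delta\in Y$ with $\|y^\delta-y\|\le\delta$ define $x_0^\delta=x_0$ and $$x_{k+1}^\delta=x_0-g_{\alpha_k}\big(F'(x_k^\delta)^*F'(x_k^\delta)\big)F'(x_k^\delta)^*\big(F(x_k^\delta)-y^\delta-F'(x_k^\delta)(x_k^\delta-x_0)\big),$$ and let $k_\delta$ be the first integer $k\ge 0$ with $\|F(x_k^\delta)-y^\delta\|\le\tau\delta$. We say that $k_\delta$ is well defined if such an integer exists and $x_0^\delta,\dots,x_{k_\delta}^\delta\in D(F)$. Consider the source conditions $$\text{(H)}\quad e_0=(F'(x^\dagger)^*F'(x^\dagger))^{\nu}\omega,\qquad\qquad \text{(L)}\quad e_0=\big(-\log(F'(x^\dagger)^*F'(x^\dagger))\big)^{-\mu}\omega ,\qquad \omega\in X.$$ **(i)** There are constants $\eta_0>0$ and $\kappa_0>0$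 depending only on $r,\tau,m$, and for each $\nu$ with $1/2\le\nu\le m-1/2$ a constant $C_\nu>0$ depending only on $r,\tau,m,\nu$, such that the following holds. Suppose that, for a constant $L$, $\|F'(x)-F'(z)\|\le L\|x-z\|$ for all $x,z\in B_\rho(x^\dagger)$, that $\rho>4\|e_0\|$, and that (H) holds for some $\omega\in X$. Then there is a unique $u\in\mathcal N(F'(x^\dagger)^*)^\perp\subset Y$ with $e_0=F'(x^\dagger)^*u$, and if $L\|u\|\le\eta_0$, then for all $\delta>0$ so small that $\|u\|\delta\le\kappa_0\rho^2$ and all $y^\delta$ with $\|y^\delta-y\|\le\delta$, the index $k_\delta$ is well defined and $$\|x_{k_\delta}^\delta-x^\dagger\|\le C_\nu\|\omega\|^{1/(1+2\nu)}\delta^{2\nu/(1+2\nu)} .$$ **(ii)** Fix $\gamma_1>c_3r^{1/2}/(\tau-1)$. There is a constant $\eta_1>0$ depending only on $r,\tau,m$ (and on the fixed $\gamma_1$) such that the following holds. Suppose that $\rho>2(1+c_4\gamma_1)\|e_0\|$ and $e_0\in\mathcal N(F'(x^\dagger))^\perp$, and that there are constants $K_0,K_1,K_2>0$ with $(K_0+K_1+K_2)\|e_0\|\le\eta_1$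 such that for all $x,z\in B_\rho(x^\dagger)$ there is a bounded linear operator $R(x,z):X\to X$ with $$F'(x)=F'(z)R(x,z),\qquad \|I-R(x,z)\|\le K_0\|x-z\|,$$ and for all $x,z\in B_\rho(x^\dagger)$ and $w\in X$ $$\|[F'(x)-F'(z)]w\|\le K_1\|x-z\|\|F'(z)w\|+K_2\|F'(z)(x-z)\|\|w\| .$$ Then $k_\delta$ is well defined for all $\delta>0$ and all $y^\delta$ with $\|y^\delta-y\|\le\delta$, and * $x_{k_\delta}^\delta\to x^\dagger$ as $\delta\to0$, uniformly over all $y^\delta$ with $\|y^\delta-y\|\le\delta$; * if (H) holds for some $\omega\in X$ and $0<\nu\le m-1/2$, then for all $\delta>0$ $$\|x_{k_\delta}^\delta-x^\dagger\|\le C_\nu\|\omega\|^{1/(1+2\nu)}\delta^{2\nu/(1+2\nu)},$$ where $C_\nu>0$ depends only on $r,\tau,m,\nu$ (and $\gamma_1$); * if (L) holds for some $\omega\in X$ and $\mu>0$, then for all $0<\delta\le\|\omega\|$ $$\|x_{k_\delta}^\delta-x^\dagger\|\le C_\mu\|\omega\|\Big(1+\Big|\ln\frac{\delta}{\|\omega\|}\Big|\Big)^{-\mu},$$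 where $C_\mu>0$ depends only on $r,\tau,m,\mu$ (and $\gamma_1$). -/

import Mathlib

open Filter Topology

universe u v w

noncomputable section

/-- `S = f(T)` for a bounded nonnegative self-adjoint operator `T` and a real function `f` that is
continuous on `[0, ‖T‖]` (an interval containing the spectrum of `T`): `S` is the operator that is
approximated by `p(T)`, in operator norm, at least as well as `f` is approximated uniformly on
`[0, ‖T‖]` by the real polynomial `p`. By the Weierstrass theorem there is at most one such `S`
(see `IsFunctionOf.unique`); that it exists is the continuous functional calculus. The definition
covers real and complex Hilbert spaces alike. -/
def IsFunctionOf {𝕜 : Type u} {X : Type v} [RCLike 𝕜] [NormedAddCommGroup X]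
    [InnerProductSpace 𝕜 X] (f : ℝ → ℝ) (T S : X →L[𝕜] X) : Prop :=
  ∀ (p : Polynomial ℝ) (η : ℝ), (∀ t ∈ Set.Icc 0 ‖T‖, |p.eval t - f t| ≤ η) →
    ‖Polynomial.aeval T (p.map (algebraMap ℝ 𝕜)) - S‖ ≤ η

theorem IsFunctionOf.unique {𝕜 : Type u} {X : Type v} [RCLike 𝕜] [NormedAddCommGroup X]
    [InnerProductSpace 𝕜 X] {f : ℝ → ℝ} {T S S' : X →L[𝕜] X}
    (hf : ContinuousOn f (Set.Icc 0 ‖T‖)) (h : IsFunctionOf f T S) (h' : IsFunctionOf f T S') :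
    S = S' := by
  refine eq_of_forall_dist_le fun ε hε => ?_
  obtain ⟨p, hp⟩ := exists_polynomial_near_of_continuousOn 0 ‖T‖ f hf (ε / 2) (half_pos hε)
  have h1 := h p (ε / 2) fun t ht => (hp t ht).le
  have h2 := h' p (ε / 2) fun t ht => (hp t ht).le
  rw [← dist_eq_norm] at h1 h2
  calc dist S S' ≤ _ := dist_triangle_left S S' _
    _ ≤ ε := by linarith

/-- The operator `f(T)` of the functional calculus. -/
def opFun {𝕜 : Type u} {X : Type v} [RCLike 𝕜] [NormedAddCommGroup X] [InnerProductSpace 𝕜 X]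
    (f : ℝ → ℝ) (T : X →L[𝕜] X) : X →L[𝕜] X :=
  Classical.epsilon (IsFunctionOf f T)

/-- `A* A`. -/
def gram {𝕜 : Type u} {X : Type v} {Y : Type w} [RCLike 𝕜]
    [NormedAddCommGroup X] [InnerProductSpace 𝕜 X] [CompleteSpace X]
    [NormedAddCommGroup Y] [InnerProductSpace 𝕜 Y] [CompleteSpace Y]
    (A : X →L[𝕜] Y) : X →L[𝕜] X :=
  (ContinuousLinearMap.adjoint A).comp A

/-- Iterated Tikhonov regularization of order `m`:
`g_α(t) = ((α + t)^m - α^m) / (t (α + t)^m)`, extended continuously by `g_α(0) = m / α`. -/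
def iterTikhonov (m : ℕ) (α t : ℝ) : ℝ :=
  if t = 0 then m / α else ((α + t) ^ m - α ^ m) / (t * (α + t) ^ m)

/-- The residual function `r_α(t) = 1 - t g_α(t)`. -/
def tikhonovResidual (m : ℕ) (α t : ℝ) : ℝ := 1 - t * iterTikhonov m α t

/-- The constant in `r_α(t) √t ≤ c₃ √α` for iterated Tikhonov regularization of order `m`. -/
def c₃ (m : ℕ) : ℝ := 1 / √(2 * m - 1) * ((2 * m - 1) / (2 * m)) ^ m

/-- The constant in `g_α(t) √t ≤ c₄ / √α` for iterated Tikhonov regularization of order `m`. -/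
def c₄ (m : ℕ) : ℝ := (1 - (((m : ℝ) + 1) / (m + 3)) ^ m) * √m

/-- The data of the nonlinear problem `F(x) = y` with `y = F(x†)` and of the Newton type method:
the domain `dom = D(F)`, the operator `F` and its derivative `F'` (only their values on `dom`
matter), the solution `xdag = x†`, the initial guess `x0`, the radius `ρ` of the ball around `x†`
on which conditions are imposed, and the regularization parameters `α k`. -/
structure NewtonData (𝕜 : Type u) (X : Type v) (Y : Type w) [RCLike 𝕜]
    [NormedAddCommGroup X] [InnerProductSpace 𝕜 X] [NormedAddCommGroup Y]
    [InnerProductSpace 𝕜 Y] where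
  dom : Set X
  F : X → Y
  F' : X → X →L[𝕜] Y
  xdag : X
  x0 : X
  ρ : ℝ
  α : ℕ → ℝ

namespace NewtonData

variable {𝕜 : Type u} {X : Type v} {Y : Type w} [RCLike 𝕜]
  [NormedAddCommGroup X] [InnerProductSpace 𝕜 X] [CompleteSpace X]
  [NormedAddCommGroup Y] [InnerProductSpace 𝕜 Y] [CompleteSpace Y]

/-- The exact right hand side `y = F(x†)`. -/
def y (P : NewtonData 𝕜 X Y) : Y := P.F P.xdag

/-- The initial error `x₀ - x†`. -/
def e0 (P : NewtonData 𝕜 X Y) : X := P.x0 - P.xdag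

/-- The ball `B_ρ(x†)`. -/
def ball (P : NewtonData 𝕜 X Y) : Set X := Metric.ball P.xdag P.ρ

/-- The standing assumptions: `F` is Fréchet differentiable on its domain, `B_ρ(x†) ⊆ D(F)`,
the parameters satisfy `α_k > 0`, `1 ≤ α_k / α_{k+1} ≤ r`, `α_k → 0`, and `F'` is scaled such that
`‖F'(x)‖ ≤ min {c₃ √α₀, √β₀}` on the ball, where `0 < β₀ ≤ 1/2` and `r_{α₀} ≥ 3/4` on `[0, β₀]`. -/
structure Standing (m : ℕ) (r : ℝ) (P : NewtonData 𝕜 X Y) : Prop where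
  hasFDeriv : ∀ x ∈ P.dom, HasFDerivWithinAt P.F (P.F' x) P.dom x
  radius_pos : 0 < P.ρ
  ball_subset : P.ball ⊆ P.dom
  alpha_pos : ∀ k, 0 < P.α k
  alpha_ratio : ∀ k, 1 ≤ P.α k / P.α (k + 1) ∧ P.α k / P.α (k + 1) ≤ r
  alpha_tendsto : Tendsto P.α atTop (𝓝 0)
  scaling : ∃ β₀ : ℝ, 0 < β₀ ∧ β₀ ≤ 1 / 2 ∧
    (∀ t ∈ Set.Icc 0 β₀, 3 / 4 ≤ tikhonovResidual m (P.α 0) t) ∧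
    ∀ x ∈ P.ball, ‖P.F' x‖ ≤ min (c₃ m * √(P.α 0)) (√β₀)

/-- The iterates `x_k^δ` for the data `yδ`:
`x_{k+1} = x₀ - g_{α_k}(F'(x_k)* F'(x_k)) F'(x_k)* (F(x_k) - yδ - F'(x_k)(x_k - x₀))`. -/
def iter (m : ℕ) (P : NewtonData 𝕜 X Y) (yδ : Y) : ℕ → X
  | 0 => P.x0
  | k + 1 =>
    P.x0 - opFun (iterTikhonov m (P.α k)) (gram (P.F' (iter m P yδ k)))
      (ContinuousLinearMap.adjoint (P.F' (iter m P yδ k))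
        (P.F (iter m P yδ k) - yδ - P.F' (iter m P yδ k) (iter m P yδ k - P.x0)))

/-- `k = k_δ`: the iterates up to index `k` exist (they do not leave the domain of `F`), and `k` is
the first index at which the discrepancy principle `‖F(x_k) - yδ‖ ≤ τ δ` is satisfied. -/
def IsStop (m : ℕ) (τ : ℝ) (P : NewtonData 𝕜 X Y) (δ : ℝ) (yδ : Y) (k : ℕ) : Prop :=
  (∀ j ≤ k, P.iter m yδ j ∈ P.dom) ∧
  ‖P.F (P.iter m yδ k) - yδ‖ ≤ τ * δ ∧
  ∀ j < k, τ * δ < ‖P.F (P.iter m yδ j) - yδ‖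

/-- The stopping index is unique. -/
theorem IsStop.unique {m : ℕ} {τ : ℝ} {P : NewtonData 𝕜 X Y} {δ : ℝ} {yδ : Y} {k l : ℕ}
    (hk : P.IsStop m τ δ yδ k) (hl : P.IsStop m τ δ yδ l) : k = l := by
  rcases lt_trichotomy k l with h | h | h
  · exact absurd hk.2.1 (not_le.2 (hl.2.2 k h))
  · exact h
  · exact absurd hl.2.1 (not_le.2 (hk.2.2 l h))

/-- `x₀ - x† = (F'(x†)* F'(x†))^ν ω`. -/
def HolderSource (P : NewtonData 𝕜 X Y) (ν : ℝ) (ω : X) : Prop :=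
  P.e0 = opFun (fun t => t ^ ν) (gram (P.F' P.xdag)) ω

/-- `x₀ - x† = (-log (F'(x†)* F'(x†)))^(-μ) ω`. The function `(-log t)^(-μ)` has the value `0`,
which is its limit, at `t = 0`. -/
def LogSource (P : NewtonData 𝕜 X Y) (μ : ℝ) (ω : X) : Prop :=
  P.e0 = opFun (fun t => (-Real.log t) ^ (-μ)) (gram (P.F' P.xdag)) ω

/-- `F'` is Lipschitz on the ball with constant `L`. -/
def LipschitzDeriv (P : NewtonData 𝕜 X Y) (L : ℝ) : Prop :=
  ∀ x ∈ P.ball, ∀ z ∈ P.ball, ‖P.F' x - P.F' z‖ ≤ L * ‖x - z‖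

/-- `z` is an element of `N(F'(x†)*)^⊥` with `x₀ - x† = F'(x†)* z`. -/
def IsSourceElement (P : NewtonData 𝕜 X Y) (z : Y) : Prop :=
  z ∈ (LinearMap.ker (ContinuousLinearMap.adjoint (P.F' P.xdag) : Y →ₗ[𝕜] X))ᗮ ∧
    P.e0 = ContinuousLinearMap.adjoint (P.F' P.xdag) z

/-- `F'(x) = F'(z) R(x, z)` with `‖I - R(x, z)‖ ≤ K₀ ‖x - z‖` on the ball. -/
def RangeInvariance (P : NewtonData 𝕜 X Y) (K₀ : ℝ) : Prop :=
  0 < K₀ ∧ ∃ R : X → X → X →L[𝕜] X, ∀ x ∈ P.ball, ∀ z ∈ P.ball,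
    P.F' x = (P.F' z).comp (R x z) ∧
      ‖ContinuousLinearMap.id 𝕜 X - R x z‖ ≤ K₀ * ‖x - z‖

/-- `‖(F'(x) - F'(z)) h‖ ≤ K₁ ‖x - z‖ ‖F'(z) h‖ + K₂ ‖F'(z)(x - z)‖ ‖h‖` on the ball. -/
def DerivBound (P : NewtonData 𝕜 X Y) (K₁ K₂ : ℝ) : Prop :=
  0 < K₁ ∧ 0 < K₂ ∧ ∀ x ∈ P.ball, ∀ z ∈ P.ball, ∀ h : X,
    ‖(P.F' x - P.F' z) h‖ ≤ K₁ * ‖x - z‖ * ‖P.F' z h‖ + K₂ * ‖P.F' z (x - z)‖ * ‖h‖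

/-- The assumptions of the second part: the standing assumptions, the two structure conditions on
`F'`, `ρ > 2 (1 + c₄ γ₁) ‖x₀ - x†‖`, `x₀ - x† ∈ N(F'(x†))^⊥`, and the smallness condition
`(K₀ + K₁ + K₂) ‖x₀ - x†‖ ≤ η₁`. -/
structure StrongAssumptions (m : ℕ) (r γ₁ η₁ : ℝ) (P : NewtonData 𝕜 X Y) (K₀ K₁ K₂ : ℝ) :
    Prop where
  standing : P.Standing m r
  rangeInvariance : P.RangeInvariance K₀
  derivBound : P.DerivBound K₁ K₂
  radius : 2 * (1 + c₄ m * γ₁) * ‖P.e0‖ < P.ρ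
  orthogonal : P.e0 ∈ (LinearMap.ker (P.F' P.xdag : X →ₗ[𝕜] Y))ᗮ
  small : (K₀ + K₁ + K₂) * ‖P.e0‖ ≤ η₁

end NewtonData

end

/-! Write `T = F'(x†)`, `S = F'(x_k)`, `e_k = x_k - x†`, `ξ = y - yδ` and `p = F(x_k) - y - S e_k`.
Then `e_{k+1} = r_α(S*S) e0 - g_α(S*S) S*(p + ξ)` with `α = α_k` (`iter_succ_sub`). With `S = T` and
`p = 0` this is linear iterated Tikhonov regularization, and the proof treats the nonlinear method
as a perturbation of it. Errors are measured by `scaledNorm`, that is `√α ‖x‖ + ‖T x‖`. In this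
norm, replacing `S` by `T` and dropping `p` costs at most a small multiple `ε` of the norm of `e_k`,
plus multiples of `δ` (`newton_step_lipschitz`, `newton_step_structure`). Here `ε` is a constant
times `L ‖u‖` or `(K₀ + K₁ + K₂) ‖e0‖`. The tool is the resolvent identity, telescoped over the
powers (`resOp_sub`).

The stopping index exists because an a priori index `K`, the first at which `α_K` is small compared
with the noise, already satisfies the discrepancy principle. Up to `K` an induction keeps the
iterates in the ball (`exists_isStop_of_lipschitz`, `StrongAssumptions.exists_isStop`).

All that the rates need from the stopping rule is collected in `StoppedError` by
`NearLinear.exists_stoppedError`. The final error `x` lies within `‖x‖/4 + C D` of a filtered vector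
`h = r_a(T*T) e0` or `h = e0`, where `D` is `0` or some `δ/√a` whose `a` cannot be too small, since
the discrepancy principle failed one index before stopping. As `h` is a contraction of `e0`
commuting with every `r_β(T*T)`, this gives `‖x‖ ≤ C (‖r_β(T*T) e0‖ + δ/√β + D)` for every `β > 0`
(`StoppedError.norm_le`). The parameter `β` is unrelated to the stopping index, so each source
condition only requires an a priori choice of `β` and a bound for `D`. Under a mere Lipschitz
condition `‖T x‖` is not known to be `O(δ)`; there a duality argument with the source element gives
a similar bound (`StoppedError.norm_le_of_source`).

The functional calculus is built for real and complex scalars at once from one inequality: `‖p(T)‖`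
is at most the maximum of `|p|` on `[0, ‖T‖]` for positive `T` and real polynomials `p`
(`norm_polyEval_le`). -/

noncomputable section

/-! ### Real polynomials of a positive operator and their norms. -/

section FunctionalCalculus

open Polynomial ContinuousLinearMap
open scoped InnerProductSpace

variable {𝕜 : Type u} {X : Type v} {Y : Type w} [RCLike 𝕜]
  [NormedAddCommGroup X] [InnerProductSpace 𝕜 X]
  [NormedAddCommGroup Y] [InnerProductSpace 𝕜 Y]

/-- Evaluation of real polynomials at an operator. -/
def polyEval (T : X →L[𝕜] X) : ℝ[X] →+* (X →L[𝕜] X) :=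
  (aeval T : 𝕜[X] →ₐ[𝕜] _).toRingHom.comp (mapRingHom (algebraMap ℝ 𝕜))

theorem polyEval_apply (T : X →L[𝕜] X) (p : ℝ[X]) :
    polyEval T p = aeval T (p.map (algebraMap ℝ 𝕜)) := rfl

@[simp] theorem polyEval_X (T : X →L[𝕜] X) : polyEval T Polynomial.X = T := by
  simp [polyEval_apply]

@[simp] theorem polyEval_C (T : X →L[𝕜] X) (c : ℝ) : polyEval T (C c) = (c : 𝕜) • 1 := by
  simp [polyEval_apply, Algebra.algebraMap_eq_smul_one]

theorem polyEval_C_mul (T : X →L[𝕜] X) (c : ℝ) (p : ℝ[X]) :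
    polyEval T (C c * p) = (c : 𝕜) • polyEval T p := by
  rw [map_mul, polyEval_C, smul_mul_assoc, one_mul]

theorem re_inner_real_smul_left (c : ℝ) (x y : X) :
    RCLike.re ⟪(c : 𝕜) • x, y⟫_𝕜 = c * RCLike.re ⟪x, y⟫_𝕜 := by
  rw [inner_smul_left, RCLike.conj_ofReal, RCLike.re_ofReal_mul]

variable [CompleteSpace X] [CompleteSpace Y]

theorem polyEval_isSelfAdjoint {T : X →L[𝕜] X} (hT : IsSelfAdjoint T) (p : ℝ[X]) :
    IsSelfAdjoint (polyEval T p) := by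
  induction p using Polynomial.induction_on' with
  | add p q hp hq => rw [map_add]; exact hp.add hq
  | monomial n a =>
    rw [← C_mul_X_pow_eq_monomial, polyEval_C_mul, map_pow, polyEval_X]
    refine IsSelfAdjoint.smul ?_ (hT.pow n)
    simp [isSelfAdjoint_iff]

/-- Coercive operators are invertible (Lax–Milgram). All invertibility below is reduced to this. -/
theorem isUnit_of_re_inner_ge {S : X →L[𝕜] X} {c : ℝ} (hc : 0 < c)
    (h : ∀ x : X, c * ‖x‖ ^ 2 ≤ RCLike.re ⟪S x, x⟫_𝕜) : IsUnit S :=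
  isUnit_of_forall_le_norm_inner_map S (c := ⟨c, hc.le⟩) hc fun x => by
    have := h x
    have h2 := RCLike.re_le_norm ⟪S x, x⟫_𝕜
    change ‖x‖ ^ 2 * c ≤ _
    linarith

theorem isUnit_polyEval_linear {T : X →L[𝕜] X} (hT : T.IsPositive) {a : ℝ}
    (ha : a ∉ Set.Icc 0 ‖T‖) : IsUnit (polyEval T (Polynomial.X - C a)) := by
  have key : ∀ x : X, ⟪(polyEval T (Polynomial.X - C a)) x, x⟫_𝕜 = ⟪T x, x⟫_𝕜 - ⟪(a : 𝕜) • x, x⟫_𝕜 := by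
    intro x; simp [inner_sub_left]
  have hin (x : X) : RCLike.re ⟪(a : 𝕜) • x, x⟫_𝕜 = a * ‖x‖ ^ 2 := by
    rw [re_inner_real_smul_left, inner_self_eq_norm_sq]
  by_cases h0 : a < 0
  · refine isUnit_of_re_inner_ge (neg_pos.2 h0) fun x => ?_
    rw [key, map_sub, hin]
    have := hT.re_inner_nonneg_left x
    linarith
  · have h1 : ‖T‖ < a := by
      by_contra h; exact ha ⟨not_lt.1 h0, not_lt.1 h⟩
    have : IsUnit (-(polyEval T (Polynomial.X - C a))) := by
      refine isUnit_of_re_inner_ge (sub_pos.2 h1) fun x => ?_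
      rw [neg_apply, inner_neg_left, key, map_neg, map_sub, hin]
      have h2 : RCLike.re ⟪T x, x⟫_𝕜 ≤ ‖T‖ * ‖x‖ ^ 2 := by
        calc _ ≤ ‖T x‖ * ‖x‖ := re_inner_le_norm _ _
          _ ≤ (‖T‖ * ‖x‖) * ‖x‖ := by gcongr; exact T.le_opNorm x
          _ = _ := by ring
      linarith
    exact (IsUnit.neg_iff _).1 this

theorem isUnit_polyEval_quadratic {T : X →L[𝕜] X} (hT : IsSelfAdjoint T) (b : ℝ) {d : ℝ}
    (hd : 0 < d) : IsUnit (polyEval T ((Polynomial.X - C b) ^ 2 + C d)) := by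
  refine isUnit_of_re_inner_ge hd fun x => ?_
  have hs := (polyEval_isSelfAdjoint hT (Polynomial.X - C b))
  set S := polyEval T (Polynomial.X - C b)
  have h1 : (polyEval T ((Polynomial.X - C b) ^ 2 + C d)) x = S (S x) + (d : 𝕜) • x := by
    simp only [map_add, polyEval_C, pow_two]
    simp [S]
  rw [h1, inner_add_left, map_add, re_inner_real_smul_left, inner_self_eq_norm_sq]
  have h2 : ⟪S (S x), x⟫_𝕜 = ⟪S x, S x⟫_𝕜 := by
    conv_lhs => rw [← hs.adjoint_eq, adjoint_inner_left, hs.adjoint_eq]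
  rw [h2, inner_self_eq_norm_sq]
  nlinarith [sq_nonneg ‖S x‖]

/-- A real irreducible polynomial has degree at most two. With a root it is linear up to a unit, and
the root lies off `[0, ‖T‖]`; without one it is, unless constant, a multiple of `(X - b)² + d` with
`d > 0`. Either way the operator or its negative is coercive up to a nonzero factor. No
complexification is needed. -/
theorem isUnit_polyEval_irreducible {T : X →L[𝕜] X} (hT : T.IsPositive) {p : ℝ[X]}
    (hp : Irreducible p) (h : ∀ t ∈ Set.Icc 0 ‖T‖, p.eval t ≠ 0) : IsUnit (polyEval T p) := by
  have hC : ∀ c : ℝ, c ≠ 0 → IsUnit (polyEval T (C c)) := fun c hc =>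
    (isUnit_C.2 (isUnit_iff_ne_zero.2 hc)).map _
  by_cases hr : ∃ a, p.IsRoot a
  · obtain ⟨a, ha⟩ := hr
    obtain ⟨q, rfl⟩ := dvd_iff_isRoot.2 ha
    have hq : IsUnit q := (hp.isUnit_or_isUnit rfl).resolve_left (not_isUnit_X_sub_C a)
    rw [map_mul]
    refine (isUnit_polyEval_linear hT fun hm => h a hm ?_).mul (hq.map _)
    simp
  · push Not at hr
    have hdeg := hp.degree_le_two
    have hq := eq_quadratic_of_degree_le_two hdeg
    set a := p.coeff 2
    set b := p.coeff 1
    set c := p.coeff 0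
    have hev : ∀ t, p.eval t = a * t ^ 2 + b * t + c := fun t => by rw [hq]; simp
    have hr' : ∀ t, a * t ^ 2 + b * t + c ≠ 0 := fun t ht => hr t (by rw [IsRoot, hev, ht])
    by_cases ha : a = 0
    · by_cases hb : b = 0
      · exfalso
        refine hp.not_isUnit ?_
        rw [hq, ha, hb]
        simp only [map_zero, zero_mul, zero_add]
        refine isUnit_C.2 (isUnit_iff_ne_zero.2 fun hc => hr' 0 (by simp [hc]))
      · exact absurd (by rw [ha]; field_simp; ring) (hr' (-c / b))
    · have hdisc : 0 < c / a - (b / (2 * a)) ^ 2 := by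
        by_contra hneg
        push Not at hneg
        set s := √((b / (2 * a)) ^ 2 - c / a)
        have hs : s ^ 2 = (b / (2 * a)) ^ 2 - c / a := Real.sq_sqrt (by linarith)
        refine hr' (s - b / (2 * a)) ?_
        have : a * (s - b / (2 * a)) ^ 2 + b * (s - b / (2 * a)) + c
          = a * (s ^ 2 - ((b / (2 * a)) ^ 2 - c / a)) := by field_simp; ring
        rw [this, hs]; ring
      have : p = C a * ((Polynomial.X - C (-(b / (2 * a)))) ^ 2 + C (c / a - (b / (2 * a)) ^ 2)) := by
        refine Polynomial.funext fun t => ?_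
        rw [hev]; simp; field_simp; ring
      rw [this, map_mul]
      exact (hC a ha).mul (isUnit_polyEval_quadratic hT.isSelfAdjoint _ hdisc)

theorem isUnit_polyEval {T : X →L[𝕜] X} (hT : T.IsPositive) (p : ℝ[X])
    (h : ∀ t ∈ Set.Icc 0 ‖T‖, p.eval t ≠ 0) : IsUnit (polyEval T p) := by
  induction p using WfDvdMonoid.induction_on_irreducible with
  | zero => exact absurd (by simp) (h 0 ⟨le_rfl, norm_nonneg _⟩)
  | unit p hp => exact hp.map _
  | mul p i _ hi ih =>
    rw [map_mul]
    refine (isUnit_polyEval_irreducible hT hi fun t ht h0 => h t ht ?_).mul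
      (ih fun t ht h0 => h t ht ?_) <;> simp [h0]

/-- A bounded inverse `V` of `‖S‖² - S²` would keep `‖S x‖²` below `(‖S‖² - k) ‖x‖²` with a fixed `k
> 0`, contradicting the definition of the operator norm. Self-adjointness enters through `⟨x, S² x⟩
= ‖S x‖²`. -/
theorem not_isUnit_sq_norm_sub_sq {S : X →L[𝕜] X} (hS : IsSelfAdjoint S) (h0 : S ≠ 0) :
    ¬ IsUnit (((‖S‖ ^ 2 : ℝ) : 𝕜) • (1 : X →L[𝕜] X) - S * S) := by
  rintro ⟨U, hU⟩
  have hc : 0 < ‖S‖ := norm_pos_iff.2 h0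
  set c := ‖S‖
  set V : X →L[𝕜] X := (↑U⁻¹ : X →L[𝕜] X)
  have hV : ∀ x, V ((((c ^ 2 : ℝ) : 𝕜) • (1 : X →L[𝕜] X) - S * S) x) = x := fun x => by
    rw [← hU]
    exact congrArg (fun W : X →L[𝕜] X => W x) U.inv_mul
  have hVn : 0 ≤ ‖V‖ := norm_nonneg _
  have key : ∀ x, ‖x‖ ^ 2 ≤ ‖V‖ ^ 2 * (c ^ 2 * (c ^ 2 * ‖x‖ ^ 2 - ‖S x‖ ^ 2)) := by
    intro x
    set z := (((c ^ 2 : ℝ) : 𝕜) • (1 : X →L[𝕜] X) - S * S) x with hz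
    have hz' : z = ((c ^ 2 : ℝ) : 𝕜) • x - S (S x) := by simp [hz]
    have h1 : ‖x‖ ≤ ‖V‖ * ‖z‖ := by
      conv_lhs => rw [← hV x]
      exact V.le_opNorm _
    have h2 : ‖z‖ ^ 2 ≤ c ^ 2 * (c ^ 2 * ‖x‖ ^ 2 - ‖S x‖ ^ 2) := by
      rw [hz', @norm_sub_sq 𝕜, re_inner_real_smul_left]
      have h3 : ⟪x, S (S x)⟫_𝕜 = ⟪S x, S x⟫_𝕜 := by
        conv_lhs => rw [← hS.adjoint_eq, adjoint_inner_right, hS.adjoint_eq]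
      rw [h3, inner_self_eq_norm_sq, norm_smul, RCLike.norm_ofReal, abs_of_nonneg (sq_nonneg c)]
      have h4 : ‖S (S x)‖ ^ 2 ≤ c ^ 2 * ‖S x‖ ^ 2 := by
        rw [← mul_pow]; gcongr; exact S.le_opNorm _
      nlinarith
    calc ‖x‖ ^ 2 ≤ (‖V‖ * ‖z‖) ^ 2 := by gcongr
      _ = ‖V‖ ^ 2 * ‖z‖ ^ 2 := by ring
      _ ≤ _ := by gcongr
  have hVpos : 0 < ‖V‖ := by
    refine hVn.lt_of_ne fun h => h0 ?_
    ext x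
    have := key x
    rw [← h] at this
    have hx : ‖x‖ = 0 := by nlinarith [norm_nonneg x]
    rw [norm_eq_zero.1 hx]; simp
  have hk : 0 < 1 / (‖V‖ ^ 2 * c ^ 2) := by positivity
  set k := 1 / (‖V‖ ^ 2 * c ^ 2) with hkdef
  have hSx : ∀ x, ‖S x‖ ^ 2 ≤ (c ^ 2 - k) * ‖x‖ ^ 2 := fun x => by
    have h1 := key x
    have h2 : k * ‖x‖ ^ 2 ≤ c ^ 2 * ‖x‖ ^ 2 - ‖S x‖ ^ 2 := by
      rw [hkdef, one_div, inv_mul_le_iff₀ (by positivity)]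
      linarith
    linarith
  have hle : c ≤ √(c ^ 2 - k) := by
    refine S.opNorm_le_bound (Real.sqrt_nonneg _) fun x => ?_
    by_cases hx : ‖x‖ = 0
    · rw [norm_eq_zero.1 hx]; simp
    have hx' : 0 < ‖x‖ ^ 2 := by positivity
    have hpos : 0 ≤ c ^ 2 - k := by
      have := (sq_nonneg ‖S x‖).trans (hSx x)
      exact nonneg_of_mul_nonneg_left this hx'
    refine le_of_sq_le_sq ?_ (by positivity)
    rw [mul_pow, Real.sq_sqrt hpos]
    exact hSx x
  have : √(c ^ 2 - k) < c := by
    rw [Real.sqrt_lt' hc]; linarith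
  linarith

/-- If `‖p(T)‖` exceeded `M`, the polynomial `‖p(T)‖² - p²` would have no zero on `[0, ‖T‖]`, so
`‖S‖² - S²` with `S = p(T)` would be invertible, which `not_isUnit_sq_norm_sub_sq` excludes. -/
theorem norm_polyEval_le {T : X →L[𝕜] X} (hT : T.IsPositive) {p : ℝ[X]} {M : ℝ}
    (h : ∀ t ∈ Set.Icc 0 ‖T‖, |p.eval t| ≤ M) : ‖polyEval T p‖ ≤ M := by
  have hM : 0 ≤ M := (abs_nonneg _).trans (h 0 ⟨le_rfl, norm_nonneg _⟩)
  by_contra! hlt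
  set S := polyEval T p with hS
  have hne : S ≠ 0 := fun h0 => by rw [h0, norm_zero] at hlt; linarith
  refine not_isUnit_sq_norm_sub_sq (polyEval_isSelfAdjoint hT.isSelfAdjoint p) hne ?_
  have := isUnit_polyEval hT (C (‖S‖ ^ 2) - p * p) fun t ht h0 => by
    have h1 : ‖S‖ ^ 2 = (p.eval t) ^ 2 := by
      simp at h0; linarith
    have h2 := h t ht
    rw [← sq_abs (p.eval t)] at h1
    have : |p.eval t| = ‖S‖ := by
      rw [← abs_of_nonneg (norm_nonneg S)]
      have := (sq_eq_sq_iff_abs_eq_abs _ _).1 h1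
      rw [abs_abs] at this; exact this.symm
    linarith
  rwa [map_sub, map_mul, polyEval_C] at this

end FunctionalCalculus

/-! ### Continuous functional calculus on `[0, ‖T‖]`. -/

section OpFun

open Polynomial ContinuousLinearMap
open scoped InnerProductSpace

variable {𝕜 : Type u} {X : Type v} {Y : Type w} [RCLike 𝕜]
  [NormedAddCommGroup X] [InnerProductSpace 𝕜 X]
  {T : X →L[𝕜] X} {f g : ℝ → ℝ}

theorem opFun_congr (h : ∀ t ∈ Set.Icc 0 ‖T‖, f t = g t) : opFun f T = opFun g T := by
  have : IsFunctionOf f T = IsFunctionOf g T := by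
    funext S
    refine propext (forall_congr' fun p => forall_congr' fun η => ?_)
    have : (∀ t ∈ Set.Icc 0 ‖T‖, |p.eval t - f t| ≤ η) ↔
        ∀ t ∈ Set.Icc 0 ‖T‖, |p.eval t - g t| ≤ η :=
      forall₂_congr fun t ht => by rw [h t ht]
    rw [this]
  rw [opFun, opFun, this]

variable [CompleteSpace X]

theorem norm_polyEval_sub_le (hT : T.IsPositive) {p q : ℝ[X]} {a b : ℝ}
    (hp : ∀ t ∈ Set.Icc 0 ‖T‖, |p.eval t - f t| ≤ a)
    (hq : ∀ t ∈ Set.Icc 0 ‖T‖, |q.eval t - f t| ≤ b) :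
    ‖polyEval T p - polyEval T q‖ ≤ a + b := by
  rw [← map_sub]
  refine norm_polyEval_le hT fun t ht => ?_
  rw [eval_sub]
  calc |p.eval t - q.eval t| = |(p.eval t - f t) - (q.eval t - f t)| := by ring_nf
    _ ≤ _ := (abs_sub _ _).trans (add_le_add (hp t ht) (hq t ht))

/-- Polynomials that are uniformly close to `f` have close values at `T`, so one good approximant
per tolerance already settles the condition for all polynomials. The algebraic rules for `opFun` are
verified through this criterion. -/
theorem IsFunctionOf.of_forall_approx (hT : T.IsPositive) {S : X →L[𝕜] X}
    (h : ∀ ε > 0, ∃ p : ℝ[X], (∀ t ∈ Set.Icc 0 ‖T‖, |p.eval t - f t| ≤ ε) ∧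
      ‖polyEval T p - S‖ ≤ ε) : IsFunctionOf f T S := by
  intro p η hp
  refine le_of_forall_pos_le_add fun ε hε => ?_
  obtain ⟨q, hq, hqS⟩ := h (ε / 2) (half_pos hε)
  have h1 := norm_polyEval_sub_le hT hp hq
  calc ‖polyEval T p - S‖ = ‖(polyEval T p - polyEval T q) + (polyEval T q - S)‖ := by
        rw [sub_add_sub_cancel]
    _ ≤ (η + ε / 2) + ε / 2 := (norm_add_le _ _).trans (add_le_add h1 hqS)
    _ = η + ε := by ring

theorem exists_isFunctionOf (hT : T.IsPositive) (hf : ContinuousOn f (Set.Icc 0 ‖T‖)) :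
    ∃ S, IsFunctionOf f T S := by
  have hp (n : ℕ) := exists_polynomial_near_of_continuousOn 0 ‖T‖ f hf (1 / ((n : ℝ) + 1))
    Nat.one_div_pos_of_nat
  choose p hp using hp
  have hc : CauchySeq fun n => polyEval T (p n) := by
    refine cauchySeq_of_le_tendsto_0 (fun n => 2 * (1 / ((n : ℝ) + 1))) (fun n k N hn hk => ?_) ?_
    · rw [dist_eq_norm]
      refine (norm_polyEval_sub_le hT (fun t ht => (hp n t ht).le) fun t ht => (hp k t ht).le).trans ?_
      have h1 := Nat.one_div_le_one_div (α := ℝ) hn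
      have h2 := Nat.one_div_le_one_div (α := ℝ) hk
      linarith
    · simpa using (tendsto_one_div_add_atTop_nhds_zero_nat (𝕜 := ℝ)).const_mul 2
  obtain ⟨S, hS⟩ := cauchySeq_tendsto_of_complete hc
  refine ⟨S, .of_forall_approx hT fun ε hε => ?_⟩
  have h1 := (Metric.tendsto_nhds.1 hS ε hε).and
    ((Metric.tendsto_nhds.1 (tendsto_one_div_add_atTop_nhds_zero_nat (𝕜 := ℝ)) ε hε))
  obtain ⟨n, hn1, hn2⟩ := h1.exists
  refine ⟨p n, fun t ht => (hp n t ht).le.trans ?_, ?_⟩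
  · rw [Real.dist_eq, sub_zero] at hn2
    exact (le_abs_self _).trans hn2.le
  · rw [← dist_eq_norm]; exact hn1.le

theorem isFunctionOf_opFun (hT : T.IsPositive) (hf : ContinuousOn f (Set.Icc 0 ‖T‖)) :
    IsFunctionOf f T (opFun f T) :=
  Classical.epsilon_spec (exists_isFunctionOf hT hf)

theorem IsFunctionOf.opFun_eq {S : X →L[𝕜] X} (hT : T.IsPositive)
    (hf : ContinuousOn f (Set.Icc 0 ‖T‖)) (h : IsFunctionOf f T S) : opFun f T = S :=
  (isFunctionOf_opFun hT hf).unique hf h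

theorem exists_polyEval_near (hT : T.IsPositive) (hf : ContinuousOn f (Set.Icc 0 ‖T‖)) {ε : ℝ}
    (hε : 0 < ε) : ∃ p : ℝ[X], (∀ t ∈ Set.Icc 0 ‖T‖, |p.eval t - f t| ≤ ε) ∧
      ‖polyEval T p - opFun f T‖ ≤ ε := by
  obtain ⟨p, hp⟩ := exists_polynomial_near_of_continuousOn 0 ‖T‖ f hf ε hε
  exact ⟨p, fun t ht => (hp t ht).le, isFunctionOf_opFun hT hf p ε fun t ht => (hp t ht).le⟩

theorem norm_opFun_le (hT : T.IsPositive) (hf : ContinuousOn f (Set.Icc 0 ‖T‖)) {M : ℝ}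
    (h : ∀ t ∈ Set.Icc 0 ‖T‖, |f t| ≤ M) : ‖opFun f T‖ ≤ M := by
  have := isFunctionOf_opFun hT hf 0 M fun t ht => by simpa using h t ht
  simpa using this

theorem opFun_polynomial (hT : T.IsPositive) (p : ℝ[X]) :
    opFun (fun t => p.eval t) T = polyEval T p :=
  IsFunctionOf.opFun_eq hT p.continuous.continuousOn
    (.of_forall_approx hT fun ε hε => ⟨p, fun t _ => by simpa using hε.le, by simpa using hε.le⟩)

theorem opFun_const (hT : T.IsPositive) (c : ℝ) :
    opFun (fun _ => c) T = (c : 𝕜) • (1 : X →L[𝕜] X) := by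
  simpa using opFun_polynomial hT (C c)

theorem opFun_id (hT : T.IsPositive) : opFun (fun t => t) T = T := by
  simpa using opFun_polynomial hT Polynomial.X

theorem opFun_add (hT : T.IsPositive) (hf : ContinuousOn f (Set.Icc 0 ‖T‖))
    (hg : ContinuousOn g (Set.Icc 0 ‖T‖)) :
    opFun (fun t => f t + g t) T = opFun f T + opFun g T := by
  refine IsFunctionOf.opFun_eq hT (hf.add hg) (.of_forall_approx hT fun ε hε => ?_)
  obtain ⟨p, hp, hpS⟩ := exists_polyEval_near hT hf (half_pos hε)
  obtain ⟨q, hq, hqS⟩ := exists_polyEval_near hT hg (half_pos hε)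
  refine ⟨p + q, fun t ht => ?_, ?_⟩
  · rw [eval_add, add_sub_add_comm]
    have := (abs_add_le (p.eval t - f t) (q.eval t - g t)).trans (add_le_add (hp t ht) (hq t ht))
    linarith
  · rw [map_add, add_sub_add_comm]
    have := (norm_add_le (polyEval T p - opFun f T) (polyEval T q - opFun g T)).trans
      (add_le_add hpS hqS)
    linarith

theorem norm_mul_sub_mul_le {R : Type*} [NormedRing R] {p q a b : R} {M η : ℝ} (hη : η ≤ 1)
    (hM : 0 ≤ M) (ha : ‖a‖ ≤ M) (hb : ‖b‖ ≤ M) (hp : ‖p - a‖ ≤ η) (hq : ‖q - b‖ ≤ η) :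
    ‖p * q - a * b‖ ≤ η * (2 * M + 1) := by
  have hη0 : 0 ≤ η := (norm_nonneg _).trans hp
  have : p * q - a * b = (p - a) * (q - b) + (a * (q - b) + (p - a) * b) := by noncomm_ring
  rw [this]
  calc _ ≤ ‖(p - a) * (q - b)‖ + (‖a * (q - b)‖ + ‖(p - a) * b‖) :=
        (norm_add_le _ _).trans (add_le_add le_rfl (norm_add_le _ _))
    _ ≤ ‖p - a‖ * ‖q - b‖ + (‖a‖ * ‖q - b‖ + ‖p - a‖ * ‖b‖) := by
        gcongr <;> exact norm_mul_le _ _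
    _ ≤ η * 1 + (M * η + η * M) := by gcongr; exact hq.trans hη
    _ = _ := by ring

theorem opFun_mul (hT : T.IsPositive) (hf : ContinuousOn f (Set.Icc 0 ‖T‖))
    (hg : ContinuousOn g (Set.Icc 0 ‖T‖)) :
    opFun (fun t => f t * g t) T = opFun f T * opFun g T := by
  refine IsFunctionOf.opFun_eq hT (hf.mul hg) (.of_forall_approx hT fun ε hε => ?_)
  obtain ⟨Mf, hMf⟩ := isCompact_Icc.exists_bound_of_continuousOn hf
  obtain ⟨Mg, hMg⟩ := isCompact_Icc.exists_bound_of_continuousOn hg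
  set M := max 0 (max Mf Mg)
  have hM0 : 0 ≤ M := le_max_left _ _
  have hf' : ∀ t ∈ Set.Icc 0 ‖T‖, |f t| ≤ M := fun t ht =>
    (hMf t ht).trans ((le_max_left _ _).trans (le_max_right _ _))
  have hg' : ∀ t ∈ Set.Icc 0 ‖T‖, |g t| ≤ M := fun t ht =>
    (hMg t ht).trans ((le_max_right _ _).trans (le_max_right _ _))
  set η := min 1 (ε / (2 * M + 1))
  have hη : 0 < η := by positivity
  have hηε : η * (2 * M + 1) ≤ ε := by
    rw [← le_div_iff₀ (by positivity)]; exact min_le_right _ _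
  obtain ⟨p, hp, hpS⟩ := exists_polyEval_near hT hf hη
  obtain ⟨q, hq, hqS⟩ := exists_polyEval_near hT hg hη
  refine ⟨p * q, fun t ht => ?_, ?_⟩
  · rw [eval_mul]
    exact (norm_mul_sub_mul_le (R := ℝ) (min_le_left _ _) hM0 (hf' t ht) (hg' t ht) (hp t ht)
      (hq t ht)).trans hηε
  · rw [map_mul]
    exact (norm_mul_sub_mul_le (min_le_left _ _) hM0 (norm_opFun_le hT hf hf')
      (norm_opFun_le hT hg hg') hpS hqS).trans hηε

theorem opFun_const_mul (hT : T.IsPositive) (hf : ContinuousOn f (Set.Icc 0 ‖T‖)) (c : ℝ) :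
    opFun (fun t => c * f t) T = (c : 𝕜) • opFun f T := by
  rw [opFun_mul hT continuousOn_const hf, opFun_const hT, smul_mul_assoc, one_mul]

theorem opFun_mul_apply (hT : T.IsPositive) (hf : ContinuousOn f (Set.Icc 0 ‖T‖))
    (hg : ContinuousOn g (Set.Icc 0 ‖T‖)) (x : X) :
    opFun (fun t => f t * g t) T x = opFun f T (opFun g T x) := by
  rw [opFun_mul hT hf hg]; rfl

theorem opFun_sub (hT : T.IsPositive) (hf : ContinuousOn f (Set.Icc 0 ‖T‖))
    (hg : ContinuousOn g (Set.Icc 0 ‖T‖)) :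
    opFun (fun t => f t - g t) T = opFun f T - opFun g T := by
  rw [eq_sub_iff_add_eq, ← opFun_add hT (f := fun t => f t - g t) (hf.sub hg) hg]
  simp only [sub_add_cancel]

theorem opFun_isSelfAdjoint (hT : T.IsPositive) (hf : ContinuousOn f (Set.Icc 0 ‖T‖)) :
    IsSelfAdjoint (opFun f T) := by
  refine eq_of_forall_dist_le fun ε hε => ?_
  obtain ⟨p, -, hp⟩ := exists_polyEval_near hT hf (half_pos hε)
  have h1 : ‖star (opFun f T) - polyEval T p‖ ≤ ε / 2 := by
    rw [← (polyEval_isSelfAdjoint hT.isSelfAdjoint p).star_eq, ← star_sub, norm_star, norm_sub_rev]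
    exact hp
  rw [dist_eq_norm, ← sub_add_sub_cancel _ (polyEval T p)]
  exact (norm_add_le _ _).trans (by linarith)

theorem inner_opFun_left (hT : T.IsPositive) (hf : ContinuousOn f (Set.Icc 0 ‖T‖)) (x z : X) :
    ⟪opFun f T x, z⟫_𝕜 = ⟪x, opFun f T z⟫_𝕜 := by
  conv_lhs => rw [← (opFun_isSelfAdjoint hT hf).adjoint_eq, adjoint_inner_left]

theorem norm_sq_opFun_apply (hT : T.IsPositive) (hf : ContinuousOn f (Set.Icc 0 ‖T‖)) (x : X) :
    ‖opFun f T x‖ ^ 2 = RCLike.re ⟪opFun (fun t => f t * f t) T x, x⟫_𝕜 := by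
  rw [opFun_mul_apply hT hf hf, inner_opFun_left hT hf, inner_self_eq_norm_sq]

/-- With `h = √(g² - f²)` one has `‖g(T) x‖² - ‖f(T) x‖² = ‖h(T) x‖²`. This replaces pointwise
comparison under a spectral measure. -/
theorem norm_opFun_apply_le_of_sq_le (hT : T.IsPositive) (hf : ContinuousOn f (Set.Icc 0 ‖T‖))
    (hg : ContinuousOn g (Set.Icc 0 ‖T‖)) (h : ∀ t ∈ Set.Icc 0 ‖T‖, f t ^ 2 ≤ g t ^ 2) (x : X) :
    ‖opFun f T x‖ ≤ ‖opFun g T x‖ := by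
  have hc : ContinuousOn (fun t => g t * g t - f t * f t) (Set.Icc 0 ‖T‖) :=
    (hg.mul hg).sub (hf.mul hf)
  have h1 := norm_sq_opFun_apply hT hc.sqrt x
  have h2 : opFun (fun t => √(g t * g t - f t * f t) * √(g t * g t - f t * f t)) T
      = opFun (fun t => g t * g t) T - opFun (fun t => f t * f t) T := by
    rw [← opFun_sub hT (f := fun t => g t * g t) (g := fun t => f t * f t) (hg.mul hg) (hf.mul hf)]
    refine opFun_congr fun t ht => Real.mul_self_sqrt ?_
    have := h t ht
    nlinarith
  rw [h2, sub_apply, inner_sub_left, map_sub, ← norm_sq_opFun_apply hT hf,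
    ← norm_sq_opFun_apply hT hg] at h1
  refine le_of_sq_le_sq ?_ (norm_nonneg _)
  nlinarith [sq_nonneg ‖opFun (fun t => √(g t * g t - f t * f t)) T x‖]

theorem norm_opFun_apply_le (hT : T.IsPositive) (hf : ContinuousOn f (Set.Icc 0 ‖T‖)) {M : ℝ}
    (h : ∀ t ∈ Set.Icc 0 ‖T‖, |f t| ≤ M) (x : X) : ‖opFun f T x‖ ≤ M * ‖x‖ :=
  (opFun f T).le_of_opNorm_le (norm_opFun_le hT hf h) x

end OpFun

/-! ### Functions of `A* A` and `A A*`. -/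

section Gram

open Polynomial ContinuousLinearMap
open scoped InnerProductSpace

variable {𝕜 : Type u} {X : Type v} {Y : Type w} [RCLike 𝕜]
  [NormedAddCommGroup X] [InnerProductSpace 𝕜 X] [CompleteSpace X]
  [NormedAddCommGroup Y] [InnerProductSpace 𝕜 Y] [CompleteSpace Y]
  (A : X →L[𝕜] Y) {f : ℝ → ℝ}

theorem gram_isPositive : (gram A).IsPositive := isPositive_adjoint_comp_self A

theorem gram_apply (x : X) : gram A x = adjoint A (A x) := rfl

theorem norm_gram : ‖gram A‖ = ‖A‖ ^ 2 := by
  rw [gram, norm_adjoint_comp_self, sq]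

theorem norm_gram_adjoint : ‖gram (adjoint A)‖ = ‖gram A‖ := by
  rw [norm_gram, norm_gram, LinearIsometryEquiv.norm_map]

theorem gram_adjoint_apply (z : Y) : gram (adjoint A) z = A (adjoint A z) := by
  rw [gram_apply, adjoint_adjoint]

theorem apply_polyEval_gram (p : ℝ[X]) (x : X) :
    A (polyEval (gram A) p x) = polyEval (gram (adjoint A)) p (A x) := by
  induction p using Polynomial.induction_on' generalizing x with
  | add p q hp hq => simp [hp, hq]
  | monomial n a =>
    rw [← C_mul_X_pow_eq_monomial]
    simp only [polyEval_C_mul, map_pow, polyEval_X, smul_apply, map_smul]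
    congr 1
    induction n generalizing x with
    | zero => simp
    | succ n ih =>
      rw [pow_succ, pow_succ]
      change A ((gram A ^ n) (gram A x)) = (gram (adjoint A) ^ n) (gram (adjoint A) (A x))
      rw [ih, gram_adjoint_apply, gram_apply]

/-- The identity is clear for polynomials. Since `A* A` and `A A*` have the same norm, one
polynomial approximates `f` well enough for both operators. -/
theorem apply_opFun_gram (hf : ContinuousOn f (Set.Icc 0 ‖gram A‖)) (x : X) :
    A (opFun f (gram A) x) = opFun f (gram (adjoint A)) (A x) := by
  refine eq_of_forall_dist_le fun ε hε => ?_
  set δ := ε / (2 * (‖A‖ * ‖x‖ + 1)) with hδ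
  have hpos : 0 < ‖A‖ * ‖x‖ + 1 := by positivity
  have hδ0 : 0 < δ := by positivity
  obtain ⟨p, hp, hpS⟩ := exists_polyEval_near (gram_isPositive A) hf hδ0
  have hf' : ContinuousOn f (Set.Icc 0 ‖gram (adjoint A)‖) := by rwa [norm_gram_adjoint]
  have hpS' := isFunctionOf_opFun (gram_isPositive (adjoint A)) hf' p δ
    (by rwa [norm_gram_adjoint])
  rw [← polyEval_apply] at hpS'
  have h1 : ‖A (opFun f (gram A) x) - A (polyEval (gram A) p x)‖ ≤ ‖A‖ * (δ * ‖x‖) := by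
    rw [← map_sub, ← sub_apply]
    refine (A.le_opNorm _).trans ?_
    gcongr
    exact le_of_opNorm_le _ (by rwa [norm_sub_rev]) x
  have h2 : ‖polyEval (gram (adjoint A)) p (A x) - opFun f (gram (adjoint A)) (A x)‖
      ≤ δ * (‖A‖ * ‖x‖) := by
    rw [← sub_apply]
    refine (le_of_opNorm_le _ hpS' _).trans ?_
    gcongr
    exact A.le_opNorm _
  rw [← apply_polyEval_gram] at h2
  rw [dist_eq_norm, ← sub_add_sub_cancel _ (A (polyEval (gram A) p x))]
  refine (norm_add_le _ _).trans ((add_le_add h1 h2).trans ?_)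
  have : δ * (2 * (‖A‖ * ‖x‖ + 1)) = ε := by rw [hδ]; field_simp
  nlinarith

theorem adjoint_apply_opFun_gram (hf : ContinuousOn f (Set.Icc 0 ‖gram A‖)) (z : Y) :
    adjoint A (opFun f (gram (adjoint A)) z) = opFun f (gram A) (adjoint A z) := by
  have := apply_opFun_gram (adjoint A) (f := f) (by rwa [norm_gram_adjoint]) z
  rwa [adjoint_adjoint] at this

/-- Both squared norms equal `⟨t f(t)² x, x⟩` with `t = A* A`. Thus every bound on `A f(A* A)`
becomes a scalar bound on `√t f(t)`. -/
theorem norm_apply_opFun_gram (hf : ContinuousOn f (Set.Icc 0 ‖gram A‖)) (x : X) :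
    ‖A (opFun f (gram A) x)‖ = ‖opFun (fun t => √t * f t) (gram A) x‖ := by
  have hA := gram_isPositive A
  have hs : ContinuousOn (fun t => √t * f t) (Set.Icc 0 ‖gram A‖) :=
    Real.continuous_sqrt.continuousOn.mul hf
  have hff : ContinuousOn (fun t => t * f t) (Set.Icc 0 ‖gram A‖) := continuousOn_id.mul hf
  have h1 : opFun (fun t => √t * f t * (√t * f t)) (gram A) x
      = opFun f (gram A) (gram A (opFun f (gram A) x)) := by
    have : gram A (opFun f (gram A) x) = opFun (fun t => t * f t) (gram A) x := by
      rw [opFun_mul_apply hA (f := fun t => t) continuousOn_id hf, opFun_id hA]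
    rw [this, ← opFun_mul_apply hA hf hff]
    refine congrArg (fun S : X →L[𝕜] X => S x) (opFun_congr fun t ht => ?_)
    linear_combination (f t ^ 2) * Real.mul_self_sqrt ht.1
  rw [← sq_eq_sq₀ (norm_nonneg _) (norm_nonneg _), norm_sq_opFun_apply hA hs, h1,
    inner_opFun_left hA hf, gram_apply, adjoint_inner_left, inner_self_eq_norm_sq]

end Gram

/-! ### Scalar estimates for the filter functions, in terms of `α / (α + t)`. -/

section Scalar

variable {α t : ℝ}

theorem resolvent_pos (hα : 0 < α) (ht : 0 ≤ t) : 0 < α / (α + t) := by positivity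

theorem resolvent_le_one (hα : 0 < α) (ht : 0 ≤ t) : α / (α + t) ≤ 1 :=
  div_le_one_of_le₀ (by linarith) (by positivity)

theorem resolvent_pow_le_one (hα : 0 < α) (ht : 0 ≤ t) (n : ℕ) : (α / (α + t)) ^ n ≤ 1 :=
  pow_le_one₀ (resolvent_pos hα ht).le (resolvent_le_one hα ht)

theorem mul_resolvent_eq (hα : 0 < α) (ht : 0 ≤ t) :
    t * (α / (α + t)) = α * (1 - α / (α + t)) := by
  have : α + t ≠ 0 := by positivity
  field_simp; ring

theorem resolvent_pow_le_self (hα : 0 < α) (ht : 0 ≤ t) {n : ℕ} (hn : 1 ≤ n) :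
    (α / (α + t)) ^ n ≤ α / (α + t) :=
  pow_le_of_le_one (resolvent_pos hα ht).le (resolvent_le_one hα ht) (by lia)

theorem mul_resolvent_pow_le (hα : 0 < α) (ht : 0 ≤ t) {n : ℕ} (hn : 1 ≤ n) :
    t * (α / (α + t)) ^ n ≤ α :=
  calc t * (α / (α + t)) ^ n ≤ t * (α / (α + t)) := by
        gcongr; exact resolvent_pow_le_self hα ht hn
    _ = α * (1 - α / (α + t)) := mul_resolvent_eq hα ht
    _ ≤ α := by have := resolvent_pos hα ht; nlinarith

theorem sqrt_mul_resolvent_pow_le (hα : 0 < α) (ht : 0 ≤ t) {n : ℕ} (hn : 1 ≤ n) :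
    √t * (α / (α + t)) ^ n ≤ √α := by
  refine Real.le_sqrt_of_sq_le ?_
  rw [mul_pow, Real.sq_sqrt ht]
  have h1 := mul_resolvent_pow_le hα ht hn
  have h2 := resolvent_pow_le_one hα ht n
  have h3 : 0 ≤ (α / (α + t)) ^ n := (pow_pos (resolvent_pos hα ht) n).le
  nlinarith

theorem iterTikhonov_eq_sum (m : ℕ) (hα : 0 < α) (ht : 0 ≤ t) :
    iterTikhonov m α t = α⁻¹ * ∑ i ∈ Finset.range m, (α / (α + t)) ^ (i + 1) := by
  have hαt : α + t ≠ 0 := by positivity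
  rw [iterTikhonov]
  split_ifs with h
  · simp [h, div_self hα.ne', div_eq_inv_mul]
  · have h1 : α / (α + t) ≠ 1 := by
      rw [Ne, div_eq_one_iff_eq hαt]; intro h2; exact h (by linarith)
    simp only [pow_succ]
    rw [← Finset.sum_mul, geom_sum_eq h1, div_pow]
    have h3 : α / (α + t) - 1 = - (t / (α + t)) := by field_simp; ring
    rw [h3]
    field_simp
    ring

theorem tikhonovResidual_eq (m : ℕ) (hα : 0 < α) (ht : 0 ≤ t) :
    tikhonovResidual m α t = (α / (α + t)) ^ m := by
  have hαt : α + t ≠ 0 := by positivity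
  rw [tikhonovResidual, iterTikhonov]
  split_ifs with h
  · simp [h, div_self hα.ne']
  · rw [div_pow]; field_simp; ring

theorem mul_iterTikhonov_eq (m : ℕ) (hα : 0 < α) (ht : 0 ≤ t) :
    t * iterTikhonov m α t = 1 - (α / (α + t)) ^ m := by
  rw [← tikhonovResidual_eq m hα ht, tikhonovResidual]; ring

theorem iterTikhonov_nonneg (m : ℕ) (hα : 0 < α) (ht : 0 ≤ t) : 0 ≤ iterTikhonov m α t := by
  rw [iterTikhonov_eq_sum m hα ht]; positivity

theorem iterTikhonov_le (m : ℕ) (hα : 0 < α) (ht : 0 ≤ t) : iterTikhonov m α t ≤ m / α := by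
  rw [iterTikhonov_eq_sum m hα ht, div_eq_inv_mul (m : ℝ) α]
  refine mul_le_mul_of_nonneg_left ?_ (inv_pos.2 hα).le
  refine (Finset.sum_le_card_nsmul _ _ 1 fun i _ => resolvent_pow_le_one hα ht _).trans ?_
  simp

/-- Multiply `t g ≤ 1` by `g ≤ m / α`. This constant is cruder than `c₄`, but at most twice as large
(`sqrt_le_two_mul_c₄`), which is all that is needed. -/
theorem sqrt_mul_iterTikhonov_le (m : ℕ) (hα : 0 < α) (ht : 0 ≤ t) :
    √t * iterTikhonov m α t ≤ √m / √α := by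
  rw [← Real.sqrt_div (Nat.cast_nonneg _)]
  refine Real.le_sqrt_of_sq_le ?_
  rw [mul_pow, Real.sq_sqrt ht]
  have h1 : t * iterTikhonov m α t ≤ 1 := by
    rw [mul_iterTikhonov_eq m hα ht]
    linarith [pow_pos (resolvent_pos hα ht) m]
  have h2 := iterTikhonov_le m hα ht
  have h3 := iterTikhonov_nonneg m hα ht
  nlinarith

theorem c₃_pos {m : ℕ} (hm : 1 ≤ m) : 0 < c₃ m := by
  have : (1 : ℝ) ≤ m := by exact_mod_cast hm
  rw [c₃]
  have h : (0 : ℝ) < 2 * m - 1 := by linarith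
  positivity

/-- After squaring, this is Bernoulli's inequality with exponent `2 m`. The variable `x` of the
proof vanishes exactly at the maximizer `t = α / (2 m - 1)`, which is why the constant is sharp.
Sharpness matters because `γ₁` is allowed to be anything above `c₃ √r / (τ - 1)`. -/
theorem sqrt_mul_resolvent_pow_le_c₃ {m : ℕ} (hm : 1 ≤ m) (hα : 0 < α) (ht : 0 ≤ t) :
    √t * (α / (α + t)) ^ m ≤ c₃ m * √α := by
  have hm' : (1 : ℝ) ≤ m := by exact_mod_cast hm
  have h : (0 : ℝ) < 2 * m - 1 := by linarith
  have hαt : 0 < α + t := by positivity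
  have hc := c₃_pos hm
  refine le_of_sq_le_sq ?_ (by positivity)
  rw [c₃]
  simp only [mul_pow, div_pow (1 : ℝ), one_pow, Real.sq_sqrt ht, Real.sq_sqrt hα.le,
    Real.sq_sqrt h.le]
  set x : ℝ := ((α + t) / α) * ((2 * m - 1) / (2 * m)) - 1 with hx
  have hx0 : 0 ≤ 1 + x := by rw [hx, add_sub_cancel]; positivity
  have hB := one_add_mul_le_pow (a := x) (by linarith) (2 * m)
  have e1 : 1 + ((2 * m : ℕ) : ℝ) * x = t / α * (2 * m - 1) := by
    rw [hx]; push_cast; field_simp; ring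
  have e2 : (1 + x) ^ (2 * m) = (((α + t) / α) ^ m) ^ 2 * (((2 * m - 1) / (2 * m)) ^ m) ^ 2 := by
    rw [hx, add_sub_cancel, mul_pow, ← pow_mul, ← pow_mul, mul_comm m 2]
  rw [e1, e2] at hB
  have e3 : (α / (α + t)) ^ m * ((α + t) / α) ^ m = 1 := by
    rw [← mul_pow]
    have : α / (α + t) * ((α + t) / α) = 1 := by field_simp
    rw [this, one_pow]
  set a := (α / (α + t)) ^ m
  set b := ((α + t) / α) ^ m
  set c := ((2 * (m : ℝ) - 1) / (2 * m)) ^ m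
  have e4 : t = α / (2 * m - 1) * (t / α * (2 * m - 1)) := by field_simp
  calc t * a ^ 2 = α / (2 * m - 1) * (t / α * (2 * m - 1)) * a ^ 2 := by rw [← e4]
    _ ≤ α / (2 * m - 1) * (b ^ 2 * c ^ 2) * a ^ 2 := by gcongr
    _ = α / (2 * m - 1) * c ^ 2 * (a * b) ^ 2 := by ring
    _ = _ := by rw [e3]; ring

theorem c₃_le_one {m : ℕ} (hm : 1 ≤ m) : c₃ m ≤ 1 := by
  have hm' : (1 : ℝ) ≤ m := by exact_mod_cast hm
  rw [c₃]
  refine mul_le_one₀ ?_ (by have : (0 : ℝ) ≤ 2 * m - 1 := by linarith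
                            positivity) ?_
  · rw [one_div]
    exact inv_le_one_of_one_le₀ (Real.one_le_sqrt.2 (by linarith))
  · refine pow_le_one₀ (div_nonneg (by linarith) (by positivity)) ?_
    rw [div_le_one (by positivity)]; linarith

/-- Bernoulli gives `(1 + 2/(m+1))^m ≥ 2`. The factor `2` fits the radius condition, in which `c₄
γ₁` already occurs doubled. -/
theorem sqrt_le_two_mul_c₄ {m : ℕ} (hm : 1 ≤ m) : √(m : ℝ) ≤ 2 * c₄ m := by
  have hm' : (1 : ℝ) ≤ m := by exact_mod_cast hm
  have h1 : (((m : ℝ) + 1) / (m + 3)) ^ m ≤ 1 / 2 := by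
    have hB := one_add_mul_le_pow (a := (2 : ℝ) / (m + 1))
      (le_trans (by norm_num) (show (0 : ℝ) ≤ 2 / (m + 1) by positivity)) m
    have h2 : (2 : ℝ) ≤ 1 + m * (2 / (m + 1)) := by
      have : 1 + (m : ℝ) * (2 / (m + 1)) - 2 = (m - 1) / (m + 1) := by field_simp; ring
      have h3 : 0 ≤ ((m : ℝ) - 1) / (m + 1) := div_nonneg (by linarith) (by positivity)
      linarith
    have h4 : ((m : ℝ) + 1) / (m + 3) = (1 + 2 / ((m : ℝ) + 1))⁻¹ := by field_simp; ring
    rw [h4, inv_pow, one_div]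
    exact inv_anti₀ two_pos (h2.trans hB)
  have h2 := Real.sqrt_nonneg (m : ℝ)
  rw [c₄]
  nlinarith

theorem resolvent_le_mul {β r : ℝ} (hα : 0 < α) (hβ : 0 < β) (hr : 1 ≤ r) (h : α ≤ r * β)
    (ht : 0 ≤ t) : α / (α + t) ≤ r * (β / (β + t)) := by
  rw [← mul_div_assoc, div_le_div_iff₀ (by positivity) (by positivity)]
  have : t * α ≤ t * (r * β) := by gcongr
  nlinarith [mul_pos hα hβ]

end Scalar

theorem continuousOn_resolvent {α : ℝ} (hα : 0 < α) (M : ℝ) :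
    ContinuousOn (fun t => α / (α + t)) (Set.Icc 0 M) :=
  continuousOn_const.div (continuousOn_const.add continuousOn_id) fun t ht => by
    have := ht.1; positivity

theorem continuousOn_resolvent_pow {α : ℝ} (hα : 0 < α) (n : ℕ) (M : ℝ) :
    ContinuousOn (fun t => (α / (α + t)) ^ n) (Set.Icc 0 M) :=
  (continuousOn_resolvent hα M).pow n

theorem continuousOn_iterTikhonov (m : ℕ) {α : ℝ} (hα : 0 < α) (M : ℝ) :
    ContinuousOn (iterTikhonov m α) (Set.Icc 0 M) := by
  have : ContinuousOn (fun t => α⁻¹ * ∑ i ∈ Finset.range m, (α / (α + t)) ^ (i + 1))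
      (Set.Icc 0 M) :=
    continuousOn_const.mul
      (continuousOn_finsetSum _ fun i _ => continuousOn_resolvent_pow hα (i + 1) M)
  exact this.congr fun t ht => iterTikhonov_eq_sum m hα ht.1

/-! ### The operators `r_α(A* A)`, `g_α(A* A)` and their dependence on `A`. -/

section Operators

open ContinuousLinearMap
open scoped InnerProductSpace

variable {𝕜 : Type u} {X : Type v} {Y : Type w} [RCLike 𝕜]
  [NormedAddCommGroup X] [InnerProductSpace 𝕜 X] [CompleteSpace X]
  [NormedAddCommGroup Y] [InnerProductSpace 𝕜 Y] [CompleteSpace Y]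

/-- `(α (α + A* A)⁻¹)^n`. -/
def resOp (n : ℕ) (α : ℝ) (A : X →L[𝕜] Y) : X →L[𝕜] X :=
  opFun (fun t => (α / (α + t)) ^ n) (gram A)

variable (A : X →L[𝕜] Y) {α : ℝ}

theorem resOp_zero (α : ℝ) : resOp 0 α A = 1 := by
  simpa [resOp] using opFun_const (gram_isPositive A) 1

theorem resOp_add (hα : 0 < α) (n k : ℕ) : resOp (n + k) α A = resOp n α A * resOp k α A := by
  simp only [resOp, pow_add]
  exact opFun_mul (gram_isPositive A) (continuousOn_resolvent_pow hα n _)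
    (continuousOn_resolvent_pow hα k _)

theorem resOp_comm (hα : 0 < α) {β : ℝ} (hβ : 0 < β) (n k : ℕ) (x : X) :
    resOp n α A (resOp k β A x) = resOp k β A (resOp n α A x) := by
  rw [resOp, resOp, ← opFun_mul_apply (gram_isPositive A) (continuousOn_resolvent_pow hα n _)
    (continuousOn_resolvent_pow hβ k _), ← opFun_mul_apply (gram_isPositive A)
    (continuousOn_resolvent_pow hβ k _) (continuousOn_resolvent_pow hα n _)]
  simp only [mul_comm]

theorem norm_resOp_apply_le (hα : 0 < α) (n : ℕ) (x : X) : ‖resOp n α A x‖ ≤ ‖x‖ := by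
  refine (norm_opFun_apply_le (gram_isPositive A) (continuousOn_resolvent_pow hα n _) (M := 1)
    (fun t ht => ?_) x).trans (one_mul _).le
  rw [abs_of_pos (pow_pos (resolvent_pos hα ht.1) n)]
  exact resolvent_pow_le_one hα ht.1 n

theorem apply_resOp (hα : 0 < α) (n : ℕ) (x : X) :
    A (resOp n α A x) = resOp n α (adjoint A) (A x) :=
  apply_opFun_gram A (continuousOn_resolvent_pow hα n _) x

theorem resOp_adjoint_apply (hα : 0 < α) (n : ℕ) (z : Y) :
    resOp n α A (adjoint A z) = adjoint A (resOp n α (adjoint A) z) :=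
  (adjoint_apply_opFun_gram A (continuousOn_resolvent_pow hα n _) z).symm

theorem norm_apply_resOp_le_of_le (hα : 0 < α) (n : ℕ) {M : ℝ}
    (h : ∀ t, 0 ≤ t → √t * (α / (α + t)) ^ n ≤ M) (x : X) : ‖A (resOp n α A x)‖ ≤ M * ‖x‖ := by
  rw [resOp, norm_apply_opFun_gram A (continuousOn_resolvent_pow hα n _)]
  refine norm_opFun_apply_le (gram_isPositive A)
    (Real.continuous_sqrt.continuousOn.mul (continuousOn_resolvent_pow hα n _)) (fun t ht => ?_) x
  change |√t * (α / (α + t)) ^ n| ≤ M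
  rw [abs_of_nonneg (mul_nonneg (Real.sqrt_nonneg _) (pow_pos (resolvent_pos hα ht.1) n).le)]
  exact h t ht.1

theorem norm_apply_resOp_le (hα : 0 < α) {n : ℕ} (hn : 1 ≤ n) (x : X) :
    ‖A (resOp n α A x)‖ ≤ √α * ‖x‖ :=
  norm_apply_resOp_le_of_le A hα n (fun _ ht => sqrt_mul_resolvent_pow_le hα ht hn) x

theorem norm_apply_resOp_le_c₃ (hα : 0 < α) {m : ℕ} (hm : 1 ≤ m) (x : X) :
    ‖A (resOp m α A x)‖ ≤ c₃ m * √α * ‖x‖ :=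
  norm_apply_resOp_le_of_le A hα m (fun _ ht => sqrt_mul_resolvent_pow_le_c₃ hm hα ht) x

theorem norm_resOp_adjoint_apply_le (hα : 0 < α) {n : ℕ} (hn : 1 ≤ n) (z : Y) :
    ‖resOp n α A (adjoint A z)‖ ≤ √α * ‖z‖ := by
  rw [resOp_adjoint_apply A hα]; exact norm_apply_resOp_le _ hα hn z

theorem norm_gram_resOp_le (hα : 0 < α) {n : ℕ} (hn : 1 ≤ n) (x : X) :
    ‖gram A (resOp n α A x)‖ ≤ α * ‖x‖ := by
  have h : gram A (resOp n α A x) = opFun (fun t => t * (α / (α + t)) ^ n) (gram A) x := by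
    rw [opFun_mul_apply (gram_isPositive A) (f := fun t => t) continuousOn_id
      (continuousOn_resolvent_pow hα n _), opFun_id (gram_isPositive A), resOp]
  rw [h]
  refine norm_opFun_apply_le (gram_isPositive A)
    (continuousOn_id.mul (continuousOn_resolvent_pow hα n _)) (fun t ht => ?_) x
  change |t * (α / (α + t)) ^ n| ≤ α
  rw [abs_of_nonneg (mul_nonneg ht.1 (pow_pos (resolvent_pos hα ht.1) n).le)]
  exact mul_resolvent_pow_le hα ht.1 hn

theorem norm_apply_resOp_adjoint_apply_le (hα : 0 < α) {n : ℕ} (hn : 1 ≤ n) (z : Y) :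
    ‖A (resOp n α A (adjoint A z))‖ ≤ α * ‖z‖ := by
  rw [resOp_adjoint_apply A hα, ← gram_adjoint_apply]
  exact norm_gram_resOp_le _ hα hn z

/-- Pointwise, `α/(α+t) ≤ r β/(β+t)` when `α ≤ r β`. This is the price of passing from one
regularization parameter to the next. -/
theorem norm_resOp_le_norm_resOp (hα : 0 < α) {β r : ℝ} (hβ : 0 < β) (hr : 1 ≤ r)
    (h : α ≤ r * β) (n : ℕ) (x : X) : ‖resOp n α A x‖ ≤ r ^ n * ‖resOp n β A x‖ := by
  have h1 : r ^ n * ‖resOp n β A x‖ = ‖opFun (fun t => r ^ n * (β / (β + t)) ^ n) (gram A) x‖ := by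
    rw [opFun_const_mul (gram_isPositive A) (continuousOn_resolvent_pow hβ n _), smul_apply,
      norm_smul, RCLike.norm_ofReal, abs_of_nonneg (by positivity), resOp]
  rw [h1]
  refine norm_opFun_apply_le_of_sq_le (gram_isPositive A) (continuousOn_resolvent_pow hα n _)
    (continuousOn_const.mul (continuousOn_resolvent_pow hβ n _)) (fun t ht => ?_) x
  change ((α / (α + t)) ^ n) ^ 2 ≤ (r ^ n * (β / (β + t)) ^ n) ^ 2
  rw [← mul_pow]
  have := (resolvent_pos hα ht.1).le
  gcongr
  exact resolvent_le_mul hα hβ hr h ht.1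

theorem norm_apply_resOp_le_norm_apply_resOp (hα : 0 < α) {β r : ℝ} (hβ : 0 < β) (hr : 1 ≤ r)
    (h : α ≤ r * β) (n : ℕ) (x : X) : ‖A (resOp n α A x)‖ ≤ r ^ n * ‖A (resOp n β A x)‖ := by
  rw [apply_resOp A hα, apply_resOp A hβ]
  exact norm_resOp_le_norm_resOp _ hα hβ hr h n _

theorem norm_le_norm_resOp (hα : 0 < α) {c : ℝ} (hc : 0 < c) (n : ℕ)
    (h : ∀ t ∈ Set.Icc 0 ‖gram A‖, c ≤ (α / (α + t)) ^ n) (x : X) :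
    ‖x‖ ≤ c⁻¹ * ‖resOp n α A x‖ := by
  have h1 : opFun (fun _ => c) (gram A) x = (c : 𝕜) • x := by
    rw [opFun_const (gram_isPositive A), smul_apply, one_apply_eq_self]
  have h2 := norm_opFun_apply_le_of_sq_le (gram_isPositive A) (f := fun _ => c)
    continuousOn_const (continuousOn_resolvent_pow hα n _)
    (fun t ht => pow_le_pow_left₀ hc.le (h t ht) 2) x
  rw [h1, norm_smul, RCLike.norm_ofReal, abs_of_pos hc] at h2
  rw [← div_eq_inv_mul, le_div_iff₀ hc, mul_comm]
  exact h2

theorem norm_apply_le_norm_apply_resOp (hα : 0 < α) {c : ℝ} (hc : 0 < c) (n : ℕ)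
    (h : ∀ t ∈ Set.Icc 0 ‖gram A‖, c ≤ (α / (α + t)) ^ n) (x : X) :
    ‖A x‖ ≤ c⁻¹ * ‖A (resOp n α A x)‖ := by
  rw [apply_resOp A hα]
  exact norm_le_norm_resOp _ hα hc n (by rwa [norm_gram_adjoint]) _

/-- `g_α(A* A)` for iterated Tikhonov regularization. -/
def regOp (m : ℕ) (α : ℝ) (A : X →L[𝕜] Y) : X →L[𝕜] X := opFun (iterTikhonov m α) (gram A)

theorem regOp_adjoint_apply (hα : 0 < α) (m : ℕ) (z : Y) :
    regOp m α A (adjoint A z) = adjoint A (regOp m α (adjoint A) z) :=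
  (adjoint_apply_opFun_gram A (continuousOn_iterTikhonov m hα _) z).symm

theorem regOp_gram_apply (hα : 0 < α) (m : ℕ) (x : X) :
    regOp m α A (gram A x) = x - resOp m α A x := by
  have hA := gram_isPositive A
  have h1 : regOp m α A (gram A x) = opFun (fun t => iterTikhonov m α t * t) (gram A) x := by
    rw [opFun_mul_apply hA (g := fun t => t) (continuousOn_iterTikhonov m hα _) continuousOn_id,
      opFun_id hA, regOp]
  have h2 : opFun (fun t => iterTikhonov m α t * t) (gram A)
      = opFun (fun t => 1 - (α / (α + t)) ^ m) (gram A) :=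
    opFun_congr fun t ht => by rw [mul_comm, mul_iterTikhonov_eq m hα ht.1]
  rw [h1, h2, opFun_sub hA continuousOn_const (continuousOn_resolvent_pow hα m _), opFun_const hA]
  simp [resOp]

theorem norm_apply_regOp_le (hα : 0 < α) (m : ℕ) (x : X) :
    ‖A (regOp m α A x)‖ ≤ √m / √α * ‖x‖ := by
  rw [regOp, norm_apply_opFun_gram A (continuousOn_iterTikhonov m hα _)]
  refine norm_opFun_apply_le (gram_isPositive A)
    (Real.continuous_sqrt.continuousOn.mul (continuousOn_iterTikhonov m hα _)) (fun t ht => ?_) x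
  change |√t * iterTikhonov m α t| ≤ √m / √α
  rw [abs_of_nonneg (mul_nonneg (Real.sqrt_nonneg _) (iterTikhonov_nonneg m hα ht.1))]
  exact sqrt_mul_iterTikhonov_le m hα ht.1

theorem norm_regOp_adjoint_apply_le (hα : 0 < α) (m : ℕ) (z : Y) :
    ‖regOp m α A (adjoint A z)‖ ≤ √m / √α * ‖z‖ := by
  rw [regOp_adjoint_apply A hα]; exact norm_apply_regOp_le _ hα m z

theorem regOp_gram_comm (hα : 0 < α) (m : ℕ) (x : X) :
    gram A (regOp m α A x) = regOp m α A (gram A x) := by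
  have hA := gram_isPositive A
  have h1 := opFun_mul_apply hA (f := fun t => t) continuousOn_id
    (continuousOn_iterTikhonov m hα ‖gram A‖) x
  have h2 := opFun_mul_apply hA (g := fun t => t)
    (continuousOn_iterTikhonov m hα ‖gram A‖) continuousOn_id x
  rw [opFun_id hA] at h1 h2
  rw [regOp, ← h1, ← h2]
  simp only [mul_comm]

theorem apply_regOp_adjoint_apply (hα : 0 < α) (m : ℕ) (z : Y) :
    A (regOp m α A (adjoint A z)) = z - resOp m α (adjoint A) z := by
  rw [regOp_adjoint_apply A hα, ← gram_adjoint_apply, regOp_gram_comm _ hα, regOp_gram_apply _ hα]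

theorem norm_sub_apply_regOp_le (hα : 0 < α) (m : ℕ) (z : Y) :
    ‖z - A (regOp m α A (adjoint A z))‖ ≤ ‖z‖ := by
  rw [apply_regOp_adjoint_apply A hα, sub_sub_cancel]
  exact norm_resOp_apply_le _ hα m z

theorem norm_apply_regOp_adjoint_apply_le (hα : 0 < α) (m : ℕ) (z : Y) :
    ‖A (regOp m α A (adjoint A z))‖ ≤ ‖z‖ := by
  have h : A (regOp m α A (adjoint A z))
      = opFun (fun t => 1 - (α / (α + t)) ^ m) (gram (adjoint A)) z := by
    rw [apply_regOp_adjoint_apply A hα, opFun_sub (gram_isPositive _) continuousOn_const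
      (continuousOn_resolvent_pow hα m _), opFun_const (gram_isPositive _)]
    simp [resOp]
  rw [h]
  refine (norm_opFun_apply_le (gram_isPositive _)
    (continuousOn_const.sub (continuousOn_resolvent_pow hα m _)) (M := 1)
    (fun t ht => ?_) z).trans (one_mul _).le
  have h1 := resolvent_pow_le_one hα ht.1 m
  have h2 := pow_pos (resolvent_pos hα ht.1) m
  change |1 - (α / (α + t)) ^ m| ≤ 1
  rw [abs_of_nonneg (by linarith)]; linarith

theorem resOp_one_left_inv (hα : 0 < α) :
    resOp 1 α A * ((α : 𝕜) • 1 + gram A) = (α : 𝕜) • 1 := by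
  have hA := gram_isPositive A
  have hc : ContinuousOn (fun t : ℝ => α + t) (Set.Icc 0 ‖gram A‖) :=
    continuousOn_const.add continuousOn_id
  have h1 : opFun (fun t => α + t) (gram A) = (α : 𝕜) • 1 + gram A := by
    rw [opFun_add hA (g := fun t => t) continuousOn_const continuousOn_id, opFun_const hA,
      opFun_id hA]
  rw [← h1, resOp, ← opFun_mul hA (continuousOn_resolvent_pow hα 1 _) hc, ← opFun_const hA]
  refine opFun_congr fun t ht => ?_
  have : α + t ≠ 0 := by have := ht.1; positivity
  field_simp

theorem resOp_one_right_inv (hα : 0 < α) :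
    ((α : 𝕜) • 1 + gram A) * resOp 1 α A = (α : 𝕜) • 1 := by
  have hA := gram_isPositive A
  have hc : ContinuousOn (fun t : ℝ => α + t) (Set.Icc 0 ‖gram A‖) :=
    continuousOn_const.add continuousOn_id
  have h1 : opFun (fun t => α + t) (gram A) = (α : 𝕜) • 1 + gram A := by
    rw [opFun_add hA (g := fun t => t) continuousOn_const continuousOn_id, opFun_const hA,
      opFun_id hA]
  rw [← h1, resOp, ← opFun_mul hA hc (continuousOn_resolvent_pow hα 1 _), ← opFun_const hA]
  refine opFun_congr fun t ht => ?_
  have : α + t ≠ 0 := by have := ht.1; positivity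
  field_simp

theorem resOp_one_sub (hα : 0 < α) (S T : X →L[𝕜] Y) :
    (α : 𝕜) • (resOp 1 α S - resOp 1 α T) = resOp 1 α S * (gram T - gram S) * resOp 1 α T := by
  have h1 := resOp_one_left_inv S hα
  have h2 := resOp_one_right_inv T hα
  have h3 : gram T - gram S = ((α : 𝕜) • 1 + gram T) - ((α : 𝕜) • 1 + gram S) := by abel
  rw [h3, mul_sub, sub_mul, h1, mul_assoc, h2]
  simp [smul_sub]

/-- Telescoping of the difference of two `m`-th powers, combined with the resolvent identity
`resOp_one_sub`. Each term carries at least one resolvent of `S` on the left and one of `T` on the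
right, so the smoothing bounds with exponent at least one apply on both sides. -/
theorem resOp_sub (hα : 0 < α) (S T : X →L[𝕜] Y) (m : ℕ) :
    (α : 𝕜) • (resOp m α S - resOp m α T)
      = ∑ j ∈ Finset.range m, resOp (j + 1) α S * (gram T - gram S) * resOp (m - j) α T := by
  induction m with
  | zero => simp [resOp_zero S, resOp_zero T]
  | succ m ih =>
    have h1 : resOp (m + 1) α S - resOp (m + 1) α T
        = resOp 1 α S * (resOp m α S - resOp m α T)
          + (resOp 1 α S - resOp 1 α T) * resOp m α T := by
      rw [add_comm m 1, resOp_add S hα, resOp_add T hα]; noncomm_ring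
    rw [h1, smul_add, ← mul_smul_comm, ih, ← smul_mul_assoc, resOp_one_sub hα,
      Finset.sum_range_succ', Finset.mul_sum]
    congr 1
    · refine Finset.sum_congr rfl fun j _ => ?_
      rw [Nat.add_sub_add_right, add_comm (j + 1) 1, resOp_add S hα 1 (j + 1)]
      simp only [mul_assoc]
    · rw [Nat.sub_zero, zero_add, add_comm m 1, resOp_add T hα 1 m]
      simp only [mul_assoc]

/-- The free operator `U` lets the same sum be estimated in `X` (with the identity) and in `Y` (with
`S`). -/
theorem norm_resOp_sub_apply_le (hα : 0 < α) (S T : X →L[𝕜] Y) (m : ℕ) (e : X) {Z : Type*}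
    [NormedAddCommGroup Z] [NormedSpace 𝕜 Z] (U : X →L[𝕜] Z) {M : ℝ}
    (h : ∀ i j : ℕ, 1 ≤ i → 1 ≤ j →
      ‖U (resOp i α S ((gram T - gram S) (resOp j α T e)))‖ ≤ α * M) :
    ‖U (resOp m α S e - resOp m α T e)‖ ≤ m * M := by
  have h1 := congrArg (fun W : X →L[𝕜] X => U (W e)) (resOp_sub hα S T m)
  simp only [smul_apply, map_smul, sum_apply, map_sum] at h1
  have h2 : α * ‖U (resOp m α S e - resOp m α T e)‖ ≤ α * (m * M) := by
    calc α * ‖U (resOp m α S e - resOp m α T e)‖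
        = ‖(α : 𝕜) • U ((resOp m α S - resOp m α T) e)‖ := by
          rw [norm_smul, RCLike.norm_ofReal, abs_of_pos hα, sub_apply]
      _ = _ := by rw [h1]
      _ ≤ ∑ j ∈ Finset.range m, α * M := by
          refine norm_sum_le_of_le _ fun j hj => h (j + 1) (m - j) (by lia) ?_
          have := Finset.mem_range.1 hj
          lia
      _ = α * (m * M) := by simp; ring
  exact le_of_mul_le_mul_left h2 hα

/-- In this splitting `S*` stands next to the resolvents of `S*S` on its left and `T` next to those
of `T*T` on its right, so each unbalanced factor gains a power of `√α`. -/
theorem gram_sub_gram (S T : X →L[𝕜] Y) (x : X) :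
    (gram T - gram S) x = adjoint S ((T - S) x) + adjoint (T - S) (T x) := by
  simp only [sub_apply, gram_apply, map_sub]
  abel

end Operators

/-! ### Perturbations of the linear method and what the discrepancy principle implies for them. -/

section Abstract

open ContinuousLinearMap
open scoped InnerProductSpace

variable {𝕜 : Type u} {X : Type v} {Y : Type w} [RCLike 𝕜]
  [NormedAddCommGroup X] [InnerProductSpace 𝕜 X]
  [NormedAddCommGroup Y] [InnerProductSpace 𝕜 Y]

/-- The norm of `x` that is scaled like the residual: `√a ‖x‖ + ‖T x‖`. -/
def scaledNorm (T : X →L[𝕜] Y) (a : ℝ) (x : X) : ℝ := √a * ‖x‖ + ‖T x‖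

theorem scaledNorm_nonneg (T : X →L[𝕜] Y) (a : ℝ) (x : X) : 0 ≤ scaledNorm T a x := by
  unfold scaledNorm; positivity

variable [CompleteSpace X] [CompleteSpace Y]

/-- The regularization parameters: positive, decreasing at most by the factor `r`, and starting
with an `α 0` for which the residual function is at least `3/4` on the spectrum of `T* T`. -/
structure AdmissibleParameters (m : ℕ) (r : ℝ) (T : X →L[𝕜] Y) (α : ℕ → ℝ) : Prop where
  one_le : 1 ≤ r
  pos : ∀ k, 0 < α k
  anti : ∀ k, α (k + 1) ≤ α k
  le_mul : ∀ k, α k ≤ r * α (k + 1)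
  start : ∀ t ∈ Set.Icc 0 ‖gram T‖, 3 / 4 ≤ (α 0 / (α 0 + t)) ^ m

/-- Iterates with errors `e k` and residuals `R k` that follow, up to index `N`, the linear method
with the operator `T` applied to the initial error `e0` and the data error `ξ`, up to
perturbations of relative size `ε`. -/
structure NearLinear (m : ℕ) (T : X →L[𝕜] Y) (α : ℕ → ℝ) (e0 : X) (ξ : Y) (δ ε : ℝ) (N : ℕ)
    (e : ℕ → X) (R : ℕ → Y) : Prop where
  data : ‖ξ‖ ≤ δ
  zero : e 0 = e0
  error : ∀ k < N, √(α k) * ‖e (k + 1) - resOp m (α k) T e0‖ ≤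
    ε * scaledNorm T (α k) (e k) + √m * δ
  image : ∀ k < N, ‖T (e (k + 1) - resOp m (α k) T e0) + ξ‖ ≤
    ε * scaledNorm T (α k) (e k) + (1 + ε) * δ
  residual : ∀ k ≤ N, ‖R k - ξ - T (e k)‖ ≤ ε * scaledNorm T (α k) (e k)

/-- The initial error has not been filtered. Since the residual function at `α 0` is at least `3/4`
on the spectrum, filtering it changes its size only by a fixed factor, so index `0` can be treated
like the others. -/
theorem scaledNorm_start_le {m : ℕ} {r : ℝ} {T : X →L[𝕜] Y} {α : ℕ → ℝ}
    (hα : AdmissibleParameters m r T α) (x : X) :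
    scaledNorm T (α 0) x ≤ 4 / 3 * scaledNorm T (α 0) (resOp m (α 0) T x) := by
  have h1 := norm_le_norm_resOp T (hα.pos 0) (by norm_num) m hα.start x
  have h2 := norm_apply_le_norm_apply_resOp T (hα.pos 0) (by norm_num) m hα.start x
  unfold scaledNorm
  have h3 := mul_le_mul_of_nonneg_left h1 (Real.sqrt_nonneg (α 0))
  norm_num at h1 h2 h3
  linarith

theorem AdmissibleParameters.sqrt_le {m : ℕ} {r : ℝ} {T : X →L[𝕜] Y} {α : ℕ → ℝ}
    (hα : AdmissibleParameters m r T α) (k : ℕ) : √(α k) ≤ √r * √(α (k + 1)) := by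
  rw [← Real.sqrt_mul (by linarith [hα.one_le])]
  exact Real.sqrt_le_sqrt (hα.le_mul k)

theorem sqrt_le_self_of_one_le {r : ℝ} (hr : 1 ≤ r) : √r ≤ r := by
  rw [Real.sqrt_le_left (by linarith)]; nlinarith

theorem scaledNorm_resOp_le {m : ℕ} {r : ℝ} {T : X →L[𝕜] Y} {α : ℕ → ℝ}
    (hα : AdmissibleParameters m r T α) (k : ℕ) (x : X) :
    scaledNorm T (α k) (resOp m (α k) T x) ≤
      r ^ (m + 1) * scaledNorm T (α (k + 1)) (resOp m (α (k + 1)) T x) := by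
  have hr := hα.one_le
  have h1 := norm_resOp_le_norm_resOp T (hα.pos k) (hα.pos (k + 1)) hr (hα.le_mul k) m x
  have h2 := norm_apply_resOp_le_norm_apply_resOp T (hα.pos k) (hα.pos (k + 1)) hr
    (hα.le_mul k) m x
  have h3 : √(α k) ≤ r * √(α (k + 1)) := (hα.sqrt_le k).trans (by
    gcongr; exact sqrt_le_self_of_one_le hr)
  unfold scaledNorm
  calc _ ≤ r * √(α (k + 1)) * (r ^ m * ‖resOp m (α (k + 1)) T x‖)
        + r * (r ^ m * ‖T (resOp m (α (k + 1)) T x)‖) := by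
        gcongr
        exact h2.trans (le_mul_of_one_le_left (by positivity) hr)
    _ = _ := by ring

namespace NearLinear

variable {m : ℕ} {r τ : ℝ} {T : X →L[𝕜] Y} {α : ℕ → ℝ} {e0 : X} {ξ : Y} {δ ε : ℝ} {N : ℕ}
  {e : ℕ → X} {R : ℕ → Y}

theorem delta_nonneg (h : NearLinear m T α e0 ξ δ ε N e R) : 0 ≤ δ := (norm_nonneg _).trans h.data

theorem scaledNorm_succ_le (h : NearLinear m T α e0 ξ δ ε N e R)
    (hα : AdmissibleParameters m r T α) {k : ℕ} (hk : k < N) :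
    scaledNorm T (α (k + 1)) (e (k + 1)) ≤ scaledNorm T (α k) (resOp m (α k) T e0)
      + 2 * ε * scaledNorm T (α k) (e k) + (√m + 2 + ε) * δ := by
  have h1 := h.error k hk
  have h2 := h.image k hk
  have h3 : ‖e (k + 1)‖ ≤ ‖e (k + 1) - resOp m (α k) T e0‖ + ‖resOp m (α k) T e0‖ := by
    simpa using norm_add_le (e (k + 1) - resOp m (α k) T e0) (resOp m (α k) T e0)
  have h4 : ‖T (e (k + 1))‖ ≤ ‖T (e (k + 1) - resOp m (α k) T e0) + ξ‖ + ‖ξ‖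
      + ‖T (resOp m (α k) T e0)‖ := by
    have : T (e (k + 1)) = (T (e (k + 1) - resOp m (α k) T e0) + ξ) - ξ
        + T (resOp m (α k) T e0) := by rw [map_sub]; abel
    conv_lhs => rw [this]
    exact (norm_add_le _ _).trans (add_le_add (norm_sub_le _ _) le_rfl)
  have h5 : √(α (k + 1)) ≤ √(α k) := Real.sqrt_le_sqrt (hα.anti k)
  have h6 := h.data
  have h7 : √(α (k + 1)) * ‖e (k + 1)‖ ≤ √(α k) * (‖e (k + 1) - resOp m (α k) T e0‖
      + ‖resOp m (α k) T e0‖) := by gcongr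
  rw [scaledNorm, scaledNorm.eq_1 T (α k) (resOp m (α k) T e0)]
  linarith

/-- The errors inherit the size of the linear approximations: `scaledNorm_succ_le` is a recursion
with factor `2 ε`, and `ε` beats the loss `r^(m+1)` incurred in passing from `α k` to `α (k + 1)`.
The second clause keeps the parameter of the preceding step, because the stopping argument compares
`e (j + 1)` with the linear approximation at `α j`. -/
theorem scaledNorm_le (h : NearLinear m T α e0 ξ δ ε N e R)
    (hα : AdmissibleParameters m r T α) (hε0 : 0 ≤ ε) (hε : 4 * r ^ (m + 1) * ε ≤ 1) {k : ℕ}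
    (hk : k ≤ N) : scaledNorm T (α k) (e k) ≤
      2 * r ^ (m + 1) * (√m + 4) * (scaledNorm T (α k) (resOp m (α k) T e0) + δ) ∧
      (∀ j, k = j + 1 → scaledNorm T (α k) (e k) ≤
      2 * r ^ (m + 1) * (√m + 4) * (scaledNorm T (α j) (resOp m (α j) T e0) + δ)) := by
  have hδ := h.delta_nonneg
  have hρ : 1 ≤ r ^ (m + 1) := one_le_pow₀ hα.one_le
  set ρ := r ^ (m + 1)
  have hm := Real.sqrt_nonneg (m : ℝ)
  have hε1 : ε ≤ 1 := by nlinarith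
  induction k with
  | zero =>
    have h1 := scaledNorm_start_le hα e0
    have h2 := scaledNorm_nonneg T (α 0) (resOp m (α 0) T e0)
    refine ⟨?_, fun j hj => by lia⟩
    rw [h.zero]
    refine h1.trans ?_
    have h3 : 4 / 3 ≤ 2 * ρ * (√m + 4) := by nlinarith
    nlinarith
  | succ k ih =>
    have h1 := h.scaledNorm_succ_le hα (k := k) (by lia)
    have h2 := (ih (by lia)).1
    have h3 := scaledNorm_resOp_le hα k e0
    have h4 := scaledNorm_nonneg T (α k) (resOp m (α k) T e0)
    have h5 := scaledNorm_nonneg T (α (k + 1)) (resOp m (α (k + 1)) T e0)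
    set H := scaledNorm T (α k) (resOp m (α k) T e0)
    set H' := scaledNorm T (α (k + 1)) (resOp m (α (k + 1)) T e0)
    set σ := scaledNorm T (α k) (e k)
    have h6 : 2 * ε * σ ≤ (√m + 4) * (H + δ) := by
      calc 2 * ε * σ ≤ 2 * ε * (2 * ρ * (√m + 4) * (H + δ)) := by gcongr
        _ = (4 * ρ * ε) * ((√m + 4) * (H + δ)) := by ring
        _ ≤ 1 * ((√m + 4) * (H + δ)) := by gcongr
        _ = _ := one_mul _
    have h7 : scaledNorm T (α (k + 1)) (e (k + 1)) ≤ 2 * (√m + 4) * (H + δ) := by nlinarith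
    constructor
    · refine h7.trans ?_
      have h8 : H + δ ≤ ρ * (H' + δ) := by nlinarith
      calc 2 * (√m + 4) * (H + δ) ≤ 2 * (√m + 4) * (ρ * (H' + δ)) := by gcongr
        _ = _ := by ring
    · intro j hj
      obtain rfl : k = j := by lia
      refine h7.trans ?_
      rw [show 2 * ρ * (√m + 4) * (H + δ) = ρ * (2 * (√m + 4) * (H + δ)) by ring]
      exact le_mul_of_one_le_left (by positivity) hρ

end NearLinear

/-- The size of the perturbations that is admissible in `NearLinear`. -/
def perturbationBound (m : ℕ) (r τ : ℝ) : ℝ :=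
  min (τ - 1) 1 / (64 * (r ^ (m + 1) * (√m + 4)))

theorem perturbationBound_pos (m : ℕ) {r τ : ℝ} (hr : 1 ≤ r) (hτ : 1 < τ) :
    0 < perturbationBound m r τ := by
  have : 0 < min (τ - 1) 1 := lt_min (by linarith) one_pos
  unfold perturbationBound
  positivity

theorem perturbationBound_spec (m : ℕ) {r τ ε : ℝ} (hr : 1 ≤ r)
    (hε0 : 0 ≤ ε) (hε : ε ≤ perturbationBound m r τ) :
    16 * ((2 * r ^ (m + 1) * (√m + 4)) * ε) ≤ 1 ∧
      4 * (2 * ((2 * r ^ (m + 1) * (√m + 4)) * ε)) ≤ τ - 1 ∧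
      4 * r ^ (m + 1) * ε ≤ 1 ∧ 64 * ε ≤ 1 ∧ 64 * ε ≤ τ - 1 := by
  have hρ : 1 ≤ r ^ (m + 1) := one_le_pow₀ hr
  have hm := Real.sqrt_nonneg (m : ℝ)
  rw [perturbationBound, le_div_iff₀ (by positivity)] at hε
  have h1 : ε * (64 * (r ^ (m + 1) * (√m + 4))) ≤ 1 := hε.trans (min_le_right _ _)
  have h2 : ε * (64 * (r ^ (m + 1) * (√m + 4))) ≤ τ - 1 := hε.trans (min_le_left _ _)
  have h3 : r ^ (m + 1) * ε ≤ r ^ (m + 1) * (√m + 4) * ε := by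
    refine mul_le_mul_of_nonneg_right ?_ hε0
    nlinarith
  have h4 : ε ≤ r ^ (m + 1) * ε := le_mul_of_one_le_left hε0 hρ
  refine ⟨?_, ?_, ?_, ?_, ?_⟩ <;> nlinarith

/-- What the stopping rule says about the error `x` at the stopping index. -/
structure StoppedError (m : ℕ) (C τ δ : ℝ) (T : X →L[𝕜] Y) (e0 x h : X) (D : ℝ) : Prop where
  filtered : ∃ (n : ℕ) (a : ℝ), 0 < a ∧ h = resOp n a T e0
  close : ‖x - h‖ ≤ 1 / 4 * ‖x‖ + C * D
  noise : D = 0 ∨ ∃ a > 0, D = δ / √a ∧ (τ - 1) * δ ≤ 4 * scaledNorm T a (resOp m a T e0)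

-- The discrepancy principle at `N` controls `T (e N)` and thereby the perturbation, giving
-- closeness to the linear approximation. Its failure at the index before bounds `δ` from above by
-- the linear residual, giving the noise clause.
set_option maxHeartbeats 600000 in
theorem NearLinear.exists_stoppedError {m : ℕ} {r τ : ℝ} {T : X →L[𝕜] Y} {α : ℕ → ℝ} {e0 : X}
    {ξ : Y} {δ ε : ℝ} {N : ℕ} {e : ℕ → X} {R : ℕ → Y} (h : NearLinear m T α e0 ξ δ ε N e R)
    (hα : AdmissibleParameters m r T α) (hτ : 1 < τ) (hε0 : 0 ≤ ε)
    (hε : ε ≤ perturbationBound m r τ) (hdisc : ‖R N‖ ≤ τ * δ) (hbefore : ∀ j < N, τ * δ < ‖R j‖) :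
    ∃ (z : X) (D : ℝ), StoppedError m (2 * r * (τ + 6 + √m)) τ δ T e0 (e N) z D := by
  have hδ := h.delta_nonneg
  have hr := hα.one_le
  have hm := Real.sqrt_nonneg (m : ℝ)
  obtain ⟨hC1, hC2, hC3, hε1, hε2⟩ := perturbationBound_spec m hr hε0 hε
  set C := 2 * r ^ (m + 1) * (√m + 4)
  cases N with
  | zero =>
    -- Stopping at once: the error is `e0` itself, filtered with exponent `0`, and there is no noise
    -- term.
    refine ⟨e0, 0, ⟨0, 1, one_pos, by simp [resOp_zero]⟩, ?_, Or.inl rfl⟩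
    rw [h.zero]; simp
  | succ k =>
    have hξ := h.data
    have hres (j : ℕ) (hj : j ≤ k + 1) : ‖R j - ξ - T (e j)‖ ≤
        ε * scaledNorm T (α j) (e j) := h.residual j hj
    -- The residual at `k` is governed by the filter at `α (k - 1)`, so `j = k - 1`; for `k = 0` it
    -- is governed by `e0` itself, and `j = 0` is used via `scaledNorm_start_le`.
    obtain ⟨j, hj1, hj2⟩ : ∃ j, α j ≤ r * α k ∧
        (τ - 1) * δ ≤ 4 * scaledNorm T (α j) (resOp m (α j) T e0) := by
      cases k with
      | zero =>
        refine ⟨0, le_mul_of_one_le_left (hα.pos 0).le hr, ?_⟩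
        have h1 := hbefore 0 (by lia)
        have h2 := hres 0 (by lia)
        have h3 := scaledNorm_start_le hα e0
        rw [h.zero] at h2
        have h4 : ‖R 0‖ ≤ ‖R 0 - ξ - T e0‖ + ‖ξ‖ + ‖T e0‖ := by
          have : R 0 = (R 0 - ξ - T e0) + ξ + T e0 := by abel
          conv_lhs => rw [this]
          exact norm_add₃_le
        have h5 : ‖T e0‖ ≤ scaledNorm T (α 0) e0 := by
          rw [scaledNorm]; exact le_add_of_nonneg_left (by positivity)
        have h6 := scaledNorm_nonneg T (α 0) e0
        nlinarith
      | succ k =>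
        refine ⟨k, hα.le_mul k, ?_⟩
        have h1 := hbefore (k + 1) (by lia)
        have h2 := hres (k + 1) (by lia)
        have h3 := h.image k (by lia)
        have h4 : ‖R (k + 1)‖ ≤ ‖R (k + 1) - ξ - T (e (k + 1))‖
            + ‖T (e (k + 1) - resOp m (α k) T e0) + ξ‖ + ‖T (resOp m (α k) T e0)‖ := by
          have : R (k + 1) = (R (k + 1) - ξ - T (e (k + 1)))
              + (T (e (k + 1) - resOp m (α k) T e0) + ξ) + T (resOp m (α k) T e0) := by
            rw [map_sub]; abel
          conv_lhs => rw [this]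
          exact norm_add₃_le
        have h5 : ‖T (resOp m (α k) T e0)‖ ≤ scaledNorm T (α k) (resOp m (α k) T e0) := by
          rw [scaledNorm.eq_1 T (α k) (resOp m (α k) T e0)]
          exact le_add_of_nonneg_left (by positivity)
        have h6 := (h.scaledNorm_le hα hε0 hC3 (k := k + 1) (by lia)).2 k rfl
        have h7 := (h.scaledNorm_le hα hε0 hC3 (k := k) (by lia)).1
        have h8 := scaledNorm_nonneg T (α k) (resOp m (α k) T e0)
        set H := scaledNorm T (α k) (resOp m (α k) T e0)
        have h9 := mul_le_mul_of_nonneg_left h6 hε0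
        have h10 := mul_le_mul_of_nonneg_left h7 hε0
        have h11 : C * ε * H ≤ 1 / 16 * H := by nlinarith
        have h12 : 8 * (C * ε * δ) ≤ (τ - 1) * δ := by nlinarith
        have h13 : 64 * ε * δ ≤ (τ - 1) * δ := by gcongr
        nlinarith
    set a := √(α k) with ha
    have hapos : 0 < a := Real.sqrt_pos.2 (hα.pos k)
    refine ⟨resOp m (α k) T e0, δ / √(α j), ⟨m, α k, hα.pos k, rfl⟩, ?_,
      Or.inr ⟨α j, hα.pos j, rfl, hj2⟩⟩
    set z := resOp m (α k) T e0
    set x := e (k + 1)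
    have h1 := h.error k (by lia)
    have h2 := h.image k (by lia)
    have h3 := hres (k + 1) le_rfl
    -- The residual is at most `τ δ` here, which bounds `T x`, then `T z`. The perturbation terms
    -- are thus reduced to `a ‖z‖` and `δ`, and dividing by `a = √(α k)` gives the claim.
    have h4 : ‖T x‖ ≤ ‖R (k + 1) - ξ - T x‖ + ‖R (k + 1)‖ + ‖ξ‖ := by
      have : T x = R (k + 1) - (R (k + 1) - ξ - T x) - ξ := by abel
      conv_lhs => rw [this]
      exact (norm_sub_le _ _).trans (add_le_add ((norm_sub_le _ _).trans (add_comm _ _).le) le_rfl)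
    have h5 : ‖T z‖ ≤ ‖T x‖ + ‖T (x - z) + ξ‖ + ‖ξ‖ := by
      have : T z = T x - (T (x - z) + ξ) + ξ := by rw [map_sub]; abel
      conv_lhs => rw [this]
      exact (norm_add_le _ _).trans (add_le_add (norm_sub_le _ _) le_rfl)
    have h6 := (h.scaledNorm_le hα hε0 hC3 (k := k + 1) le_rfl).2 k rfl
    have h7 := (h.scaledNorm_le hα hε0 hC3 (k := k) (by lia)).1
    have h8 : scaledNorm T (α k) z = a * ‖z‖ + ‖T z‖ := rfl
    rw [h8] at h6 h7
    have h9 := mul_le_mul_of_nonneg_left h6 hε0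
    have h10 := mul_le_mul_of_nonneg_left h7 hε0
    have h11 : ε * (C * (a * ‖z‖ + ‖T z‖ + δ)) ≤ 1 / 16 * (a * ‖z‖ + ‖T z‖ + δ) := by
      have : 0 ≤ a * ‖z‖ + ‖T z‖ + δ := by positivity
      nlinarith
    have h12 : ε * δ ≤ δ := by nlinarith
    have hz0 : 0 ≤ a * ‖z‖ := by positivity
    have hτδ : 0 ≤ τ * δ := by positivity
    have hmδ : 0 ≤ √m * δ := by positivity
    have h13 : ‖T z‖ ≤ 1 / 7 * (a * ‖z‖) + 2 * (τ + 5) * δ := by linarith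
    have h14 : a * ‖x - z‖ ≤ 1 / 8 * (a * ‖z‖) + (τ + 6 + √m) * δ := by linarith
    have h15 : a * ‖z‖ ≤ a * ‖x‖ + a * ‖x - z‖ := by
      rw [← mul_add]
      gcongr
      have : z = x - (x - z) := by abel
      conv_lhs => rw [this]
      exact norm_sub_le _ _
    have h16 : a * ‖x - z‖ ≤ 1 / 4 * (a * ‖x‖) + 2 * (τ + 6 + √m) * δ := by
      have : 0 ≤ a * ‖x‖ := by positivity
      linarith
    have h17 : √(α j) ≤ r * a := by
      calc √(α j) ≤ √(r * α k) := Real.sqrt_le_sqrt hj1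
        _ = √r * a := Real.sqrt_mul (by linarith) _
        _ ≤ r * a := by gcongr; exact sqrt_le_self_of_one_le hr
    have hjpos : 0 < √(α j) := Real.sqrt_pos.2 (hα.pos j)
    have h18 : δ / a ≤ r * (δ / √(α j)) := by
      rw [← mul_div_assoc, div_le_div_iff₀ hapos hjpos]
      calc δ * √(α j) ≤ δ * (r * a) := by gcongr
        _ = r * δ * a := by ring
    have h19 : ‖x - z‖ ≤ 1 / 4 * ‖x‖ + 2 * (τ + 6 + √m) * (δ / a) := by
      have : ‖x - z‖ = (a * ‖x - z‖) / a := by field_simp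
      rw [this, div_le_iff₀ hapos]
      refine h16.trans (le_of_eq ?_)
      field_simp
    refine h19.trans ?_
    have : 0 ≤ 2 * (τ + 6 + √m) := by positivity
    calc _ ≤ 1 / 4 * ‖x‖ + 2 * (τ + 6 + √m) * (r * (δ / √(α j))) := by gcongr
      _ = _ := by ring

end Abstract

/-! ### Testing against a dense subspace. -/

section InnerRange

open scoped InnerProductSpace

variable {𝕜 : Type u} {Y : Type w} [RCLike 𝕜] [NormedAddCommGroup Y] [InnerProductSpace 𝕜 Y]

theorem norm_le_of_inner_range {S : Submodule 𝕜 Y} {z : Y} (hz : z ∈ S.topologicalClosure) {c : ℝ}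
    (hc : 0 ≤ c) (h : ∀ y ∈ S, ‖⟪z, y⟫_𝕜‖ ≤ c * ‖y‖) : ‖z‖ ≤ c := by
  have hcl : IsClosed {y : Y | ‖⟪z, y⟫_𝕜‖ ≤ c * ‖y‖} :=
    isClosed_le (by fun_prop) (by fun_prop)
  have h1 : ‖⟪z, z⟫_𝕜‖ ≤ c * ‖z‖ := closure_minimal h hcl hz
  rw [inner_self_eq_norm_sq_to_K] at h1
  simp only [norm_pow, RCLike.norm_ofReal, abs_norm] at h1
  nlinarith [norm_nonneg z]

end InnerRange

/-! ### Error bounds at the stopping index with a free parameter, and the polar decomposition. -/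

section Stopped

open ContinuousLinearMap
open scoped InnerProductSpace

variable {𝕜 : Type u} {X : Type v} {Y : Type w} [RCLike 𝕜]
  [NormedAddCommGroup X] [InnerProductSpace 𝕜 X] [CompleteSpace X]
  [NormedAddCommGroup Y] [InnerProductSpace 𝕜 Y] [CompleteSpace Y]

variable {m : ℕ} {C τ δ : ℝ} {T : X →L[𝕜] Y} {e0 x h : X} {D : ℝ}

/-- Split `x = r_β(T*T) x + g_β(T*T) T*T x`. The second part is of order `‖T x‖/√β`. In the first,
`x` is replaced by `h`, whose filter commutes with `r_β(T*T)` and is a contraction; the error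
`‖x‖/4` made by this is absorbed on the left. -/
theorem StoppedError.norm_le (H : StoppedError m C τ δ T e0 x h D) (hC : 0 ≤ C) (hD : 0 ≤ D)
    (hδ : 0 ≤ δ) {C₂ : ℝ} (hC₂ : 0 ≤ C₂) (hx : ‖T x‖ ≤ C₂ * δ) {β : ℝ} (hβ : 0 < β) :
    ‖x‖ ≤ 2 * (1 + √m * C₂ + C) * (‖resOp m β T e0‖ + δ / √β + D) := by
  obtain ⟨n, a, ha, hh⟩ := H.filtered
  have hm := Real.sqrt_nonneg (m : ℝ)
  have h1 : ‖x‖ ≤ ‖resOp m β T x‖ + √m / √β * (C₂ * δ) := by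
    have h2 := regOp_gram_apply T hβ m x
    have h3 := norm_regOp_adjoint_apply_le T hβ m (T x)
    rw [← gram_apply, h2] at h3
    calc ‖x‖ = ‖resOp m β T x + (x - resOp m β T x)‖ := by rw [add_sub_cancel]
      _ ≤ _ := (norm_add_le _ _).trans (add_le_add le_rfl (h3.trans (by gcongr)))
  have h2 : ‖resOp m β T x‖ ≤ ‖resOp m β T e0‖ + ‖x - h‖ := by
    have h3 : ‖resOp m β T h‖ ≤ ‖resOp m β T e0‖ := by
      rw [hh, resOp_comm T hβ ha]; exact norm_resOp_apply_le T ha n _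
    calc ‖resOp m β T x‖ = ‖resOp m β T h + resOp m β T (x - h)‖ := by
          rw [← map_add, add_sub_cancel]
      _ ≤ _ := (norm_add_le _ _).trans (add_le_add h3 (norm_resOp_apply_le T hβ m _))
  have h3 := H.close
  have h4 : √m / √β * (C₂ * δ) = √m * C₂ * (δ / √β) := by ring
  rw [h4] at h1
  have h5 : 0 ≤ δ / √β := by positivity
  have h6 := norm_nonneg (resOp m β T e0)
  have h7 : 0 ≤ √m * C₂ := by positivity
  set q := δ / √β
  set z := ‖resOp m β T e0‖
  have h8 : ‖x‖ ≤ 2 * (z + √m * C₂ * q + C * D) := by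
    have : 0 ≤ z + √m * C₂ * q + C * D := by positivity
    linarith
  refine h8.trans ?_
  rw [mul_assoc]
  have : z + √m * C₂ * q + C * D ≤ (1 + √m * C₂ + C) * (z + q + D) := by
    have : (1 + √m * C₂ + C) * (z + q + D) = (z + √m * C₂ * q + C * D) +
      (q + D + √m * C₂ * (z + D) + C * (z + q)) := by ring
    rw [this]
    exact le_add_of_nonneg_right (by positivity)
  linarith

theorem le_of_sq_le_mul_add {E Q c : ℝ} (hQ : 0 ≤ Q) (hc : 0 ≤ c) (h : E ^ 2 ≤ c * Q * (Q + E)) :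
    E ≤ (c + 1) * Q := by
  by_contra! hlt
  have h1 : 0 ≤ (c + 1) * Q := by positivity
  nlinarith [mul_nonneg hc hQ, mul_nonneg (mul_nonneg hc hQ) hQ]

/-- The analogue of `StoppedError.norm_le` for `e0 = T* u` when the remainder `T x - d` is only
quadratically small. -/
theorem StoppedError.norm_le_of_source (H : StoppedError m C τ δ T e0 x h D) (hC : 0 ≤ C)
    (hD : 0 ≤ D) (hδ : 0 ≤ δ) {u d : Y} (hu : e0 = adjoint T u) {L C₂ : ℝ}
    (hC₂ : 0 ≤ C₂) (hd : ‖d‖ ≤ C₂ * δ) (hx : ‖T x - d‖ ≤ L * ‖x‖ ^ 2) (hL : 0 ≤ L)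
    (hLu : L * ‖u‖ ≤ 1 / 4)
    {β M : ℝ} (hβ : 0 < β) (hM : 0 ≤ M) (hβu : √β * ‖resOp m β (adjoint T) u‖ ≤ M) :
    ‖x‖ ≤ (2 * C₂ * (1 + 2 * √m * (1 + C)) + 2 * C + 1) * (M + δ / √β + D) := by
  obtain ⟨n, a, ha, hh⟩ := H.filtered
  have hm := Real.sqrt_nonneg (m : ℝ)
  have hb : 0 < √β := Real.sqrt_pos.2 hβ
  set v := resOp n a (adjoint T) u
  -- The filtered vector again lies in the range of `T*`, with a source element no larger than `u`.
  have hv : h = adjoint T v := by rw [hh, hu, resOp_adjoint_apply T ha]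
  have hvu : ‖v‖ ≤ ‖u‖ := norm_resOp_apply_le _ ha n u
  have hclose := H.close
  have h0 : ‖h‖ ≤ 2 * ‖x‖ + C * D := by
    have h1 : ‖h‖ ≤ ‖x‖ + ‖x - h‖ := by
      calc ‖h‖ = ‖x - (x - h)‖ := by rw [sub_sub_cancel]
        _ ≤ _ := norm_sub_le _ _
    have := norm_nonneg x
    linarith
  -- the dual element is small
  have hvs : ‖v‖ ≤ M / √β + √m / √β * (2 * ‖x‖ + C * D) := by
    have h1 := apply_regOp_adjoint_apply T hβ m v
    have h2 := norm_apply_regOp_le T hβ m (adjoint T v)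
    rw [h1, ← hv] at h2
    have h3 : ‖resOp m β (adjoint T) v‖ ≤ M / √β := by
      rw [resOp_comm _ hβ ha, le_div_iff₀ hb, mul_comm]
      refine le_trans ?_ hβu
      gcongr
      exact norm_resOp_apply_le _ ha n _
    calc ‖v‖ = ‖resOp m β (adjoint T) v + (v - resOp m β (adjoint T) v)‖ := by
          rw [add_sub_cancel]
      _ ≤ _ := (norm_add_le _ _).trans (add_le_add h3 (h2.trans (by gcongr)))
  -- Duality: `⟨x, x⟩ = ⟨T x, v⟩ + ⟨x, x - h⟩`. The quadratic remainder in `T x` is then multiplied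
  -- by `v`, and `L ‖v‖ ≤ 1/4` lets it be absorbed.
  have h1 : ‖x‖ ^ 2 ≤ C₂ * δ * ‖v‖ + L * ‖x‖ ^ 2 * ‖v‖ + ‖x‖ * (1 / 4 * ‖x‖ + C * D) := by
    have h2 : ⟪x, x⟫_𝕜 = ⟪d, v⟫_𝕜 + ⟪T x - d, v⟫_𝕜 + ⟪x, x - h⟫_𝕜 := by
      rw [← inner_add_left, add_sub_cancel, ← adjoint_inner_right, ← hv, ← inner_add_right,
        add_sub_cancel]
    have h3 : ‖x‖ ^ 2 = ‖⟪x, x⟫_𝕜‖ := by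
      rw [inner_self_eq_norm_sq_to_K]; simp
    have h4 : ‖x‖ ^ 2 ≤ ‖⟪d, v⟫_𝕜‖ + ‖⟪T x - d, v⟫_𝕜‖ + ‖⟪x, x - h⟫_𝕜‖ := by
      rw [h3, h2]; exact norm_add₃_le
    refine h4.trans (add_le_add (add_le_add ?_ ?_) ?_)
    · exact (norm_inner_le_norm _ _).trans (by gcongr)
    · exact (norm_inner_le_norm _ _).trans (by gcongr)
    · exact (norm_inner_le_norm _ _).trans (by gcongr)
  have h2 : L * ‖x‖ ^ 2 * ‖v‖ ≤ 1 / 4 * ‖x‖ ^ 2 := by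
    calc L * ‖x‖ ^ 2 * ‖v‖ ≤ L * ‖x‖ ^ 2 * ‖u‖ := by gcongr
      _ = L * ‖u‖ * ‖x‖ ^ 2 := by ring
      _ ≤ _ := by gcongr
  set E := ‖x‖ with hE
  have hE0 : 0 ≤ E := norm_nonneg x
  set q := δ / √β with hq
  have hq0 : 0 ≤ q := by positivity
  have h3 : E ^ 2 ≤ 2 * C₂ * q * (M + √m * (2 * E + C * D)) + 2 * C * D * E := by
    have h4 : C₂ * δ * ‖v‖ ≤ C₂ * q * (M + √m * (2 * E + C * D)) := by
      calc C₂ * δ * ‖v‖ ≤ C₂ * δ * (M / √β + √m / √β * (2 * E + C * D)) := by gcongr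
        _ = _ := by rw [hq]; ring
    nlinarith
  set Q := M + q + D
  have hQ : 0 ≤ Q := by positivity
  have hqQ : q ≤ Q := by linarith
  have hMQ : M ≤ Q := by linarith
  have hDQ : D ≤ Q := by linarith
  have h4 : E ^ 2 ≤ (2 * C₂ * (1 + 2 * √m * (1 + C)) + 2 * C) * Q * (Q + E) := by
    calc E ^ 2 ≤ 2 * C₂ * q * (M + √m * (2 * E + C * D)) + 2 * C * D * E := h3
      _ ≤ 2 * C₂ * Q * (Q + √m * (2 * E + C * Q)) + 2 * C * Q * E := by gcongr
      _ ≤ _ := by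
        have e : (2 * C₂ * (1 + 2 * √m * (1 + C)) + 2 * C) * Q * (Q + E)
          = 2 * C₂ * Q * (Q + √m * (2 * E + C * Q)) + 2 * C * Q * E
          + (2 * C₂ * Q * (E + √m * (2 * Q + C * Q + 2 * C * E)) + 2 * C * Q * Q) := by ring
        rw [e]
        exact le_add_of_nonneg_right (by positivity)
  exact le_of_sq_le_mul_add hQ (by positivity) h4

theorem ker_adjoint_orthogonal (T : X →L[𝕜] Y) :
    (LinearMap.ker (adjoint T : Y →ₗ[𝕜] X))ᗮ
      = (LinearMap.range (T : X →ₗ[𝕜] Y)).topologicalClosure := by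
  have := orthogonal_ker (adjoint T)
  rwa [adjoint_adjoint] at this

/-- For every `x`, `⟨z, T x⟩ = ⟨v, (T*T)^(1/2) x⟩`, and `‖(T*T)^(1/2) x‖ = ‖T x‖`. As `z` lies in
the closure of the range of `T`, these inner products determine its norm. -/
theorem norm_le_of_adjoint_eq_sqrt {z : Y}
    (hz : z ∈ (LinearMap.ker (adjoint T : Y →ₗ[𝕜] X))ᗮ) {v : X}
    (h : adjoint T z = opFun (fun t => √t) (gram T) v) : ‖z‖ ≤ ‖v‖ := by
  rw [ker_adjoint_orthogonal] at hz
  refine norm_le_of_inner_range hz (norm_nonneg _) ?_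
  rintro _ ⟨x, rfl⟩
  have h1 : ‖T x‖ = ‖opFun (fun t => √t) (gram T) x‖ := by
    have := norm_apply_opFun_gram T (f := fun _ => 1) continuousOn_const x
    simpa [opFun_const (gram_isPositive T)] using this
  change ‖⟪z, T x⟫_𝕜‖ ≤ ‖v‖ * ‖T x‖
  rw [← adjoint_inner_left, h, inner_opFun_left (gram_isPositive T)
    Real.continuous_sqrt.continuousOn, h1]
  exact norm_inner_le_norm _ _

/-- The isometry `T x ↦ (T*T)^(1/2) x` extends to the closure of the range of `T`; the required
element is its adjoint applied to `v`. This is the polar decomposition of `T`. -/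
theorem exists_adjoint_eq_sqrt (T : X →L[𝕜] Y) (v : X) :
    ∃ z ∈ (LinearMap.ker (adjoint T : Y →ₗ[𝕜] X))ᗮ,
      adjoint T z = opFun (fun t => √t) (gram T) v := by
  rw [ker_adjoint_orthogonal]
  set K := (LinearMap.range (T : X →ₗ[𝕜] Y)).topologicalClosure
  have hK : IsClosed (K : Set Y) := Submodule.isClosed_topologicalClosure _
  have : CompleteSpace K := hK.completeSpace_coe
  let j : X →ₗ[𝕜] K := (T : X →ₗ[𝕜] Y).codRestrict K fun x =>
    Submodule.le_topologicalClosure _ ⟨x, rfl⟩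
  have hj : DenseRange j := by
    intro y
    rw [closure_subtype]
    have : (Subtype.val '' Set.range j) = Set.range T := by
      rw [← Set.range_comp]; rfl
    rw [this]
    exact y.2
  set Q := opFun (fun t => √t) (gram T)
  have h1 (x : X) : ‖T x‖ = ‖Q x‖ := by
    have := norm_apply_opFun_gram T (f := fun _ => 1) continuousOn_const x
    simpa [opFun_const (gram_isPositive T)] using this
  have hb : ∃ C, ∀ x, ‖(Q : X →ₗ[𝕜] X) x‖ ≤ C * ‖j x‖ :=
    ⟨1, fun x => by rw [one_mul]; exact (h1 x).ge⟩
  let W : K →L[𝕜] X := (Q : X →ₗ[𝕜] X).extendOfNorm j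
  have hW (x : X) : W (j x) = Q x := LinearMap.extendOfNorm_eq hj hb x
  refine ⟨(adjoint W v : K), (adjoint W v).2, ?_⟩
  refine ext_inner_right 𝕜 fun x => ?_
  rw [adjoint_inner_left]
  change ⟪adjoint W v, j x⟫_𝕜 = _
  rw [adjoint_inner_left, hW, inner_opFun_left (gram_isPositive T)
    Real.continuous_sqrt.continuousOn]

theorem adjoint_injOn_orthogonal_ker {z z' : Y}
    (hz : z ∈ (LinearMap.ker (adjoint T : Y →ₗ[𝕜] X))ᗮ)
    (hz' : z' ∈ (LinearMap.ker (adjoint T : Y →ₗ[𝕜] X))ᗮ) (h : adjoint T z = adjoint T z') :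
    z = z' := by
  have h1 : z - z' ∈ LinearMap.ker (adjoint T : Y →ₗ[𝕜] X) := by
    rw [LinearMap.mem_ker]
    change adjoint T (z - z') = 0
    rw [map_sub, h, sub_self]
  have h2 := Submodule.sub_mem _ hz hz'
  exact sub_eq_zero.1 (inner_self_eq_zero.1 (h2 _ h1))

theorem resOp_mem_orthogonal_ker {β : ℝ} (hβ : 0 < β) {z : Y}
    (hz : z ∈ (LinearMap.ker (adjoint T : Y →ₗ[𝕜] X))ᗮ) :
    resOp m β (adjoint T) z ∈ (LinearMap.ker (adjoint T : Y →ₗ[𝕜] X))ᗮ := by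
  intro w hw
  rw [resOp, ← inner_opFun_left (gram_isPositive _) (continuousOn_resolvent_pow hβ m _), ← resOp]
  refine hz _ ?_
  have hw' : adjoint T w = 0 := hw
  change adjoint T (resOp m β (adjoint T) w) = 0
  rw [← resOp_adjoint_apply T hβ, hw', map_zero]

end Stopped

/-! ### Rates under Hölder source conditions. -/

section Holder

open ContinuousLinearMap

variable {𝕜 : Type u} {X : Type v} {Y : Type w} [RCLike 𝕜]
  [NormedAddCommGroup X] [InnerProductSpace 𝕜 X] [CompleteSpace X]
  [NormedAddCommGroup Y] [InnerProductSpace 𝕜 Y] [CompleteSpace Y]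
  {m : ℕ} {T : X →L[𝕜] Y} {e0 ω : X}

/-- With `q = β/(β+t) ≤ 1` one has `t^s q^m ≤ (t q)^s`, and `t q ≤ β`. The restriction `s ≤ m` is
the qualification of the method; it is used below with `s = ν + 1/2`, whence `ν ≤ m - 1/2`. -/
theorem rpow_mul_resolvent_pow_le {s β t : ℝ} (hs : 0 ≤ s) (hsm : s ≤ m) (hβ : 0 < β)
    (ht : 0 ≤ t) : t ^ s * (β / (β + t)) ^ m ≤ β ^ s := by
  have h1 := resolvent_pos hβ ht
  have h2 : (β / (β + t)) ^ m ≤ (β / (β + t)) ^ s := by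
    rw [← Real.rpow_natCast]
    exact Real.rpow_le_rpow_of_exponent_ge h1 (resolvent_le_one hβ ht) hsm
  calc t ^ s * (β / (β + t)) ^ m ≤ t ^ s * (β / (β + t)) ^ s := by gcongr
    _ = (t * (β / (β + t))) ^ s := (Real.mul_rpow ht h1.le).symm
    _ ≤ β ^ s := by
      refine Real.rpow_le_rpow (by positivity) ?_ hs
      simpa using mul_resolvent_pow_le hβ ht (le_refl 1)

theorem continuousOn_rpow {s : ℝ} (hs : 0 ≤ s) (M : ℝ) :
    ContinuousOn (fun t : ℝ => t ^ s) (Set.Icc 0 M) :=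
  continuousOn_id.rpow_const fun _ _ => Or.inr hs

theorem norm_resOp_opFun_le {φ : ℝ → ℝ} {β M : ℝ} (hβ : 0 < β)
    (hφ : ContinuousOn φ (Set.Icc 0 ‖gram T‖)) (hφ0 : ∀ t ∈ Set.Icc 0 ‖gram T‖, 0 ≤ φ t)
    (h : ∀ t ∈ Set.Icc 0 ‖gram T‖, φ t * (β / (β + t)) ^ m ≤ M) :
    ‖resOp m β T (opFun φ (gram T) ω)‖ ≤ M * ‖ω‖ := by
  have hc := continuousOn_resolvent_pow hβ m ‖gram T‖
  rw [resOp, ← opFun_mul_apply (gram_isPositive T) hc hφ]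
  refine norm_opFun_apply_le (gram_isPositive T) (hc.mul hφ) (fun t ht => ?_) ω
  change |(β / (β + t)) ^ m * φ t| ≤ M
  rw [abs_of_nonneg (mul_nonneg (pow_pos (resolvent_pos hβ ht.1) m).le (hφ0 t ht)), mul_comm]
  exact h t ht

theorem norm_apply_resOp_opFun_le {φ : ℝ → ℝ} {β M : ℝ} (hβ : 0 < β)
    (hφ : ContinuousOn φ (Set.Icc 0 ‖gram T‖)) (hφ0 : ∀ t ∈ Set.Icc 0 ‖gram T‖, 0 ≤ φ t)
    (h : ∀ t ∈ Set.Icc 0 ‖gram T‖, √t * φ t * (β / (β + t)) ^ m ≤ M) :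
    ‖T (resOp m β T (opFun φ (gram T) ω))‖ ≤ M * ‖ω‖ := by
  have hc := continuousOn_resolvent_pow hβ m ‖gram T‖
  rw [resOp, ← opFun_mul_apply (gram_isPositive T) hc hφ, norm_apply_opFun_gram T
    (f := fun t => (β / (β + t)) ^ m * φ t) (hc.mul hφ)]
  refine norm_opFun_apply_le (gram_isPositive T)
    (Real.continuous_sqrt.continuousOn.mul (hc.mul hφ)) (fun t ht => ?_) ω
  change |√t * ((β / (β + t)) ^ m * φ t)| ≤ M
  rw [abs_of_nonneg (mul_nonneg (Real.sqrt_nonneg _)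
    (mul_nonneg (pow_pos (resolvent_pos hβ ht.1) m).le (hφ0 t ht)))]
  calc _ = √t * φ t * (β / (β + t)) ^ m := by ring
    _ ≤ M := h t ht

theorem scaledNorm_resOp_le_of_holder {ν β : ℝ} (hν : 0 ≤ ν) (hνm : ν ≤ m - 1 / 2) (hβ : 0 < β)
    (he : e0 = opFun (fun t => t ^ ν) (gram T) ω) :
    ‖resOp m β T e0‖ ≤ β ^ ν * ‖ω‖ ∧
      scaledNorm T β (resOp m β T e0) ≤ 2 * (β ^ (ν + 1 / 2) * ‖ω‖) := by
  have h1 : ‖resOp m β T e0‖ ≤ β ^ ν * ‖ω‖ := by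
    rw [he]
    exact norm_resOp_opFun_le hβ (continuousOn_rpow hν _) (fun t ht => Real.rpow_nonneg ht.1 _)
      fun t ht => rpow_mul_resolvent_pow_le hν (by linarith) hβ ht.1
  have h2 : ‖T (resOp m β T e0)‖ ≤ β ^ (ν + 1 / 2) * ‖ω‖ := by
    rw [he]
    refine norm_apply_resOp_opFun_le hβ (continuousOn_rpow hν _)
      (fun t ht => Real.rpow_nonneg ht.1 _) fun t ht => ?_
    have : √t * t ^ ν = t ^ (ν + 1 / 2) := by
      rw [Real.sqrt_eq_rpow, ← Real.rpow_add_of_nonneg ht.1 (by norm_num) hν, add_comm]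
    rw [this]
    exact rpow_mul_resolvent_pow_le (by linarith) (by linarith) hβ ht.1
  refine ⟨h1, ?_⟩
  have h3 : √β * (β ^ ν * ‖ω‖) = β ^ (ν + 1 / 2) * ‖ω‖ := by
    rw [Real.sqrt_eq_rpow, ← mul_assoc, ← Real.rpow_add hβ, add_comm]
  have h4 := mul_le_mul_of_nonneg_left h1 (Real.sqrt_nonneg β)
  rw [scaledNorm]
  linarith

/-- Splitting off `√t` from `t^ν` and applying `norm_le_of_adjoint_eq_sqrt`, the filtered source
element is no larger than the filtered `(T*T)^(ν - 1/2) ω`. This needs no decay of `u` itself. -/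
theorem sqrt_mul_norm_resOp_le_of_holder {ν β : ℝ} (hν : 1 / 2 ≤ ν) (hνm : ν ≤ m - 1 / 2)
    (hβ : 0 < β) {u : Y} (hu : u ∈ (LinearMap.ker (adjoint T : Y →ₗ[𝕜] X))ᗮ)
    (he : adjoint T u = opFun (fun t => t ^ ν) (gram T) ω) :
    √β * ‖resOp m β (adjoint T) u‖ ≤ β ^ ν * ‖ω‖ := by
  have hs : 0 ≤ ν - 1 / 2 := by linarith
  have hA := gram_isPositive T
  have hc1 := continuousOn_resolvent_pow hβ m ‖gram T‖
  have hc2 := continuousOn_rpow hs ‖gram T‖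
  have hc3 := Real.continuous_sqrt.continuousOn (s := Set.Icc 0 ‖gram T‖)
  have h1 := norm_le_of_adjoint_eq_sqrt (T := T) (resOp_mem_orthogonal_ker (m := m) hβ hu)
    (v := resOp m β T (opFun (fun t => t ^ (ν - 1 / 2)) (gram T) ω)) (by
      rw [← resOp_adjoint_apply T hβ, he, resOp, ← opFun_mul_apply hA hc1 hc2,
        ← opFun_mul_apply hA (f := fun t => √t)
        (g := fun t => (β / (β + t)) ^ m * t ^ (ν - 1 / 2)) hc3 (hc1.mul hc2), ← opFun_mul_apply hA hc1
          (continuousOn_rpow (by linarith) _)]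
      refine congrArg (fun S : X →L[𝕜] X => S ω) (opFun_congr fun t ht => ?_)
      have : t ^ ν = √t * t ^ (ν - 1 / 2) := by
        rw [Real.sqrt_eq_rpow, ← Real.rpow_add_of_nonneg ht.1 (by norm_num) hs]
        congr 1; ring
      rw [this]
      ring)
  have h2 : ‖resOp m β T (opFun (fun t => t ^ (ν - 1 / 2)) (gram T) ω)‖ ≤ β ^ (ν - 1 / 2) * ‖ω‖ :=
    norm_resOp_opFun_le hβ hc2 (fun t ht => Real.rpow_nonneg ht.1 _)
      fun t ht => rpow_mul_resolvent_pow_le hs (by linarith) hβ ht.1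
  calc √β * ‖resOp m β (adjoint T) u‖ ≤ √β * (β ^ (ν - 1 / 2) * ‖ω‖) := by
        gcongr; exact h1.trans h2
    _ = _ := by
      rw [Real.sqrt_eq_rpow, ← mul_assoc, ← Real.rpow_add hβ]
      congr 2; ring

/-- The noise bound in `StoppedError` under a Hölder condition. -/
theorem noise_le_of_holder {ν τ δ a w : ℝ} (hν : 0 < ν) (hτ : 1 < τ) (hδ : 0 < δ) (ha : 0 < a)
    (hw : 0 < w) (h : (τ - 1) * δ ≤ 8 * (a ^ (ν + 1 / 2) * w)) :
    δ / √a ≤ (8 / (τ - 1)) ^ (1 / (1 + 2 * ν)) *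
      (w ^ (1 / (1 + 2 * ν)) * δ ^ (2 * ν / (1 + 2 * ν))) := by
  have hτ' : 0 < τ - 1 := by linarith
  have hν2 : 0 < 1 + 2 * ν := by linarith
  have h1 : δ ≤ 8 / (τ - 1) * w * a ^ (ν + 1 / 2) := by
    rw [div_mul_eq_mul_div, div_mul_eq_mul_div, le_div_iff₀ hτ']; linarith
  have h2 : δ ^ (1 / (1 + 2 * ν)) ≤ (8 / (τ - 1)) ^ (1 / (1 + 2 * ν)) * w ^ (1 / (1 + 2 * ν)) * √a := by
    have := Real.rpow_le_rpow hδ.le h1 (z := 1 / (1 + 2 * ν)) (by positivity)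
    rw [Real.mul_rpow (by positivity) (by positivity), Real.mul_rpow (by positivity) hw.le,
      ← Real.rpow_mul ha.le] at this
    rw [Real.sqrt_eq_rpow]
    convert this using 3
    field_simp; ring
  have h3 : δ = δ ^ (1 / (1 + 2 * ν)) * δ ^ (2 * ν / (1 + 2 * ν)) := by
    rw [← Real.rpow_add hδ, ← add_div, div_self hν2.ne', Real.rpow_one]
  rw [div_le_iff₀ (Real.sqrt_pos.2 ha)]
  calc δ = δ ^ (1 / (1 + 2 * ν)) * δ ^ (2 * ν / (1 + 2 * ν)) := h3
    _ ≤ (8 / (τ - 1)) ^ (1 / (1 + 2 * ν)) * w ^ (1 / (1 + 2 * ν)) * √a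
        * δ ^ (2 * ν / (1 + 2 * ν)) := by gcongr
    _ = _ := by ring

/-- The a priori choice of the parameter under a Hölder condition. -/
theorem exists_parameter_of_holder {ν δ w : ℝ} (hν : 0 < ν) (hδ : 0 < δ) (hw : 0 < w) :
    ∃ β > 0, β ^ ν * w = w ^ (1 / (1 + 2 * ν)) * δ ^ (2 * ν / (1 + 2 * ν)) ∧
      δ / √β = w ^ (1 / (1 + 2 * ν)) * δ ^ (2 * ν / (1 + 2 * ν)) := by
  have hν2 : 0 < 1 + 2 * ν := by linarith
  -- This value solves `β^ν w = δ/√β`.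
  refine ⟨(δ / w) ^ (2 / (1 + 2 * ν)), by positivity, ?_, ?_⟩
  · rw [← Real.rpow_mul (by positivity), Real.div_rpow hδ.le hw.le]
    have e1 : 2 / (1 + 2 * ν) * ν = 2 * ν / (1 + 2 * ν) := by ring
    have e2 : w = w ^ (1 / (1 + 2 * ν)) * w ^ (2 * ν / (1 + 2 * ν)) := by
      rw [← Real.rpow_add hw, ← add_div, div_self hν2.ne', Real.rpow_one]
    rw [e1]
    have hp : 0 < w ^ (2 * ν / (1 + 2 * ν)) := by positivity
    field_simp
    rw [mul_comm, ← e2]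
  · rw [Real.sqrt_eq_rpow, ← Real.rpow_mul (by positivity), Real.div_rpow hδ.le hw.le]
    have e1 : 2 / (1 + 2 * ν) * (1 / 2) = 1 / (1 + 2 * ν) := by ring
    have e2 : δ = δ ^ (1 / (1 + 2 * ν)) * δ ^ (2 * ν / (1 + 2 * ν)) := by
      rw [← Real.rpow_add hδ, ← add_div, div_self hν2.ne', Real.rpow_one]
    rw [e1]
    have hp : 0 < δ ^ (1 / (1 + 2 * ν)) := by positivity
    have hp' : 0 < w ^ (1 / (1 + 2 * ν)) := by positivity
    rw [div_div_eq_mul_div, div_eq_iff hp.ne']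
    conv_lhs => rw [e2]
    ring

theorem StoppedError.holder_rate {C τ δ ν C' : ℝ} {x h : X} {D : ℝ}
    (H : StoppedError m C τ δ T e0 x h D) (hτ : 1 < τ) (hδ : 0 < δ) (hω : ω ≠ 0) (hν : 0 < ν)
    (hνm : ν ≤ m - 1 / 2) (he : e0 = opFun (fun t => t ^ ν) (gram T) ω) (hC' : 0 ≤ C')
    (hx : ∀ β > 0, ‖x‖ ≤ C' * (β ^ ν * ‖ω‖ + δ / √β + D)) :
    ‖x‖ ≤ C' * (2 + (8 / (τ - 1)) ^ (1 / (1 + 2 * ν))) * ‖ω‖ ^ (1 / (1 + 2 * ν))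
      * δ ^ (2 * ν / (1 + 2 * ν)) := by
  have hw : 0 < ‖ω‖ := norm_pos_iff.2 hω
  have hτ' : 0 < τ - 1 := by linarith
  have hD : D ≤ (8 / (τ - 1)) ^ (1 / (1 + 2 * ν)) *
      (‖ω‖ ^ (1 / (1 + 2 * ν)) * δ ^ (2 * ν / (1 + 2 * ν))) := by
    rcases H.noise with h0 | ⟨a, ha, hDa, h1⟩
    · rw [h0]; positivity
    · rw [hDa]
      refine noise_le_of_holder hν hτ hδ ha hw ?_
      have := (scaledNorm_resOp_le_of_holder hν.le hνm ha he).2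
      linarith
  obtain ⟨β, hβ, e1, e2⟩ := exists_parameter_of_holder hν hδ hw
  have h1 := hx β hβ
  rw [e1, e2] at h1
  calc ‖x‖ ≤ _ := h1
    _ ≤ C' * (‖ω‖ ^ (1 / (1 + 2 * ν)) * δ ^ (2 * ν / (1 + 2 * ν))
        + ‖ω‖ ^ (1 / (1 + 2 * ν)) * δ ^ (2 * ν / (1 + 2 * ν))
        + (8 / (τ - 1)) ^ (1 / (1 + 2 * ν)) *
          (‖ω‖ ^ (1 / (1 + 2 * ν)) * δ ^ (2 * ν / (1 + 2 * ν)))) := by gcongr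
    _ = _ := by ring

end Holder

/-! ### Scalar estimates for logarithmic source functions. -/

section LogScalar

variable {μ β t : ℝ}

theorem log_two_le_neg_log (ht : 0 < t) (ht2 : t ≤ 1 / 2) : Real.log 2 ≤ -Real.log t := by
  rw [← Real.log_inv]
  exact Real.log_le_log two_pos (by rw [le_inv_comm₀ two_pos ht]; linarith)

theorem log_two_pos : 0 < Real.log 2 := Real.log_pos (by norm_num)

theorem logSource_nonneg (ht : 0 ≤ t) (ht2 : t ≤ 1 / 2) : 0 ≤ (-Real.log t) ^ (-μ) := by
  refine Real.rpow_nonneg ?_ _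
  have := Real.log_nonpos ht (by linarith)
  linarith

theorem logSource_le (hμ : 0 < μ) (ht : 0 ≤ t) (ht2 : t ≤ 1 / 2) :
    (-Real.log t) ^ (-μ) ≤ Real.log 2 ^ (-μ) := by
  rcases ht.eq_or_lt with rfl | ht
  · rw [Real.log_zero, neg_zero, Real.zero_rpow (by linarith)]
    exact Real.rpow_nonneg log_two_pos.le _
  · exact Real.rpow_le_rpow_of_nonpos log_two_pos (log_two_le_neg_log ht ht2) (by linarith)

theorem continuousOn_logSource (hμ : 0 < μ) {M : ℝ} (hM : M ≤ 1 / 2) :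
    ContinuousOn (fun t => (-Real.log t) ^ (-μ)) (Set.Icc 0 M) := by
  intro t ht
  rcases ht.1.eq_or_lt with rfl | h0
  -- The conventions `log 0 = 0` and `0 ^ (-μ) = 0` give the value `0` at the origin, which agrees
  -- with the limit from the right.
  · rw [← continuousWithinAt_sdiff_self, ContinuousWithinAt, Real.log_zero, neg_zero,
      Real.zero_rpow (by linarith)]
    have h1 : Tendsto (fun t => (-Real.log t) ^ (-μ)) (𝓝[>] 0) (𝓝 0) :=
      (tendsto_rpow_neg_atTop hμ).comp (tendsto_neg_atBot_atTop.comp Real.tendsto_log_nhdsGT_zero)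
    refine h1.mono_left (nhdsWithin_mono _ fun x hx => ?_)
    exact lt_of_le_of_ne hx.1.1 (Ne.symm hx.2)
  · have h1 := log_two_le_neg_log h0 (ht.2.trans hM)
    have h2 := log_two_pos
    exact ((Real.continuousAt_log h0.ne').neg.rpow_const
      (Or.inl (by simp only [Pi.neg_apply]; linarith))).continuousWithinAt

theorem abs_log_of_le_one (hβ : 0 < β) (hβ1 : β ≤ 1) : |Real.log β| = -Real.log β :=
  abs_of_nonpos (Real.log_nonpos hβ.le hβ1)

theorem logSource_le_of_le_sqrt (hμ : 0 < μ) (ht : 0 ≤ t) (ht2 : t ≤ 1 / 2) (hβ : 0 < β)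
    (hβ1 : β ≤ 1) (htβ : t ≤ √β) :
    (-Real.log t) ^ (-μ) ≤ (1 / Real.log 2 + 2) ^ μ * (1 + |Real.log β|) ^ (-μ) := by
  have hl := log_two_pos
  rcases ht.eq_or_lt with rfl | ht
  · rw [Real.log_zero, neg_zero, Real.zero_rpow (by linarith)]; positivity
  · have h1 := log_two_le_neg_log ht ht2
    have h2 : -Real.log β ≤ 2 * (-Real.log t) := by
      have := Real.log_le_log ht htβ
      rw [Real.log_sqrt hβ.le] at this
      linarith
    rw [abs_log_of_le_one hβ hβ1]
    have h3 := abs_log_of_le_one hβ hβ1 ▸ abs_nonneg (Real.log β)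
    set κ := 1 / Real.log 2 + 2
    have hκ : 0 < κ := by positivity
    have h4 : 1 + -Real.log β ≤ κ * (-Real.log t) := by
      have : 1 ≤ 1 / Real.log 2 * (-Real.log t) := by
        rw [one_div_mul_eq_div, one_le_div hl]; exact h1
      linarith [show κ * (-Real.log t) = 1 / Real.log 2 * (-Real.log t) + 2 * (-Real.log t) by ring]
    have h5 : (κ * (-Real.log t)) ^ (-μ) ≤ (1 + -Real.log β) ^ (-μ) :=
      Real.rpow_le_rpow_of_nonpos (by linarith) h4 (by linarith)
    rw [Real.mul_rpow hκ.le (by linarith), Real.rpow_neg hκ.le] at h5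
    rwa [inv_mul_le_iff₀ (by positivity)] at h5

theorem rpow_quarter_le_log (hμ : 0 < μ) (hβ : 0 < β) (hβ1 : β ≤ 1) :
    β ^ (1 / 4 : ℝ) ≤ (1 + 4 * μ) ^ μ * (1 + |Real.log β|) ^ (-μ) := by
  rw [abs_log_of_le_one hβ hβ1]
  have h3 := abs_log_of_le_one hβ hβ1 ▸ abs_nonneg (Real.log β)
  set l := -Real.log β with hl
  have h1 : 1 + l ≤ (1 + 4 * μ) * Real.exp (l / (4 * μ)) := by
    have h2 := Real.add_one_le_exp (l / (4 * μ))
    calc 1 + l ≤ (1 + 4 * μ) * (l / (4 * μ) + 1) := by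
          have : (1 + 4 * μ) * (l / (4 * μ) + 1) = l + 1 + (l / (4 * μ) + 4 * μ) := by
            field_simp; ring
          rw [this]
          have : 0 ≤ l / (4 * μ) + 4 * μ := by positivity
          linarith
      _ ≤ _ := by gcongr
  have h2 := Real.rpow_le_rpow (by positivity) h1 hμ.le
  rw [Real.mul_rpow (by positivity) (Real.exp_pos _).le, ← Real.exp_mul] at h2
  have h4 : β ^ (1 / 4 : ℝ) = (Real.exp (l / (4 * μ) * μ))⁻¹ := by
    rw [Real.rpow_def_of_pos hβ, ← Real.exp_neg]
    congr 1
    rw [hl]; field_simp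
  rw [h4, Real.rpow_neg (by positivity), ← div_eq_mul_inv, le_div_iff₀ (by positivity),
    inv_mul_le_iff₀ (Real.exp_pos _)]
  linarith

theorem resolvent_pow_le_div {m : ℕ} (hm : 1 ≤ m) (hβ : 0 < β) (ht : 0 < t) :
    (β / (β + t)) ^ m ≤ β / t := by
  refine (resolvent_pow_le_self hβ ht.le hm).trans ?_
  exact div_le_div_of_nonneg_left hβ.le ht (by linarith)

/-- The constant in the estimates of the residual under a logarithmic source condition. -/
def logConst (μ : ℝ) : ℝ :=
  (1 / Real.log 2 + 2) ^ μ + Real.log 2 ^ (-μ) * (1 + 4 * μ) ^ μ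

theorem logConst_pos (hμ : 0 < μ) : 0 < logConst μ := by
  have := log_two_pos
  unfold logConst
  positivity

/-- Split at `t = √β`. Below it, `-log t` is at least half of `-log β`, so the source function
itself is small. Above it, the source function is merely bounded, but the resolvent is at most
`β/t`, which gains a power `β^(1/4)` even in the estimate weighted with `√t`; any such power is
smaller than a logarithm. -/
theorem logSource_mul_resolvent_le {m : ℕ} (hm : 1 ≤ m) (hμ : 0 < μ) (ht : 0 ≤ t)
    (ht2 : t ≤ 1 / 2) (hβ : 0 < β) (hβ1 : β ≤ 1) :
    (-Real.log t) ^ (-μ) * (β / (β + t)) ^ m ≤ logConst μ * (1 + |Real.log β|) ^ (-μ) ∧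
    √t * (-Real.log t) ^ (-μ) * (β / (β + t)) ^ m ≤
      √β * (logConst μ * (1 + |Real.log β|) ^ (-μ)) := by
  have hl := log_two_pos
  have hφ0 := logSource_nonneg (μ := μ) ht ht2
  have hq0 : 0 < (β / (β + t)) ^ m := pow_pos (resolvent_pos hβ ht) m
  have hK := rpow_quarter_le_log hμ hβ hβ1
  have hψ : 0 < (1 + |Real.log β|) ^ (-μ) := by positivity
  have hA : 0 < (1 / Real.log 2 + 2) ^ μ := by positivity
  have hB : 0 < Real.log 2 ^ (-μ) := by positivity
  have hβq : 0 < β ^ (1 / 4 : ℝ) := by positivity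
  have hβq1 : β ^ (1 / 4 : ℝ) ≤ 1 := Real.rpow_le_one hβ.le hβ1 (by norm_num)
  have hs : √β = β ^ (1 / 4 : ℝ) * β ^ (1 / 4 : ℝ) := by
    rw [Real.sqrt_eq_rpow, ← Real.rpow_add hβ]; norm_num
  have hsq : √β * √β = β := Real.mul_self_sqrt hβ.le
  have hexp : logConst μ * (1 + |Real.log β|) ^ (-μ)
      = (1 / Real.log 2 + 2) ^ μ * (1 + |Real.log β|) ^ (-μ)
        + Real.log 2 ^ (-μ) * ((1 + 4 * μ) ^ μ * (1 + |Real.log β|) ^ (-μ)) := by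
    rw [logConst]; ring
  rw [hexp]
  have hX : 0 ≤ (1 / Real.log 2 + 2) ^ μ * (1 + |Real.log β|) ^ (-μ) := by positivity
  have hY : 0 ≤ Real.log 2 ^ (-μ) * ((1 + 4 * μ) ^ μ * (1 + |Real.log β|) ^ (-μ)) := by positivity
  rcases le_total t (√β) with htβ | htβ
  · have h1 := logSource_le_of_le_sqrt hμ ht ht2 hβ hβ1 htβ
    have h2 := sqrt_mul_resolvent_pow_le hβ ht hm
    constructor
    · calc _ ≤ (-Real.log t) ^ (-μ) * 1 := by gcongr; exact resolvent_pow_le_one hβ ht m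
        _ ≤ _ := by linarith
    · calc _ = √t * (β / (β + t)) ^ m * (-Real.log t) ^ (-μ) := by ring
        _ ≤ √β * (-Real.log t) ^ (-μ) := by gcongr
        _ ≤ _ := by gcongr; linarith
  · have ht0 : 0 < t := (Real.sqrt_pos.2 hβ).trans_le htβ
    have hst : 0 < √t := Real.sqrt_pos.2 ht0
    have h1 := logSource_le hμ ht ht2
    have h2 := resolvent_pow_le_div hm hβ ht0
    have h3 : β ^ (1 / 4 : ℝ) ≤ √t := by
      refine Real.le_sqrt_of_sq_le ?_
      rw [sq, ← hs]; exact htβ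
    constructor
    · have h4 : β / t ≤ β ^ (1 / 4 : ℝ) := by
        rw [div_le_iff₀ ht0]
        nlinarith
      calc _ ≤ Real.log 2 ^ (-μ) * β ^ (1 / 4 : ℝ) := by gcongr; exact h2.trans h4
        _ ≤ Real.log 2 ^ (-μ) * ((1 + 4 * μ) ^ μ * (1 + |Real.log β|) ^ (-μ)) := by gcongr
        _ ≤ _ := by linarith
    · have h4 : √t * (β / t) ≤ √β * β ^ (1 / 4 : ℝ) := by
        have h5 : √t * (β / t) = β / √t := by
          nth_rewrite 2 [← Real.mul_self_sqrt ht]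
          field_simp
        rw [h5, div_le_iff₀ hst]
        calc β = √β * (β ^ (1 / 4 : ℝ) * β ^ (1 / 4 : ℝ)) := by rw [← hs, hsq]
          _ ≤ √β * (β ^ (1 / 4 : ℝ) * √t) := by gcongr
          _ = _ := by ring
      calc _ = (-Real.log t) ^ (-μ) * (√t * (β / (β + t)) ^ m) := by ring
        _ ≤ Real.log 2 ^ (-μ) * (√β * β ^ (1 / 4 : ℝ)) := by
          have h6 : √t * (β / (β + t)) ^ m ≤ √β * β ^ (1 / 4 : ℝ) :=
            (mul_le_mul_of_nonneg_left h2 hst.le).trans h4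
          exact mul_le_mul h1 h6 (by positivity) hB.le
        _ = √β * (Real.log 2 ^ (-μ) * β ^ (1 / 4 : ℝ)) := by ring
        _ ≤ √β * (Real.log 2 ^ (-μ) * ((1 + 4 * μ) ^ μ * (1 + |Real.log β|) ^ (-μ))) := by gcongr
        _ ≤ _ := by gcongr; linarith

end LogScalar

/-! ### Logarithmic rates, and convergence without rates. -/

section LogRate

open ContinuousLinearMap

variable {𝕜 : Type u} {X : Type v} {Y : Type w} [RCLike 𝕜]
  [NormedAddCommGroup X] [InnerProductSpace 𝕜 X] [CompleteSpace X]
  [NormedAddCommGroup Y] [InnerProductSpace 𝕜 Y] [CompleteSpace Y]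
  {m : ℕ} {T : X →L[𝕜] Y} {e0 ω : X} {C τ δ μ C' : ℝ} {x h : X} {D : ℝ}

theorem scaledNorm_resOp_le_of_log (hm : 1 ≤ m) (hμ : 0 < μ) {β : ℝ} (hβ : 0 < β) (hβ1 : β ≤ 1)
    (hT : ‖gram T‖ ≤ 1 / 2) (he : e0 = opFun (fun t => (-Real.log t) ^ (-μ)) (gram T) ω) :
    ‖resOp m β T e0‖ ≤ logConst μ * (1 + |Real.log β|) ^ (-μ) * ‖ω‖ ∧
      scaledNorm T β (resOp m β T e0) ≤
        2 * √β * (logConst μ * (1 + |Real.log β|) ^ (-μ) * ‖ω‖) := by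
  have hc := continuousOn_logSource hμ hT
  have h0 : ∀ t ∈ Set.Icc 0 ‖gram T‖, 0 ≤ (-Real.log t) ^ (-μ) := fun t ht =>
    logSource_nonneg ht.1 (ht.2.trans hT)
  have h1 : ‖resOp m β T e0‖ ≤ logConst μ * (1 + |Real.log β|) ^ (-μ) * ‖ω‖ := by
    rw [he]
    exact norm_resOp_opFun_le hβ hc h0 fun t ht =>
      (logSource_mul_resolvent_le hm hμ ht.1 (ht.2.trans hT) hβ hβ1).1
  have h2 : ‖T (resOp m β T e0)‖ ≤ √β * (logConst μ * (1 + |Real.log β|) ^ (-μ)) * ‖ω‖ := by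
    rw [he]
    exact norm_apply_resOp_opFun_le hβ hc h0 fun t ht =>
      (logSource_mul_resolvent_le hm hμ ht.1 (ht.2.trans hT) hβ hβ1).2
  refine ⟨h1, ?_⟩
  have h3 := mul_le_mul_of_nonneg_left h1 (Real.sqrt_nonneg β)
  rw [scaledNorm]
  linarith

theorem StoppedError.log_rate (H : StoppedError m C τ δ T e0 x h D) (hm : 1 ≤ m) (hτ : 1 < τ)
    (hδ : 0 < δ) (hδω : δ ≤ ‖ω‖) (hμ : 0 < μ) (hT : ‖gram T‖ ≤ 1 / 2)
    (he : e0 = opFun (fun t => (-Real.log t) ^ (-μ)) (gram T) ω) (hC' : 0 ≤ C')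
    (hx : ∀ β > 0, ‖x‖ ≤ C' * (‖resOp m β T e0‖ + δ / √β + D)) :
    ‖x‖ ≤ C' * (logConst μ + 2 * (1 + 4 * μ) ^ μ + 8 / (τ - 1) * logConst μ) * ‖ω‖
      * (1 + |Real.log (δ / ‖ω‖)|) ^ (-μ) := by
  have hw : 0 < ‖ω‖ := hδ.trans_le hδω
  have hτ' : 0 < τ - 1 := by linarith
  have hL := logConst_pos hμ
  set s := δ / ‖ω‖ with hs
  have hs0 : 0 < s := by positivity
  have hs1 : s ≤ 1 := div_le_one_of_le₀ hδω hw.le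
  set ψ := (1 + |Real.log s|) ^ (-μ) with hψ
  have hψ0 : 0 < ψ := by positivity
  have h1 : δ / √s ≤ (1 + 4 * μ) ^ μ * ψ * ‖ω‖ := by
    have h2 : δ / √s = √s * ‖ω‖ := by
      have : δ = √s * √s * ‖ω‖ := by rw [Real.mul_self_sqrt hs0.le, hs]; field_simp
      rw [div_eq_iff (Real.sqrt_pos.2 hs0).ne']
      linarith
    rw [h2]
    gcongr
    refine le_trans ?_ (rpow_quarter_le_log hμ hs0 hs1)
    rw [Real.sqrt_eq_rpow]
    exact Real.rpow_le_rpow_of_exponent_ge hs0 hs1 (by norm_num)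
  have hD : D ≤ (1 + 4 * μ) ^ μ * ψ * ‖ω‖ + 8 / (τ - 1) * (logConst μ * ψ * ‖ω‖) := by
    rcases H.noise with h0 | ⟨a, ha, hDa, h2⟩
    · rw [h0]; positivity
    rw [hDa]
    -- If `a ≥ s`, then `δ/√a ≤ δ/√s = √s ‖ω‖`, which is below the rate. If `a ≤ s`, the noise
    -- clause applies, and the logarithmic factor at `a` is no larger than at `s`.
    rcases le_total s a with hsa | hsa
    · have : δ / √a ≤ δ / √s := by
        have := Real.sqrt_pos.2 hs0
        gcongr
      have : 0 ≤ 8 / (τ - 1) * (logConst μ * ψ * ‖ω‖) := by positivity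
      linarith
    · have h3 := (scaledNorm_resOp_le_of_log (T := T) (m := m) hm hμ ha (hsa.trans hs1) hT he).2
      have h4 : (1 + |Real.log a|) ^ (-μ) ≤ ψ := by
        refine Real.rpow_le_rpow_of_nonpos (by positivity) ?_ (by linarith)
        rw [abs_log_of_le_one hs0 hs1, abs_log_of_le_one ha (hsa.trans hs1)]
        have := Real.log_le_log ha hsa
        linarith
      have hsa0 : 0 < √a := Real.sqrt_pos.2 ha
      have h5 : δ / √a ≤ 8 / (τ - 1) * (logConst μ * ψ * ‖ω‖) := by
        rw [div_le_iff₀ hsa0, div_mul_eq_mul_div, div_mul_eq_mul_div, le_div_iff₀ hτ']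
        calc δ * (τ - 1) ≤ 4 * (2 * √a * (logConst μ * (1 + |Real.log a|) ^ (-μ) * ‖ω‖)) := by
              linarith
          _ ≤ 4 * (2 * √a * (logConst μ * ψ * ‖ω‖)) := by gcongr
          _ = _ := by ring
      have : 0 ≤ (1 + 4 * μ) ^ μ * ψ * ‖ω‖ := by positivity
      linarith
  have h2 := (scaledNorm_resOp_le_of_log (T := T) (m := m) hm hμ hs0 hs1 hT he).1
  calc ‖x‖ ≤ C' * (‖resOp m s T e0‖ + δ / √s + D) := hx s hs0
    _ ≤ C' * (logConst μ * ψ * ‖ω‖ + (1 + 4 * μ) ^ μ * ψ * ‖ω‖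
        + ((1 + 4 * μ) ^ μ * ψ * ‖ω‖ + 8 / (τ - 1) * (logConst μ * ψ * ‖ω‖))) := by gcongr
    _ = _ := by ring

/-- The orthogonal complement of the kernel is the closure of the range of `T*`. Up to `ε/2`, then,
`e0` is some `T* v`, whose filtered norm is at most `√a ‖v‖`. -/
theorem exists_scaledNorm_resOp_le (hm : 1 ≤ m)
    (he : e0 ∈ (LinearMap.ker (T : X →ₗ[𝕜] Y))ᗮ) {ε : ℝ} (hε : 0 < ε) :
    ∃ a₀ > 0, ∀ a, 0 < a → a ≤ a₀ →
      ‖resOp m a T e0‖ ≤ ε ∧ scaledNorm T a (resOp m a T e0) ≤ 2 * (√a * ε) := by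
  have h1 := orthogonal_ker T
  rw [h1] at he
  obtain ⟨_, ⟨v, rfl⟩, hv⟩ := Metric.mem_closure_iff.1 he (ε / 2) (half_pos hε)
  rw [dist_eq_norm] at hv
  change ‖e0 - adjoint T v‖ < ε / 2 at hv
  set z := adjoint T v
  have hpos : 0 < ‖v‖ + 1 := by positivity
  refine ⟨(ε / (2 * (‖v‖ + 1))) ^ 2, by positivity, fun a ha haa => ?_⟩
  have hsa : √a * (‖v‖ + 1) ≤ ε / 2 := by
    have : √a ≤ ε / (2 * (‖v‖ + 1)) := by
      rw [Real.sqrt_le_left (by positivity)]; exact haa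
    rw [le_div_iff₀ (by positivity)] at this
    linarith
  have hsa' : √a * ‖v‖ ≤ ε / 2 := by nlinarith [Real.sqrt_nonneg a]
  have hsplit : resOp m a T e0 = resOp m a T (e0 - z) + resOp m a T z := by
    rw [← map_add, sub_add_cancel]
  have h2 : ‖resOp m a T e0‖ ≤ ε := by
    rw [hsplit]
    refine (norm_add_le _ _).trans ?_
    have h3 := norm_resOp_apply_le T ha m (e0 - z)
    have h4 := norm_resOp_adjoint_apply_le T ha hm v
    linarith
  have h3 : ‖T (resOp m a T e0)‖ ≤ √a * ε := by
    rw [hsplit, map_add]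
    refine (norm_add_le _ _).trans ?_
    have h3 := norm_apply_resOp_le T ha hm (e0 - z)
    have h4 := norm_apply_resOp_adjoint_apply_le T ha hm v
    have h5 : a * ‖v‖ = √a * (√a * ‖v‖) := by rw [← mul_assoc, Real.mul_self_sqrt ha.le]
    rw [h5] at h4
    nlinarith [Real.sqrt_nonneg a]
  refine ⟨h2, ?_⟩
  rw [scaledNorm]
  have := mul_le_mul_of_nonneg_left h2 (Real.sqrt_nonneg a)
  linarith

/-- The threshold `a₀` plays the role of `s` in `StoppedError.log_rate`. It depends on `T` and `e0`
but not on the data, hence the uniformity in `yδ`. -/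
theorem exists_norm_lt_of_stoppedError (hm : 1 ≤ m) (hτ : 1 < τ) (hC' : 0 < C')
    (he : e0 ∈ (LinearMap.ker (T : X →ₗ[𝕜] Y))ᗮ) {ε : ℝ} (hε : 0 < ε) :
    ∃ δ₀ > 0, ∀ (δ : ℝ) (x h : X) (D : ℝ), 0 < δ → δ < δ₀ → StoppedError m C τ δ T e0 x h D →
      (∀ β > 0, ‖x‖ ≤ C' * (‖resOp m β T e0‖ + δ / √β + D)) → ‖x‖ < ε := by
  have hτ' : 0 < τ - 1 := by linarith
  set ε' := ε / (C' * (4 + 8 / (τ - 1))) with hε'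
  have hε'0 : 0 < ε' := by positivity
  obtain ⟨a₀, ha₀, h⟩ := exists_scaledNorm_resOp_le (m := m) hm he hε'0
  have hs0 : 0 < √a₀ := Real.sqrt_pos.2 ha₀
  refine ⟨ε' * √a₀, by positivity, fun δ x z D hδ hδ₀ H hx => ?_⟩
  have h1 : δ / √a₀ ≤ ε' := by rw [div_le_iff₀ hs0]; exact hδ₀.le
  have hD : D ≤ ε' + 8 / (τ - 1) * ε' := by
    rcases H.noise with h0 | ⟨a, ha, hDa, h2⟩
    · rw [h0]; positivity
    rw [hDa]
    rcases le_total a₀ a with hsa | hsa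
    · have : δ / √a ≤ δ / √a₀ := by gcongr
      have : 0 ≤ 8 / (τ - 1) * ε' := by positivity
      linarith
    · have h3 := (h a ha hsa).2
      have hsa0 : 0 < √a := Real.sqrt_pos.2 ha
      have : δ / √a ≤ 8 / (τ - 1) * ε' := by
        rw [div_le_iff₀ hsa0, div_mul_eq_mul_div, div_mul_eq_mul_div, le_div_iff₀ hτ']
        linarith
      linarith
  have h2 := (h a₀ ha₀ le_rfl).1
  have h3 : ‖x‖ ≤ C' * (3 * ε' + 8 / (τ - 1) * ε') :=
    (hx a₀ ha₀).trans (mul_le_mul_of_nonneg_left (by linarith) hC'.le)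
  have h4 : C' * (4 * ε' + 8 / (τ - 1) * ε') = ε := by
    rw [hε']; field_simp
  have h5 : 0 < C' * ε' := by positivity
  linarith

end LogRate

/-! ### One Newton step compared with one linear step. -/

section Step

open ContinuousLinearMap

variable {𝕜 : Type u} {X : Type v} {Y : Type w} [RCLike 𝕜]
  [NormedAddCommGroup X] [InnerProductSpace 𝕜 X] [CompleteSpace X]
  [NormedAddCommGroup Y] [InnerProductSpace 𝕜 Y] [CompleteSpace Y]
  {m : ℕ} {S T : X →L[𝕜] Y} {α : ℝ} {e0 : X} {p ξ : Y} {δ : ℝ}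

/-- One step of the method, in terms of bounds for the effect of replacing `S` by `T`. -/
theorem newton_step_le (hα : 0 < α) (hξ : ‖ξ‖ ≤ δ) {a b c π : ℝ} (hp : ‖p‖ ≤ π)
    (ha : √α * ‖resOp m α S e0 - resOp m α T e0‖ ≤ a)
    (hb : ‖T (resOp m α S e0 - resOp m α T e0)‖ ≤ b)
    (hc : ‖(T - S) (regOp m α S (adjoint S (p + ξ)))‖ ≤ c) :
    √α * ‖resOp m α S e0 - regOp m α S (adjoint S (p + ξ)) - resOp m α T e0‖ ≤
        a + √m * (π + δ) ∧
      ‖T (resOp m α S e0 - regOp m α S (adjoint S (p + ξ)) - resOp m α T e0) + ξ‖ ≤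
        b + c + π + δ := by
  have hs : 0 < √α := Real.sqrt_pos.2 hα
  have hpξ : ‖p + ξ‖ ≤ π + δ := (norm_add_le _ _).trans (add_le_add hp hξ)
  set z := regOp m α S (adjoint S (p + ξ))
  constructor
  · have h1 : ‖z‖ ≤ √m / √α * ‖p + ξ‖ := norm_regOp_adjoint_apply_le S hα m _
    have h2 : √α * ‖z‖ ≤ √m * (π + δ) := by
      calc √α * ‖z‖ ≤ √α * (√m / √α * (π + δ)) := by gcongr; exact h1.trans (by gcongr)
        _ = _ := by field_simp
    have h3 : resOp m α S e0 - z - resOp m α T e0 = (resOp m α S e0 - resOp m α T e0) - z := by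
      abel
    rw [h3]
    calc _ ≤ √α * (‖resOp m α S e0 - resOp m α T e0‖ + ‖z‖) := by gcongr; exact norm_sub_le _ _
      _ ≤ _ := by rw [mul_add]; exact add_le_add ha h2
  · have h1 : T (resOp m α S e0 - z - resOp m α T e0) + ξ
        = T (resOp m α S e0 - resOp m α T e0) - (T - S) z
          - S (regOp m α S (adjoint S p)) + (ξ - S (regOp m α S (adjoint S ξ))) := by
      simp only [z, map_add, map_sub, sub_apply]
      abel
    rw [h1]
    have h2 := (norm_apply_regOp_adjoint_apply_le S hα m p).trans hp
    have h3 := (norm_sub_apply_regOp_le S hα m ξ).trans hξ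
    refine (norm_add_le _ _).trans (add_le_add ?_ h3)
    refine (norm_sub_le _ _).trans (add_le_add ?_ h2)
    exact (norm_sub_le _ _).trans (add_le_add hb hc)

/-- Replacing `S` by `T` costs a factor `L E`, which has no smoothing. The source element
compensates: filtered with a resolvent, `e0 = T* u` has size `√α ‖u‖`, and its image has size `α
‖u‖`. -/
theorem newton_step_lipschitz (hm : 1 ≤ m) (hα : 0 < α) (hξ : ‖ξ‖ ≤ δ) {L E c_e : ℝ} {u : Y}
    (hu : e0 = adjoint T u) (hL : 0 ≤ L) (hE : 0 ≤ E) (hST : ‖S - T‖ ≤ L * E)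
    (hEu : E ≤ c_e * √α * ‖u‖) (hc : 0 ≤ c_e) (hη : c_e * (L * ‖u‖) ≤ 1) (hp : ‖p‖ ≤ L * E ^ 2) :
    √α * ‖resOp m α S e0 - regOp m α S (adjoint S (p + ξ)) - resOp m α T e0‖ ≤
        (4 * m + c_e * (2 + m)) * (L * ‖u‖) * (√α * E) + √m * δ ∧
      ‖T (resOp m α S e0 - regOp m α S (adjoint S (p + ξ)) - resOp m α T e0) + ξ‖ ≤
        (4 * m + c_e * (2 + m)) * (L * ‖u‖) * (√α * E)
          + (1 + (4 * m + c_e * (2 + m)) * (L * ‖u‖)) * δ := by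
  have hm' : (1 : ℝ) ≤ m := by exact_mod_cast hm
  have hδ : 0 ≤ δ := (norm_nonneg _).trans hξ
  have hs : 0 < √α := Real.sqrt_pos.2 hα
  have hss : √α * √α = α := Real.mul_self_sqrt hα.le
  have hsm : √(m : ℝ) ≤ m := sqrt_le_self_of_one_le hm'
  set η := L * ‖u‖ with hηdef
  have hη0 : 0 ≤ η := by positivity
  have hTS : ‖T - S‖ ≤ L * E := by rwa [norm_sub_rev]
  have hLE : L * E ≤ c_e * η * √α := by
    calc L * E ≤ L * (c_e * √α * ‖u‖) := by gcongr
      _ = _ := by rw [hηdef]; ring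
  have hLE1 : L * E ≤ √α := hLE.trans (by nlinarith)
  have hTSx (x : X) : ‖(T - S) x‖ ≤ L * E * ‖x‖ := le_of_opNorm_le _ hTS x
  have hTSy (y : Y) : ‖adjoint (T - S) y‖ ≤ L * E * ‖y‖ :=
    le_of_opNorm_le _ (by rwa [LinearIsometryEquiv.norm_map]) y
  have hj {j : ℕ} (hj : 1 ≤ j) : ‖resOp j α T e0‖ ≤ √α * ‖u‖ := by
    rw [hu]; exact norm_resOp_adjoint_apply_le T hα hj u
  have hj' {j : ℕ} (hj : 1 ≤ j) : ‖T (resOp j α T e0)‖ ≤ α * ‖u‖ := by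
    rw [hu]; exact norm_apply_resOp_adjoint_apply_le T hα hj u
  have hΔ : ‖resOp m α S e0 - resOp m α T e0‖ ≤ m * (2 * (η * E)) := by
    refine norm_resOp_sub_apply_le hα S T m e0 (ContinuousLinearMap.id 𝕜 X) fun i j hi hj1 => ?_
    rw [gram_sub_gram, map_add, map_add]
    refine (norm_add_le _ _).trans ?_
    have h1 : ‖resOp i α S (adjoint S ((T - S) (resOp j α T e0)))‖ ≤ α * (η * E) := by
      calc _ ≤ √α * (L * E * (√α * ‖u‖)) :=
            (norm_resOp_adjoint_apply_le S hα hi _).trans (by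
              gcongr; exact (hTSx _).trans (by gcongr; exact hj hj1))
        _ = α * (η * E) := by rw [hηdef]; linear_combination (L * E * ‖u‖) * hss
    have h2 : ‖resOp i α S (adjoint (T - S) (T (resOp j α T e0)))‖ ≤ α * (η * E) := by
      calc _ ≤ L * E * (α * ‖u‖) :=
            (norm_resOp_apply_le S hα i _).trans ((hTSy _).trans (by gcongr; exact hj' hj1))
        _ = α * (η * E) := by rw [hηdef]; ring
    simp only [id_apply]
    linarith
  have hSΔ : ‖S (resOp m α S e0 - resOp m α T e0)‖ ≤ m * (2 * (η * (√α * E))) := by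
    refine norm_resOp_sub_apply_le hα S T m e0 S fun i j hi hj1 => ?_
    rw [gram_sub_gram, map_add, map_add]
    refine (norm_add_le _ _).trans ?_
    have h1 : ‖S (resOp i α S (adjoint S ((T - S) (resOp j α T e0))))‖ ≤ α * (η * (√α * E)) := by
      calc _ ≤ α * (L * E * (√α * ‖u‖)) :=
            (norm_apply_resOp_adjoint_apply_le S hα hi _).trans (by
              gcongr; exact (hTSx _).trans (by gcongr; exact hj hj1))
        _ = α * (η * (√α * E)) := by rw [hηdef]; ring
    have h2 : ‖S (resOp i α S (adjoint (T - S) (T (resOp j α T e0))))‖ ≤ α * (η * (√α * E)) := by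
      calc _ ≤ √α * (L * E * (α * ‖u‖)) :=
            (norm_apply_resOp_le S hα hi _).trans (by
              gcongr; exact (hTSy _).trans (by gcongr; exact hj' hj1))
        _ = α * (η * (√α * E)) := by rw [hηdef]; ring
    linarith
  have hTΔ : ‖T (resOp m α S e0 - resOp m α T e0)‖ ≤ 4 * m * η * (√α * E) := by
    set Δ := resOp m α S e0 - resOp m α T e0
    have h1 : T Δ = S Δ + (T - S) Δ := by simp
    rw [h1]
    have h2 : ‖(T - S) Δ‖ ≤ √α * (m * (2 * (η * E))) :=
      (hTSx Δ).trans (by gcongr)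
    calc _ ≤ _ := (norm_add_le _ _).trans (add_le_add hSΔ h2)
      _ = _ := by ring
  have hpE : L * E ^ 2 ≤ c_e * η * (√α * E) := by
    calc L * E ^ 2 = L * E * E := by ring
      _ ≤ c_e * η * √α * E := by gcongr
      _ = _ := by ring
  have hcw : ‖(T - S) (regOp m α S (adjoint S (p + ξ)))‖ ≤
      c_e * η * √m * (c_e * η * (√α * E) + δ) := by
    have h1 : ‖p + ξ‖ ≤ c_e * η * (√α * E) + δ :=
      (norm_add_le _ _).trans (add_le_add (hp.trans hpE) hξ)
    calc _ ≤ c_e * η * √α * (√m / √α * (c_e * η * (√α * E) + δ)) :=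
          (hTSx _).trans (by
            gcongr
            exact (norm_regOp_adjoint_apply_le S hα m _).trans (by gcongr))
      _ = _ := by field_simp
  have hΔ' : √α * ‖resOp m α S e0 - resOp m α T e0‖ ≤ √α * (m * (2 * (η * E))) := by gcongr
  obtain ⟨h1, h2⟩ := newton_step_le (m := m) hα hξ (hp.trans hpE) hΔ' hTΔ hcw
  have hx : 0 ≤ η * (√α * E) := by positivity
  have hcx : 0 ≤ c_e * (η * (√α * E)) := by positivity
  have hmx : 0 ≤ m * (η * (√α * E)) := by positivity
  have hcm : √m * (c_e * (η * (√α * E))) ≤ m * (c_e * (η * (√α * E))) := by gcongr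
  have hcm2 : c_e * η * √m * (c_e * η * (√α * E)) ≤ m * (c_e * (η * (√α * E))) := by
    calc c_e * η * √m * (c_e * η * (√α * E)) = (c_e * η) * (√m * (c_e * (η * (√α * E)))) := by ring
      _ ≤ 1 * (m * (c_e * (η * (√α * E)))) := by gcongr
      _ = _ := one_mul _
  have hcδ : c_e * η * √m * δ ≤ c_e * η * m * δ := by gcongr
  have h5 : 0 ≤ c_e * η * δ := by positivity
  have h6 : 0 ≤ m * η * δ := by positivity
  constructor
  · refine h1.trans ?_
    linarith
  · refine h2.trans ?_
    linarith

/-- Without a source element, powers of `√α` come from the structure conditions. The derivative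
bound turns `S - T` into `T` up to small terms, and range invariance does the same for the adjoint.
The derivative bound is used in both directions, because the filters contain `S` while the target is
expressed through `T`. -/
theorem newton_step_structure (hm : 1 ≤ m) (hα : 0 < α) (hξ : ‖ξ‖ ≤ δ) {R : X →L[𝕜] X} {e : X}
    {K₀ K₁ K₂ M C : ℝ} (hK₀ : 0 ≤ K₀) (hK₁ : 0 ≤ K₁) (hK₂ : 0 ≤ K₂)
    (hSR : S = T.comp R) (hR : ‖ContinuousLinearMap.id 𝕜 X - R‖ ≤ K₀ * ‖e‖)
    (hST : ∀ w, ‖(S - T) w‖ ≤ K₁ * ‖e‖ * ‖T w‖ + K₂ * ‖T e‖ * ‖w‖)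
    (hTS : ∀ w, ‖(T - S) w‖ ≤ K₁ * ‖e‖ * ‖S w‖ + K₂ * ‖S e‖ * ‖w‖)
    (hM : 1 ≤ M) (hC : 0 ≤ C) (he : ‖e‖ ≤ M * ‖e0‖) (hTe : ‖T e‖ ≤ C * √α * ‖e0‖)
    (hη : (M + 2 * m * C) * ((K₀ + K₁ + K₂) * ‖e0‖) ≤ 1)
    (hp : ‖p‖ ≤ (K₁ + K₂) * ‖e‖ * ‖S e‖) :
    √α * ‖resOp m α S e0 - regOp m α S (adjoint S (p + ξ)) - resOp m α T e0‖ ≤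
        (2 * m + 4 + (4 * m + 5) * M + 2 * m * C) * ((K₀ + K₁ + K₂) * ‖e0‖) * scaledNorm T α e
          + √m * δ ∧
      ‖T (resOp m α S e0 - regOp m α S (adjoint S (p + ξ)) - resOp m α T e0) + ξ‖ ≤
        (2 * m + 4 + (4 * m + 5) * M + 2 * m * C) * ((K₀ + K₁ + K₂) * ‖e0‖) * scaledNorm T α e
          + (1 + (2 * m + 4 + (4 * m + 5) * M + 2 * m * C) * ((K₀ + K₁ + K₂) * ‖e0‖)) * δ := by
  have hm' : (1 : ℝ) ≤ m := by exact_mod_cast hm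
  have hδ : 0 ≤ δ := (norm_nonneg _).trans hξ
  have hs : 0 < √α := Real.sqrt_pos.2 hα
  have hss : √α * √α = α := Real.mul_self_sqrt hα.le
  have hsm : √(m : ℝ) ≤ m := sqrt_le_self_of_one_le hm'
  set η := (K₀ + K₁ + K₂) * ‖e0‖ with hηdef
  have hη0 : 0 ≤ η := by positivity
  set σ := scaledNorm T α e with hσdef
  have hσ : σ = √α * ‖e‖ + ‖T e‖ := rfl
  have hσ0 : 0 ≤ σ := scaledNorm_nonneg T α e
  have hTeσ : ‖T e‖ ≤ σ := by rw [hσ]; exact le_add_of_nonneg_left (by positivity)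
  have hMη : M * η ≤ 1 := by
    have : 0 ≤ 2 * m * C * η := by positivity
    linarith
  have hK12 : (K₁ + K₂) * ‖e‖ ≤ M * η := by
    calc (K₁ + K₂) * ‖e‖ ≤ (K₀ + K₁ + K₂) * (M * ‖e0‖) := by gcongr; linarith
      _ = _ := by rw [hηdef]; ring
  have hK1 : K₁ * ‖e‖ ≤ M * η := le_trans (by gcongr; linarith) hK12
  have hK2η : K₂ * ‖e0‖ ≤ η := by rw [hηdef]; gcongr; linarith
  have hSe : ‖S e‖ ≤ 2 * ‖T e‖ := by
    have h1 : S e = T e + (S - T) e := by simp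
    have h2 := hST e
    have h3 : (K₁ + K₂) * ‖e‖ * ‖T e‖ ≤ 1 * ‖T e‖ := by gcongr; exact hK12.trans hMη
    have h4 : ‖S e‖ ≤ ‖T e‖ + ‖(S - T) e‖ := by
      conv_lhs => rw [h1]
      exact norm_add_le _ _
    linarith
  have hTS' (w : X) : ‖(T - S) w‖ ≤ K₁ * ‖e‖ * ‖S w‖ + 2 * K₂ * ‖T e‖ * ‖w‖ := by
    have h1 : K₂ * ‖S e‖ * ‖w‖ ≤ K₂ * (2 * ‖T e‖) * ‖w‖ := by gcongr
    linarith [hTS w]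
  -- From `T - S = T (I - R)` the adjoint is `(I - R)* T*`, so a factor `T*` is retained and can be
  -- smoothed by the resolvent of `T*T`.
  have hadj (y : Y) : ‖adjoint (T - S) y‖ ≤ K₀ * ‖e‖ * ‖adjoint T y‖ := by
    have h1 : T - S = T.comp (ContinuousLinearMap.id 𝕜 X - R) := by
      rw [hSR, comp_sub, comp_id]
    rw [h1, adjoint_comp]
    exact le_of_opNorm_le _ ((LinearIsometryEquiv.norm_map adjoint _).trans_le hR) _
  have hfirst {j : ℕ} (hj : 1 ≤ j) :
      ‖(T - S) (resOp j α T e0)‖ ≤ (K₁ * (√α * ‖e‖) + K₂ * ‖T e‖) * ‖e0‖ := by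
    rw [← norm_neg, ← neg_apply, neg_sub]
    calc _ ≤ K₁ * ‖e‖ * (√α * ‖e0‖) + K₂ * ‖T e‖ * ‖e0‖ := by
          refine (hST _).trans ?_
          gcongr
          · exact norm_apply_resOp_le T hα hj e0
          · exact norm_resOp_apply_le T hα j e0
      _ = _ := by ring
  have hsecond {j : ℕ} (hj : 1 ≤ j) :
      ‖adjoint (T - S) (T (resOp j α T e0))‖ ≤ α * (K₀ * ‖e‖ * ‖e0‖) := by
    refine (hadj _).trans ?_
    calc _ ≤ K₀ * ‖e‖ * (α * ‖e0‖) := by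
          gcongr; exact norm_gram_resOp_le T hα hj e0
      _ = _ := by ring
  have hsum : (K₁ * (√α * ‖e‖) + K₂ * ‖T e‖) * ‖e0‖ + √α * (K₀ * ‖e‖ * ‖e0‖) ≤ η * σ := by
    have : η * σ = (K₁ * (√α * ‖e‖) + K₂ * ‖T e‖) * ‖e0‖ + √α * (K₀ * ‖e‖ * ‖e0‖)
        + (K₂ * (√α * ‖e‖) + (K₀ + K₁) * ‖T e‖) * ‖e0‖ := by rw [hηdef, hσ]; ring
    rw [this]
    exact le_add_of_nonneg_right (by positivity)
  set Δ := resOp m α S e0 - resOp m α T e0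
  have hΔ : √α * ‖Δ‖ ≤ m * (η * σ) := by
    have h0 : ‖Δ‖ ≤ m * (η * σ / √α) := by
      refine norm_resOp_sub_apply_le hα S T m e0 (ContinuousLinearMap.id 𝕜 X)
        fun i j hi hj1 => ?_
      rw [gram_sub_gram, map_add, map_add]
      refine (norm_add_le _ _).trans ?_
      simp only [id_apply]
      have h1 := (norm_resOp_adjoint_apply_le S hα hi ((T - S) (resOp j α T e0))).trans
        (mul_le_mul_of_nonneg_left (hfirst hj1) hs.le)
      have h2 := (norm_resOp_apply_le S hα i _).trans (hsecond hj1)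
      have h3 : α * (η * σ / √α) = √α * (η * σ) := by
        nth_rewrite 1 [← hss]; field_simp
      rw [h3]
      have h4 : α * (K₀ * ‖e‖ * ‖e0‖) = √α * (√α * (K₀ * ‖e‖ * ‖e0‖)) := by
        nth_rewrite 1 [← hss]; ring
      rw [h4] at h2
      have := mul_le_mul_of_nonneg_left hsum hs.le
      linarith
    calc √α * ‖Δ‖ ≤ √α * (m * (η * σ / √α)) := by gcongr
      _ = _ := by field_simp
  have hSΔ : ‖S Δ‖ ≤ m * (η * σ) := by
    refine norm_resOp_sub_apply_le hα S T m e0 S fun i j hi hj1 => ?_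
    rw [gram_sub_gram, map_add, map_add]
    refine (norm_add_le _ _).trans ?_
    have h1 := (norm_apply_resOp_adjoint_apply_le S hα hi ((T - S) (resOp j α T e0))).trans
      (mul_le_mul_of_nonneg_left (hfirst hj1) hα.le)
    have h2 := (norm_apply_resOp_le S hα hi _).trans
      (mul_le_mul_of_nonneg_left (hsecond hj1) hs.le)
    have := mul_le_mul_of_nonneg_left hsum hα.le
    linarith
  have hΔ2 : ‖Δ‖ ≤ 2 * ‖e0‖ := by
    have h1 := norm_resOp_apply_le S hα m e0
    have h2 := norm_resOp_apply_le T hα m e0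
    linarith [norm_sub_le (resOp m α S e0) (resOp m α T e0)]
  have hTΔ : ‖T Δ‖ ≤ (2 * m + 4) * (η * σ) := by
    have h1 : T Δ = S Δ + (T - S) Δ := by simp
    have h2 : ‖T Δ‖ ≤ ‖S Δ‖ + ‖(T - S) Δ‖ := by
      conv_lhs => rw [h1]
      exact norm_add_le _ _
    have h3 : K₁ * ‖e‖ * ‖S Δ‖ ≤ 1 * (m * (η * σ)) := by gcongr; exact hK1.trans hMη
    have h4 : 2 * K₂ * ‖T e‖ * ‖Δ‖ ≤ 4 * (η * σ) := by
      calc 2 * K₂ * ‖T e‖ * ‖Δ‖ ≤ 2 * K₂ * σ * (2 * ‖e0‖) := by gcongr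
        _ = 4 * ((K₂ * ‖e0‖) * σ) := by ring
        _ ≤ 4 * (η * σ) := by gcongr
    linarith [hTS' Δ]
  have hp' : ‖p‖ ≤ 2 * M * (η * σ) := by
    calc ‖p‖ ≤ (K₁ + K₂) * ‖e‖ * ‖S e‖ := hp
      _ ≤ M * η * (2 * σ) := by gcongr; linarith
      _ = _ := by ring
  have hpξ : ‖p + ξ‖ ≤ 2 * M * (η * σ) + δ := (norm_add_le _ _).trans (add_le_add hp' hξ)
  set w := regOp m α S (adjoint S (p + ξ))
  have hcw : ‖(T - S) w‖ ≤ (M + 2 * m * C) * η * (2 * M * (η * σ) + δ) := by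
    have h1 : ‖S w‖ ≤ 2 * M * (η * σ) + δ := (norm_apply_regOp_adjoint_apply_le S hα m _).trans hpξ
    have h2 : ‖w‖ ≤ m / √α * (2 * M * (η * σ) + δ) :=
      (norm_regOp_adjoint_apply_le S hα m _).trans (by gcongr)
    have h3 : 2 * K₂ * ‖T e‖ * ‖w‖ ≤ 2 * m * C * η * (2 * M * (η * σ) + δ) := by
      calc 2 * K₂ * ‖T e‖ * ‖w‖
          ≤ 2 * K₂ * (C * √α * ‖e0‖) * (m / √α * (2 * M * (η * σ) + δ)) := by gcongr
        _ = 2 * m * C * (K₂ * ‖e0‖) * (2 * M * (η * σ) + δ) := by field_simp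
        _ ≤ _ := by gcongr
    have h4 : K₁ * ‖e‖ * ‖S w‖ ≤ M * η * (2 * M * (η * σ) + δ) := by gcongr
    linarith [hTS' w]
  obtain ⟨h1, h2⟩ := newton_step_le (m := m) hα hξ hp' hΔ hTΔ hcw
  have hx : 0 ≤ η * σ := by positivity
  have hMx : 0 ≤ M * (η * σ) := by positivity
  have hmx : 0 ≤ m * (η * σ) := by positivity
  have hmMx : √m * (M * (η * σ)) ≤ m * (M * (η * σ)) := by gcongr
  have hmMx0 : 0 ≤ m * (M * (η * σ)) := by positivity
  have hmCx : 0 ≤ m * C * (η * σ) := by positivity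
  have hxx : (M + 2 * m * C) * η * (2 * M * (η * σ)) ≤ 1 * (2 * M * (η * σ)) := by gcongr
  have h5 : 0 ≤ η * δ := by positivity
  have h6 : 0 ≤ m * (η * δ) := by positivity
  have h7 : 0 ≤ M * (η * δ) := by positivity
  have h8 : 0 ≤ m * (M * (η * δ)) := by positivity
  constructor
  · refine h1.trans ?_
    linarith
  · refine h2.trans ?_
    linarith

end Step

/-! ### Consequences of the standing assumptions, and the recursion for the errors. -/

namespace NewtonData

open ContinuousLinearMap

variable {𝕜 : Type u} {X : Type v} {Y : Type w} [RCLike 𝕜]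
  [NormedAddCommGroup X] [InnerProductSpace 𝕜 X]
  [NormedAddCommGroup Y] [InnerProductSpace 𝕜 Y]
  {P : NewtonData 𝕜 X Y} {m : ℕ} {r : ℝ}

theorem Standing.xdag_mem (h : P.Standing m r) : P.xdag ∈ P.ball := Metric.mem_ball_self h.radius_pos

theorem mem_ball_iff {x : X} : x ∈ P.ball ↔ ‖x - P.xdag‖ < P.ρ := by
  rw [ball, Metric.mem_ball, dist_eq_norm]

/-- Mean value inequality along the segment from `x†` to `x`. -/
theorem Standing.norm_image_sub_le (h : P.Standing m r) {x : X} (hx : x ∈ P.ball)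
    (A : X →L[𝕜] Y) {B : ℝ}
    (hB : ∀ s : ℝ, 0 ≤ s → s ≤ 1 → P.xdag + (s : 𝕜) • (x - P.xdag) ∈ P.ball →
      ‖(P.F' (P.xdag + (s : 𝕜) • (x - P.xdag)) - A) (x - P.xdag)‖ ≤ B) :
    ‖P.F x - P.y - A (x - P.xdag)‖ ≤ B := by
  set e := x - P.xdag with he
  have hmem : ∀ s : ℝ, 0 ≤ s → s ≤ 1 → P.xdag + (s : 𝕜) • e ∈ P.ball := fun s hs0 hs1 => by
    rw [mem_ball_iff, add_sub_cancel_left, norm_smul, RCLike.norm_ofReal, abs_of_nonneg hs0]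
    exact (mul_le_of_le_one_left (norm_nonneg _) hs1).trans_lt (mem_ball_iff.1 hx)
  let f : 𝕜 → Y := fun t => P.F (P.xdag + t • e) - t • A e
  -- The segment is parametrized by the copy of `[0, 1]` inside `𝕜`, so that the mean value
  -- inequality covers both scalar fields.
  let I : Set 𝕜 := (fun s : ℝ => (s : 𝕜)) '' Set.Icc 0 1
  have hI : Convex ℝ I := (convex_Icc 0 1).linear_image (RCLike.ofRealCLM (K := 𝕜)).toLinearMap
  have hder : ∀ t ∈ I, HasDerivWithinAt f ((P.F' (P.xdag + t • e) - A) e) I t := by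
    rintro _ ⟨s, hs, rfl⟩
    have hb := hmem s hs.1 hs.2
    have h1 : HasFDerivAt P.F (P.F' (P.xdag + (s : 𝕜) • e)) (P.xdag + (s : 𝕜) • e) :=
      (h.hasFDeriv _ (h.ball_subset hb)).hasFDerivAt
        (Filter.mem_of_superset (Metric.isOpen_ball.mem_nhds hb) h.ball_subset)
    have h2 : HasDerivAt (fun t : 𝕜 => P.xdag + t • e) e (s : 𝕜) := by
      simpa using ((hasDerivAt_id (s : 𝕜)).smul_const e).const_add P.xdag
    have h3 : HasDerivAt (fun t : 𝕜 => t • A e) (A e) (s : 𝕜) := by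
      simpa using (hasDerivAt_id (s : 𝕜)).smul_const (A e)
    exact ((h1.comp_hasDerivAt (s : 𝕜) h2).sub h3).hasDerivWithinAt
  have hbound : ∀ t ∈ I, ‖(P.F' (P.xdag + t • e) - A) e‖ ≤ B := by
    rintro _ ⟨s, hs, rfl⟩
    exact hB s hs.1 hs.2 (hmem s hs.1 hs.2)
  have := hI.norm_image_sub_le_of_norm_hasDerivWithin_le hder hbound
    (x := 0) (y := 1) ⟨0, by simp⟩ ⟨1, by simp⟩
  have hf1 : f 1 = P.F x - A e := by simp [f, he]
  have hf0 : f 0 = P.y := by simp [f, y]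
  rw [hf1, hf0] at this
  simpa [sub_right_comm] using this

theorem Standing.norm_deriv_le (h : P.Standing m r) : ‖P.F' P.xdag‖ ≤ c₃ m * √(P.α 0) := by
  obtain ⟨β₀, hβ, hβ2, -, h2⟩ := h.scaling
  exact (h2 _ h.xdag_mem).trans (min_le_left _ _)

variable [CompleteSpace X] [CompleteSpace Y]

theorem Standing.admissibleParameters (h : P.Standing m r) (hr : 1 < r) :
    AdmissibleParameters m r (P.F' P.xdag) P.α where
  one_le := hr.le
  pos := h.alpha_pos
  anti k := by
    have := (h.alpha_ratio k).1
    rwa [one_le_div (h.alpha_pos _)] at this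
  le_mul k := by
    have := (h.alpha_ratio k).2
    rwa [div_le_iff₀ (h.alpha_pos _)] at this
  start t ht := by
    obtain ⟨β₀, hβ, -, h1, h2⟩ := h.scaling
    rw [← tikhonovResidual_eq m (h.alpha_pos 0) ht.1]
    refine h1 t ⟨ht.1, ht.2.trans ?_⟩
    rw [norm_gram]
    have := (h2 _ h.xdag_mem).trans (min_le_right _ _)
    calc _ ≤ √β₀ ^ 2 := by gcongr
      _ = β₀ := Real.sq_sqrt hβ.le

theorem Standing.norm_gram_le (h : P.Standing m r) : ‖gram (P.F' P.xdag)‖ ≤ 1 / 2 := by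
  obtain ⟨β₀, hβ, hβ2, -, h2⟩ := h.scaling
  rw [norm_gram]
  have := (h2 _ h.xdag_mem).trans (min_le_right _ _)
  calc _ ≤ √β₀ ^ 2 := by gcongr
    _ = β₀ := Real.sq_sqrt hβ.le
    _ ≤ 1 / 2 := hβ2

/-- Insert `x_k - x0 = (x_k - x†) - e0`; the term `g_α(S*S) S*S e0` then equals `e0 - r_α(S*S) e0`.
-/
theorem iter_succ_sub (yδ : Y) (k : ℕ) (hα : 0 < P.α k) :
    P.iter m yδ (k + 1) - P.xdag = resOp m (P.α k) (P.F' (P.iter m yδ k)) P.e0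
      - regOp m (P.α k) (P.F' (P.iter m yδ k)) (adjoint (P.F' (P.iter m yδ k))
        ((P.F (P.iter m yδ k) - P.y - P.F' (P.iter m yδ k) (P.iter m yδ k - P.xdag))
          + (P.y - yδ))) := by
  have h0 : P.iter m yδ (k + 1) = P.x0 - regOp m (P.α k) (P.F' (P.iter m yδ k))
      (adjoint (P.F' (P.iter m yδ k)) (P.F (P.iter m yδ k) - yδ
        - P.F' (P.iter m yδ k) (P.iter m yδ k - P.x0))) := rfl
  set x := P.iter m yδ k
  set S := P.F' x
  have h1 : P.F x - yδ - S (x - P.x0) = ((P.F x - P.y - S (x - P.xdag)) + (P.y - yδ)) + S P.e0 := by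
    simp only [map_sub, e0]; abel
  have h2 := regOp_gram_apply S hα m P.e0
  rw [gram_apply] at h2
  rw [h0, h1, map_add (adjoint S), map_add, h2]
  simp only [e0]
  abel

theorem iter_zero_sub (yδ : Y) : P.iter m yδ 0 - P.xdag = P.e0 := rfl

end NewtonData

/-! ### Residual bounds for perturbed linear iterations. -/

section NearLinearResidual

open ContinuousLinearMap

variable {𝕜 : Type u} {X : Type v} {Y : Type w} [RCLike 𝕜]
  [NormedAddCommGroup X] [InnerProductSpace 𝕜 X] [CompleteSpace X]
  [NormedAddCommGroup Y] [InnerProductSpace 𝕜 Y] [CompleteSpace Y]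
  {m : ℕ} {T : X →L[𝕜] Y} {α : ℕ → ℝ} {e0 : X} {ξ : Y} {δ ε : ℝ} {N : ℕ}
  {e : ℕ → X} {R : ℕ → Y}

namespace NearLinear

theorem mono (h : NearLinear m T α e0 ξ δ ε N e R) {N' : ℕ} (hN : N' ≤ N) :
    NearLinear m T α e0 ξ δ ε N' e R where
  data := h.data
  zero := h.zero
  error k hk := h.error k (hk.trans_le hN)
  image k hk := h.image k (hk.trans_le hN)
  residual k hk := h.residual k (hk.trans hN)

theorem norm_residual_zero_le (h : NearLinear m T α e0 ξ δ ε N e R) :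
    ‖R 0‖ ≤ ε * scaledNorm T (α 0) e0 + δ + ‖T e0‖ := by
  have h1 := h.residual 0 (Nat.zero_le _)
  rw [h.zero] at h1
  calc ‖R 0‖ = ‖(R 0 - ξ - T e0) + ξ + T e0‖ := by congr 1; abel
    _ ≤ _ := norm_add₃_le.trans (add_le_add (add_le_add h1 h.data) le_rfl)

theorem norm_residual_succ_le (h : NearLinear m T α e0 ξ δ ε N e R) {k : ℕ} (hk : k < N) :
    ‖R (k + 1)‖ ≤ ε * scaledNorm T (α (k + 1)) (e (k + 1)) +
      (ε * scaledNorm T (α k) (e k) + (1 + ε) * δ) + ‖T (resOp m (α k) T e0)‖ := by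
  calc ‖R (k + 1)‖ = ‖(R (k + 1) - ξ - T (e (k + 1)))
        + (T (e (k + 1) - resOp m (α k) T e0) + ξ) + T (resOp m (α k) T e0)‖ := by
        congr 1; rw [map_sub]; abel
    _ ≤ _ := norm_add₃_le.trans
      (add_le_add (add_le_add (h.residual (k + 1) hk) (h.image k hk)) le_rfl)

end NearLinear

end NearLinearResidual

/-! ### Taylor remainders, and existence of the stopping index from an a priori index. -/

namespace NewtonData

open ContinuousLinearMap

variable {𝕜 : Type u} {X : Type v} {Y : Type w} [RCLike 𝕜]
  [NormedAddCommGroup X] [InnerProductSpace 𝕜 X]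
  [NormedAddCommGroup Y] [InnerProductSpace 𝕜 Y]
  {P : NewtonData 𝕜 X Y} {m : ℕ} {r τ δ : ℝ} {yδ : Y}

/-- Both choices of `z` are needed: linearization at the iterate enters the Newton step,
linearization at `x†` enters the residual. -/
theorem Standing.norm_remainder_le_of_lipschitz (h : P.Standing m r) {L : ℝ} (hL : 0 ≤ L)
    (hlip : P.LipschitzDeriv L) {x z : X} (hx : x ∈ P.ball) (hz : z = x ∨ z = P.xdag) :
    ‖P.F x - P.y - P.F' z (x - P.xdag)‖ ≤ L * ‖x - P.xdag‖ ^ 2 := by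
  have hzb : z ∈ P.ball := by
    rcases hz with rfl | rfl
    exacts [hx, h.xdag_mem]
  refine h.norm_image_sub_le hx _ fun s hs0 hs1 hb => ?_
  have h1 := hlip _ hb z hzb
  have h2 : ‖P.xdag + (s : 𝕜) • (x - P.xdag) - z‖ ≤ ‖x - P.xdag‖ := by
    rcases hz with rfl | rfl
    · have : P.xdag + (s : 𝕜) • (z - P.xdag) - z = -(((1 - s : ℝ) : 𝕜) • (z - P.xdag)) := by
        push_cast
        rw [sub_smul, one_smul]; abel
      rw [this, norm_neg, norm_smul, RCLike.norm_ofReal, abs_of_nonneg (by linarith)]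
      exact mul_le_of_le_one_left (norm_nonneg _) (by linarith)
    · rw [add_sub_cancel_left, norm_smul, RCLike.norm_ofReal, abs_of_nonneg hs0]
      exact mul_le_of_le_one_left (norm_nonneg _) hs1
  calc _ ≤ L * ‖x - P.xdag‖ * ‖x - P.xdag‖ :=
        le_of_opNorm_le _ (h1.trans (by gcongr)) _
    _ = _ := by ring

theorem Standing.norm_remainder_le_of_derivBound (h : P.Standing m r) {K₁ K₂ : ℝ}
    (hd : P.DerivBound K₁ K₂) {x z : X} (hx : x ∈ P.ball) (hz : z = x ∨ z = P.xdag) :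
    ‖P.F x - P.y - P.F' z (x - P.xdag)‖ ≤
      (K₁ + K₂) * ‖x - P.xdag‖ * ‖P.F' z (x - P.xdag)‖ := by
  obtain ⟨hK₁, hK₂, hd⟩ := hd
  have hzb : z ∈ P.ball := by
    rcases hz with rfl | rfl
    exacts [hx, h.xdag_mem]
  refine h.norm_image_sub_le hx _ fun s hs0 hs1 hb => ?_
  have h1 := hd _ hb z hzb (x - P.xdag)
  obtain ⟨q, hq0, hq1, hq⟩ : ∃ q : ℝ, |q| ≤ 1 ∧ 0 ≤ |q| ∧
      P.xdag + (s : 𝕜) • (x - P.xdag) - z = (q : 𝕜) • (x - P.xdag) := by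
    rcases hz with rfl | rfl
    · refine ⟨s - 1, by rw [abs_le]; constructor <;> linarith, abs_nonneg _, ?_⟩
      push_cast
      rw [sub_smul, one_smul]; abel
    · exact ⟨s, by rw [abs_of_nonneg hs0]; exact hs1, abs_nonneg _, by rw [add_sub_cancel_left]⟩
  rw [hq, map_smul, norm_smul, norm_smul, RCLike.norm_ofReal] at h1
  refine h1.trans ?_
  set e := x - P.xdag
  set b := ‖P.F' z e‖
  have hb0 : 0 ≤ b := norm_nonneg _
  calc K₁ * (|q| * ‖e‖) * b + K₂ * (|q| * b) * ‖e‖ = |q| * ((K₁ + K₂) * ‖e‖ * b) := by ring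
    _ ≤ _ := mul_le_of_le_one_left (by positivity) hq0

variable [CompleteSpace X] [CompleteSpace Y]

/-- Covers the degenerate source `ω = 0`, for which the a priori parameter choice would divide by
zero. -/
theorem isStop_zero (h : P.Standing m r) (h0 : P.e0 = 0) (hτ : 1 < τ) (hy : ‖yδ - P.y‖ ≤ δ) :
    P.IsStop m τ δ yδ 0 ∧ P.iter m yδ 0 - P.xdag = 0 := by
  have hδ : 0 ≤ δ := (norm_nonneg _).trans hy
  have hx : P.x0 = P.xdag := sub_eq_zero.1 h0
  have hi : P.iter m yδ 0 = P.xdag := hx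
  refine ⟨⟨fun j hj => ?_, ?_, fun j hj => absurd hj (by lia)⟩, by rw [hi, sub_self]⟩
  · obtain rfl : j = 0 := by lia
    rw [hi]; exact h.ball_subset h.xdag_mem
  · rw [hi, norm_sub_rev]
    exact hy.trans (by nlinarith)

/-- If the iterates are perturbations of those of the linear method up to an index at which the
residual is small, then the stopping index exists. -/
theorem exists_isStop_of_nearLinear (h : P.Standing m r) (hr : 1 < r) (hτ : 1 < τ) {ε : ℝ}
    (hε0 : 0 ≤ ε) (hε : ε ≤ perturbationBound m r τ) {K : ℕ}
    (hball : ∀ k ≤ K, P.iter m yδ k ∈ P.ball)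
    (hn : NearLinear m (P.F' P.xdag) P.α P.e0 (P.y - yδ) δ ε K
      (fun k => P.iter m yδ k - P.xdag) (fun k => P.F (P.iter m yδ k) - yδ))
    (hK : ‖P.F (P.iter m yδ K) - yδ‖ ≤ τ * δ) :
    ∃ k ≤ K, P.IsStop m τ δ yδ k ∧ ∃ (z : X) (D : ℝ),
      StoppedError m (2 * r * (τ + 6 + √m)) τ δ (P.F' P.xdag) P.e0 (P.iter m yδ k - P.xdag) z D := by
  classical
  have hex : ∃ k, ‖P.F (P.iter m yδ k) - yδ‖ ≤ τ * δ := ⟨K, hK⟩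
  have hNK : Nat.find hex ≤ K := Nat.find_min' hex hK
  have hb : ∀ j < Nat.find hex, τ * δ < ‖P.F (P.iter m yδ j) - yδ‖ := fun j hj =>
    not_le.1 (Nat.find_min hex hj)
  refine ⟨Nat.find hex, hNK, ⟨fun j hj => h.ball_subset (hball j (hj.trans hNK)),
    Nat.find_spec hex, hb⟩, ?_⟩
  exact (hn.mono hNK).exists_stoppedError (h.admissibleParameters hr) hτ hε0 hε
    (Nat.find_spec hex) hb

/-- Under a Lipschitz condition the iteration is followed as long as
`lipGamma r τ * δ < α_k * ‖u‖`. -/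
def lipGamma (r τ : ℝ) : ℝ := (τ - 1) / (2 * r)

/-- Under a Lipschitz condition the errors satisfy `‖e k‖ ≤ lipError m r τ * √α_k * ‖u‖`. -/
def lipError (m : ℕ) (r τ : ℝ) : ℝ := 2 * r * (1 + m / lipGamma r τ)

/-- The factor by which the relative size of the perturbations exceeds `L * ‖u‖`. -/
def lipConst (m : ℕ) (r τ : ℝ) : ℝ := 4 * m + lipError m r τ * (2 + m)

/-- The admissible relative size of the perturbations under a Lipschitz condition. -/
def lipBound (m : ℕ) (r τ : ℝ) : ℝ :=
  min (perturbationBound m r τ) (min (1 / (4 * r)) ((τ - 1) / (2 * (1 + lipError m r τ * (τ - 1)))))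

theorem lipGamma_pos (hr : 1 < r) (hτ : 1 < τ) : 0 < lipGamma r τ := by
  have : 0 < τ - 1 := by linarith
  unfold lipGamma; positivity

theorem lipError_pos (m : ℕ) (hr : 1 < r) (hτ : 1 < τ) : 0 < lipError m r τ := by
  have := lipGamma_pos hr hτ
  unfold lipError; positivity

theorem lipConst_pos (m : ℕ) (hr : 1 < r) (hτ : 1 < τ) : 0 < lipConst m r τ := by
  have := lipError_pos m hr hτ
  unfold lipConst; positivity

theorem lipBound_pos (m : ℕ) (hr : 1 < r) (hτ : 1 < τ) : 0 < lipBound m r τ := by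
  have := lipError_pos m hr hτ
  have h1 : 0 < τ - 1 := by linarith
  refine lt_min (perturbationBound_pos m hr.le hτ) (lt_min (by positivity) (by positivity))

end NewtonData

/-! ### The iteration under a Lipschitz condition. -/

namespace NewtonData

open ContinuousLinearMap

variable {𝕜 : Type u} {X : Type v} {Y : Type w} [RCLike 𝕜]
  [NormedAddCommGroup X] [InnerProductSpace 𝕜 X] [CompleteSpace X]
  [NormedAddCommGroup Y] [InnerProductSpace 𝕜 Y] [CompleteSpace Y]
  {P : NewtonData 𝕜 X Y} {m : ℕ} {r τ δ : ℝ} {yδ : Y}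

-- The a priori index `K` is the first with `α_K ‖u‖ ≤ γ δ`. Before it the noise is dominated by
-- `α_k ‖u‖`, so the errors stay of order `√α_k ‖u‖`; at it the linear residual is small enough for
-- the discrepancy principle.
set_option maxHeartbeats 1000000 in
theorem exists_isStop_of_lipschitz (hm : 1 ≤ m) (hr : 1 < r) (hτ : 1 < τ) (h : P.Standing m r)
    {L : ℝ} (hL : 0 ≤ L) (hlip : P.LipschitzDeriv L) (hρ : 4 * ‖P.e0‖ < P.ρ) {u : Y}
    (hu : P.e0 = adjoint (P.F' P.xdag) u)
    (hsmall : lipConst m r τ * (L * ‖u‖) ≤ lipBound m r τ) (hδ : 0 < δ)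
    (hδu : ‖u‖ * δ ≤ lipGamma r τ / (4 * m) * P.ρ ^ 2) (hy : ‖yδ - P.y‖ ≤ δ) :
    ∃ k, P.IsStop m τ δ yδ k ∧ P.iter m yδ k ∈ P.ball ∧ ∃ (z : X) (D : ℝ),
      StoppedError m (2 * r * (τ + 6 + √m)) τ δ (P.F' P.xdag) P.e0
        (P.iter m yδ k - P.xdag) z D := by
  have hm' : (1 : ℝ) ≤ m := by exact_mod_cast hm
  have hr0 : 0 < r := by linarith
  have hτ' : 0 < τ - 1 := by linarith
  set T := P.F' P.xdag
  set e : ℕ → X := fun k => P.iter m yδ k - P.xdag with he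
  set R : ℕ → Y := fun k => P.F (P.iter m yδ k) - yδ with hR
  set ξ := P.y - yδ with hξdef
  have hξ : ‖ξ‖ ≤ δ := by rwa [hξdef, norm_sub_rev]
  have hα := h.admissibleParameters hr
  have hγ := lipGamma_pos hr hτ
  have hce := lipError_pos m hr hτ
  have hγr : 2 * (r * lipGamma r τ) = τ - 1 := by rw [lipGamma]; field_simp
  set γ := lipGamma r τ
  have hcedef : lipError m r τ = 2 * r * (1 + m / γ) := rfl
  set c := lipError m r τ
  set η := L * ‖u‖ with hη
  have hη0 : 0 ≤ η := by positivity
  have hKdef : lipConst m r τ = 4 * m + c * (2 + m) := rfl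
  set ε := lipConst m r τ * η with hε
  have hε0 : 0 ≤ ε := mul_nonneg (lipConst_pos m hr hτ).le hη0
  have hε1 : ε ≤ perturbationBound m r τ := hsmall.trans (min_le_left _ _)
  have hε2 : ε * (4 * r) ≤ 1 := by
    rw [← le_div_iff₀ (by positivity)]
    exact hsmall.trans ((min_le_right _ _).trans (min_le_left _ _))
  have hε3 : ε * (2 * (1 + c * (τ - 1))) ≤ τ - 1 := by
    rw [← le_div_iff₀ (by positivity)]
    exact hsmall.trans ((min_le_right _ _).trans (min_le_right _ _))
  have hε4 : ε ≤ 1 / 4 := by nlinarith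
  have hcη : c * η ≤ ε := by
    rw [hε, hKdef]
    have : 0 ≤ c * η := by positivity
    have : 0 ≤ m * η := by positivity
    have : 0 ≤ m * (c * η) := by positivity
    linarith
  have hsp (k : ℕ) : 0 < √(P.α k) := Real.sqrt_pos.2 (hα.pos k)
  have hss (k : ℕ) : √(P.α k) * √(P.α k) = P.α k := Real.mul_self_sqrt (hα.pos k).le
  have hsr (k : ℕ) : √(P.α k) ≤ r * √(P.α (k + 1)) :=
    (hα.sqrt_le k).trans (by gcongr; exact sqrt_le_self_of_one_le hr.le)
  have hsm : √(m : ℝ) ≤ m := sqrt_le_self_of_one_le hm'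
  have hest : ∀ k, P.iter m yδ k ∈ P.ball → ‖e k‖ ≤ c * √(P.α k) * ‖u‖ →
      √(P.α k) * ‖e (k + 1) - resOp m (P.α k) T P.e0‖ ≤ ε * (√(P.α k) * ‖e k‖) + √m * δ ∧
      ‖T (e (k + 1) - resOp m (P.α k) T P.e0) + ξ‖ ≤
        ε * (√(P.α k) * ‖e k‖) + (1 + ε) * δ := by
    intro k hb hek
    have h1 := newton_step_lipschitz (S := P.F' (P.iter m yδ k)) (T := T)
      (p := P.F (P.iter m yδ k) - P.y - P.F' (P.iter m yδ k) (e k)) hm (hα.pos k) hξ hu hL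
      (norm_nonneg (e k)) (hlip _ hb _ h.xdag_mem) hek hce.le (by linarith)
      (h.norm_remainder_le_of_lipschitz hL hlip hb (Or.inl rfl))
    rw [← iter_succ_sub yδ k (hα.pos k)] at h1
    exact h1
  have hres : ∀ k, P.iter m yδ k ∈ P.ball → ‖e k‖ ≤ c * √(P.α k) * ‖u‖ →
      ‖R k - ξ - T (e k)‖ ≤ ε * (√(P.α k) * ‖e k‖) := by
    intro k hb hek
    have h1 := h.norm_remainder_le_of_lipschitz hL hlip hb (Or.inr rfl)
    have h2 : R k - ξ - T (e k) = P.F (P.iter m yδ k) - P.y - T (e k) := by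
      change P.F (P.iter m yδ k) - yδ - (P.y - yδ) - T (e k) = _
      abel
    rw [h2]
    calc _ ≤ L * ‖e k‖ ^ 2 := h1
      _ = L * ‖e k‖ * ‖e k‖ := by ring
      _ ≤ L * (c * √(P.α k) * ‖u‖) * ‖e k‖ := by gcongr
      _ = c * η * (√(P.α k) * ‖e k‖) := by rw [hη]; ring
      _ ≤ _ := by gcongr
  have hTn : ‖T‖ ≤ √(P.α 0) :=
    h.norm_deriv_le.trans (mul_le_of_le_one_left (Real.sqrt_nonneg _) (c₃_le_one hm))
  have hex : ∃ k, P.α k * ‖u‖ ≤ γ * δ := by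
    have h1 : Tendsto (fun k => P.α k * ‖u‖) atTop (𝓝 (0 * ‖u‖)) :=
      h.alpha_tendsto.mul_const _
    rw [zero_mul] at h1
    obtain ⟨k, hk⟩ := (h1.eventually_lt_const (show 0 < γ * δ by positivity)).exists
    exact ⟨k, hk.le⟩
  classical
  set K := Nat.find hex
  have hKu : P.α K * ‖u‖ ≤ γ * δ := Nat.find_spec hex
  have hc1 : 1 ≤ c := by
    rw [hcedef]
    have : 0 ≤ m / γ := by positivity
    nlinarith
  have hind : ∀ k ≤ K, P.iter m yδ k ∈ P.ball ∧ ‖e k‖ ≤ c * √(P.α k) * ‖u‖ := by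
    intro k
    induction k with
    | zero =>
      intro _
      have he0 : e 0 = P.e0 := rfl
      refine ⟨?_, ?_⟩
      · rw [mem_ball_iff, iter_zero_sub]
        have := norm_nonneg P.e0
        linarith
      · rw [he0, hu]
        refine (le_of_opNorm_le _ ((LinearIsometryEquiv.norm_map adjoint T).trans_le hTn) u).trans ?_
        gcongr
        exact le_mul_of_one_le_left (Real.sqrt_nonneg _) hc1
    | succ k ih =>
      intro hk
      obtain ⟨hb, hek⟩ := ih (by lia)
      have hlt : γ * δ < P.α k * ‖u‖ := not_le.1 (Nat.find_min hex (by lia))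
      have h1 := (hest k hb hek).1
      have h3 : ‖e (k + 1)‖ ≤ ‖e (k + 1) - resOp m (P.α k) T P.e0‖ + ‖resOp m (P.α k) T P.e0‖ := by
        simpa using norm_add_le (e (k + 1) - resOp m (P.α k) T P.e0) (resOp m (P.α k) T P.e0)
      have h3' := mul_le_mul_of_nonneg_left h3 (hsp k).le
      constructor
      · rw [mem_ball_iff]
        change ‖e (k + 1)‖ < P.ρ
        -- Before `K`, `γ δ² < α_k ‖u‖ δ`, and the smallness of `‖u‖ δ` turns this into a bound by
        -- half the radius. The filtered initial error uses less than a quarter, and the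
        -- perturbation, as `ε ≤ 1/4`, at most another quarter.
        have h4 : √m * δ ≤ √(P.α k) * (P.ρ / 2) := by
          refine le_of_sq_le_sq ?_ (by have := h.radius_pos; positivity)
          rw [mul_pow, mul_pow, Real.sq_sqrt (Nat.cast_nonneg _), Real.sq_sqrt (hα.pos k).le]
          have h5 : γ * δ ^ 2 ≤ P.α k * (γ / (4 * m) * P.ρ ^ 2) := by
            calc γ * δ ^ 2 = γ * δ * δ := by ring
              _ ≤ P.α k * ‖u‖ * δ := by gcongr
              _ = P.α k * (‖u‖ * δ) := by ring
              _ ≤ _ := by have := (hα.pos k).le; gcongr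
          have h6 : γ * (m * δ ^ 2) ≤ γ * (P.α k * (P.ρ / 2) ^ 2) := by
            calc γ * (m * δ ^ 2) = m * (γ * δ ^ 2) := by ring
              _ ≤ m * (P.α k * (γ / (4 * m) * P.ρ ^ 2)) := by gcongr
              _ = _ := by field_simp; ring
          exact le_of_mul_le_mul_left h6 hγ
        have h5 := norm_resOp_apply_le T (hα.pos k) m P.e0
        have h6 : ‖e k‖ < P.ρ := mem_ball_iff.1 hb
        have h7 : √(P.α k) * ‖e (k + 1)‖ < √(P.α k) * P.ρ := by
          have h8 : √(P.α k) * ‖resOp m (P.α k) T P.e0‖ < √(P.α k) * (P.ρ / 4) := by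
            have := hsp k
            gcongr
            linarith
          have h9 : ε * (√(P.α k) * ‖e k‖) ≤ 1 / 4 * (√(P.α k) * P.ρ) := by
            have := (hsp k).le
            gcongr
          linarith
        exact lt_of_mul_lt_mul_left h7 (hsp k).le
      · have h4 : ‖resOp m (P.α k) T P.e0‖ ≤ √(P.α k) * ‖u‖ := by
          rw [hu]; exact norm_resOp_adjoint_apply_le T (hα.pos k) hm u
        have h5 : √m * δ ≤ m / γ * (P.α k * ‖u‖) := by
          calc √m * δ ≤ m * δ := by gcongr
            _ = m / γ * (γ * δ) := by field_simp
            _ ≤ _ := by gcongr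
        have h6 : ε * (√(P.α k) * ‖e k‖) ≤ ε * (c * (P.α k * ‖u‖)) := by
          refine mul_le_mul_of_nonneg_left ?_ hε0
          calc √(P.α k) * ‖e k‖ ≤ √(P.α k) * (c * √(P.α k) * ‖u‖) := by
                have := (hsp k).le; gcongr
            _ = c * ((√(P.α k) * √(P.α k)) * ‖u‖) := by ring
            _ = _ := by rw [hss]
        have h7 : √(P.α k) * ‖e (k + 1)‖ ≤ √(P.α k) * ((1 + m / γ + ε * c) * (√(P.α k) * ‖u‖)) := by
          have h8 : √(P.α k) * ((1 + m / γ + ε * c) * (√(P.α k) * ‖u‖))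
            = (1 + m / γ + ε * c) * (P.α k * ‖u‖) := by
            conv_rhs => rw [← hss k]
            ring
          have h9 := mul_le_mul_of_nonneg_left h4 (hsp k).le
          rw [← mul_assoc, hss] at h9
          rw [h8]
          linarith
        have h8 := le_of_mul_le_mul_left h7 (hsp k)
        -- The constant `c` is twice `r (1 + m/γ)`; its other half leaves room for the perturbation.
        have h9 : (1 + m / γ + ε * c) * r ≤ c := by
          have h10 := mul_le_mul_of_nonneg_right hε2 hce.le
          have h11 : (1 + m / γ) * r = c / 2 := by rw [hcedef]; ring
          rw [add_mul, h11]
          linarith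
        calc ‖e (k + 1)‖ ≤ (1 + m / γ + ε * c) * (√(P.α k) * ‖u‖) := h8
          _ ≤ (1 + m / γ + ε * c) * (r * √(P.α (k + 1)) * ‖u‖) := by
            gcongr; exact hsr k
          _ = (1 + m / γ + ε * c) * r * (√(P.α (k + 1)) * ‖u‖) := by ring
          _ ≤ c * (√(P.α (k + 1)) * ‖u‖) := by gcongr
          _ = _ := by ring
  have hwk (k : ℕ) : ε * (√(P.α k) * ‖e k‖) ≤ ε * scaledNorm T (P.α k) (e k) := by
    gcongr
    rw [scaledNorm]; exact le_add_of_nonneg_right (norm_nonneg _)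
  have hn : NearLinear m T P.α P.e0 ξ δ ε K e R := by
    refine ⟨hξ, rfl, fun k hk => ?_, fun k hk => ?_, fun k hk => ?_⟩
    · obtain ⟨hb, hek⟩ := hind k hk.le
      linarith [(hest k hb hek).1, hwk k]
    · obtain ⟨hb, hek⟩ := hind k hk.le
      linarith [(hest k hb hek).2, hwk k]
    · obtain ⟨hb, hek⟩ := hind k hk
      linarith [hres k hb hek, hwk k]
  have hσ : ∀ k ≤ K, √(P.α k) * ‖e k‖ ≤ c * (P.α k * ‖u‖) := fun k hk => by
    calc √(P.α k) * ‖e k‖ ≤ √(P.α k) * (c * √(P.α k) * ‖u‖) := by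
          have := (hsp k).le
          have := (hind k hk).2
          gcongr
      _ = c * ((√(P.α k) * √(P.α k)) * ‖u‖) := by ring
      _ = _ := by rw [hss]
  -- Half of `τ - 1` pays for the linear residual, since `r γ = (τ - 1)/2`; the other half pays for
  -- the perturbations of the last step and of the residual.
  have hfin : (1 + r * γ + ε * (1 + c * (τ - 1))) * δ ≤ τ * δ := by
    gcongr
    linarith
  have hcγ : 0 ≤ ε * c * (γ * δ) := by positivity
  have hrγ : 0 ≤ (r - 1) * (ε * c * (γ * δ)) := mul_nonneg (by linarith) hcγ
  have hεδ : 0 ≤ ε * δ := by positivity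
  have hexp : (1 + r * γ + ε * (1 + c * (τ - 1))) * δ
      = (1 + r * γ + ε) * δ + 2 * (r * (ε * c * (γ * δ))) := by
    rw [← hγr]; ring
  have hdisc : ‖R K‖ ≤ τ * δ := by
    refine le_trans ?_ hfin
    rw [hexp]
    have hbase := hind K le_rfl
    have hresK := hres K hbase.1 hbase.2
    have hσK : ε * (√(P.α K) * ‖e K‖) ≤ ε * c * (γ * δ) := by
      calc _ ≤ ε * (c * (P.α K * ‖u‖)) := mul_le_mul_of_nonneg_left (hσ K le_rfl) hε0
        _ ≤ ε * (c * (γ * δ)) := by gcongr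
        _ = _ := by ring
    generalize hKn : K = n at *
    cases n with
    | zero =>
      have he0 : e 0 = P.e0 := rfl
      have h1 : ‖R 0‖ ≤ ‖R 0 - ξ - T (e 0)‖ + ‖ξ‖ + ‖T (e 0)‖ := by
        calc ‖R 0‖ = ‖(R 0 - ξ - T (e 0)) + ξ + T (e 0)‖ := by congr 1; abel
          _ ≤ _ := norm_add₃_le
      have h2 : ‖T (e 0)‖ ≤ γ * δ := by
        rw [he0, hu]
        calc _ ≤ √(P.α 0) * (√(P.α 0) * ‖u‖) := by
              refine (le_of_opNorm_le _ hTn _).trans ?_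
              gcongr
              exact le_of_opNorm_le _ ((LinearIsometryEquiv.norm_map adjoint T).trans_le hTn) u
          _ = P.α 0 * ‖u‖ := by rw [← mul_assoc, hss]
          _ ≤ _ := hKu
      have h3 : γ * δ ≤ r * γ * δ := by
        rw [mul_assoc]; exact le_mul_of_one_le_left (by positivity) hr.le
      linarith
    | succ k =>
      obtain ⟨hb, hek⟩ := hind k (by lia)
      have h1 := (hest k hb hek).2
      have h2 : ‖R (k + 1)‖ ≤ ‖R (k + 1) - ξ - T (e (k + 1))‖
          + ‖T (e (k + 1) - resOp m (P.α k) T P.e0) + ξ‖ + ‖T (resOp m (P.α k) T P.e0)‖ := by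
        calc ‖R (k + 1)‖ = ‖(R (k + 1) - ξ - T (e (k + 1)))
              + (T (e (k + 1) - resOp m (P.α k) T P.e0) + ξ) + T (resOp m (P.α k) T P.e0)‖ := by
              congr 1; rw [map_sub T (e (k + 1))]; abel
          _ ≤ _ := norm_add₃_le
      have hαu : P.α k * ‖u‖ ≤ r * (γ * δ) := by
        calc P.α k * ‖u‖ ≤ r * P.α (k + 1) * ‖u‖ := by gcongr; exact hα.le_mul k
          _ = r * (P.α (k + 1) * ‖u‖) := by ring
          _ ≤ _ := by gcongr
      have h3 : ‖T (resOp m (P.α k) T P.e0)‖ ≤ r * (γ * δ) := by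
        refine le_trans ?_ hαu
        rw [hu]
        exact norm_apply_resOp_adjoint_apply_le T (hα.pos k) hm u
      have h4 : ε * (√(P.α k) * ‖e k‖) ≤ r * (ε * c * (γ * δ)) := by
        calc _ ≤ ε * (c * (P.α k * ‖u‖)) := mul_le_mul_of_nonneg_left (hσ k (by lia)) hε0
          _ ≤ ε * (c * (r * (γ * δ))) := by gcongr
          _ = _ := by ring
      linarith
  obtain ⟨k, hk, hs, hz⟩ := exists_isStop_of_nearLinear h hr hτ hε0 hε1 (fun k hk => (hind k hk).1)
    hn hdisc
  exact ⟨k, hs, (hind k hk).1, hz⟩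

end NewtonData

/-! ### The iteration under the structure conditions. -/

namespace NewtonData

open ContinuousLinearMap

variable {𝕜 : Type u} {X : Type v} {Y : Type w} [RCLike 𝕜]
  [NormedAddCommGroup X] [InnerProductSpace 𝕜 X] [CompleteSpace X]
  [NormedAddCommGroup Y] [InnerProductSpace 𝕜 Y] [CompleteSpace Y]
  {P : NewtonData 𝕜 X Y} {m : ℕ} {r τ δ γ : ℝ} {yδ : Y}

/-- Under the structure conditions the errors satisfy `‖e k‖ ≤ structError m γ * ‖e0‖`. -/
def structError (m : ℕ) (γ : ℝ) : ℝ := 2 * (1 + c₄ m * γ)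

/-- Under the structure conditions the errors satisfy
`‖F'(x†) e k‖ ≤ structImage r γ * √α_k * ‖e0‖`. -/
def structImage (r γ : ℝ) : ℝ := r * (2 + 3 * γ)

/-- The factor by which the relative size of the perturbations exceeds
`(K₀ + K₁ + K₂) * ‖e0‖`. -/
def structConst (m : ℕ) (r γ : ℝ) : ℝ :=
  2 * m + 4 + (4 * m + 5) * structError m γ + 2 * m * structImage r γ

/-- The admissible relative size of the perturbations. -/
def structBound (m : ℕ) (r τ γ : ℝ) : ℝ :=
  min (perturbationBound m r τ) (min (1 / (structError m γ + structImage r γ))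
    ((τ - 1 - c₃ m * √r / γ) / (1 + (1 + r) * (structError m γ + structImage r γ) / γ)))

theorem two_add_le_structError (hm : 1 ≤ m) (hγ : 0 ≤ γ) : 2 + √m * γ ≤ structError m γ := by
  have h := mul_le_mul_of_nonneg_right (sqrt_le_two_mul_c₄ hm) hγ
  rw [structError]; linarith

theorem structError_pos (hm : 1 ≤ m) (hγ : 0 ≤ γ) : 0 < structError m γ := by
  have : 0 ≤ √(m : ℝ) * γ := by positivity
  linarith [two_add_le_structError hm hγ]

theorem structImage_pos (hr : 1 < r) (hγ : 0 ≤ γ) : 0 < structImage r γ := by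
  rw [structImage]
  have : 0 < r := by linarith
  positivity

theorem structConst_pos (hm : 1 ≤ m) (hr : 1 < r) (hγ : 0 ≤ γ) : 0 < structConst m r γ := by
  have := structError_pos hm hγ
  have := structImage_pos hr hγ
  rw [structConst]; positivity

/-- At the a priori index the linear residual is at most `c₃ √r δ / γ`. The condition on `γ` leaves
a positive gap between this and `(τ - 1) δ`, from which the perturbations are paid. -/
theorem pos_of_c₃_mul_lt (hm : 1 ≤ m) (hr : 1 < r) (hτ : 1 < τ)
    (hγ : c₃ m * √r / (τ - 1) < γ) : 0 < γ ∧ c₃ m * √r / γ < τ - 1 := by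
  have h1 := c₃_pos hm
  have h2 : 0 < √r := Real.sqrt_pos.2 (by linarith)
  have h3 : 0 < τ - 1 := by linarith
  have h4 : 0 < γ := lt_trans (by positivity) hγ
  refine ⟨h4, ?_⟩
  rw [div_lt_iff₀ h3] at hγ
  rw [div_lt_iff₀ h4]
  linarith

theorem structBound_pos (hm : 1 ≤ m) (hr : 1 < r) (hτ : 1 < τ)
    (hγ : c₃ m * √r / (τ - 1) < γ) : 0 < structBound m r τ γ := by
  obtain ⟨h1, h2⟩ := pos_of_c₃_mul_lt hm hr hτ hγ
  have := structError_pos hm h1.le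
  have := structImage_pos hr h1.le
  have : 0 < τ - 1 - c₃ m * √r / γ := by linarith
  have : 0 < r := by linarith
  exact lt_min (perturbationBound_pos m hr.le hτ) (lt_min (by positivity) (by positivity))

/-- The perturbation estimates for one Newton step under the structure conditions. -/
theorem StrongAssumptions.step {η₁ K₀ K₁ K₂ : ℝ} (h : P.StrongAssumptions m r γ η₁ K₀ K₁ K₂)
    (hm : 1 ≤ m) (hr : 1 < r) (hγ : 0 < γ) (hy : ‖yδ - P.y‖ ≤ δ)
    (hsmall : structConst m r γ * ((K₀ + K₁ + K₂) * ‖P.e0‖) ≤ 1) {k : ℕ}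
    (hb : P.iter m yδ k ∈ P.ball)
    (he : ‖P.iter m yδ k - P.xdag‖ ≤ structError m γ * ‖P.e0‖)
    (hTe : ‖P.F' P.xdag (P.iter m yδ k - P.xdag)‖ ≤ structImage r γ * √(P.α k) * ‖P.e0‖) :
    √(P.α k) * ‖P.iter m yδ (k + 1) - P.xdag - resOp m (P.α k) (P.F' P.xdag) P.e0‖ ≤
        structConst m r γ * ((K₀ + K₁ + K₂) * ‖P.e0‖) *
          scaledNorm (P.F' P.xdag) (P.α k) (P.iter m yδ k - P.xdag) + √m * δ ∧
      ‖P.F' P.xdag (P.iter m yδ (k + 1) - P.xdag - resOp m (P.α k) (P.F' P.xdag) P.e0)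
          + (P.y - yδ)‖ ≤
        structConst m r γ * ((K₀ + K₁ + K₂) * ‖P.e0‖) *
          scaledNorm (P.F' P.xdag) (P.α k) (P.iter m yδ k - P.xdag) +
        (1 + structConst m r γ * ((K₀ + K₁ + K₂) * ‖P.e0‖)) * δ := by
  have hM := structError_pos hm hγ.le
  have hM2 := two_add_le_structError hm hγ.le
  have hmγ : 0 ≤ √(m : ℝ) * γ := by positivity
  have hC := structImage_pos hr hγ.le
  obtain ⟨hK₀, R, hR⟩ := h.rangeInvariance
  have hd := h.derivBound
  obtain ⟨hK₁, hK₂, hd'⟩ := hd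
  have hx := h.standing.xdag_mem
  rw [iter_succ_sub yδ k (h.standing.alpha_pos k)]
  refine newton_step_structure hm (h.standing.alpha_pos k) (by rwa [norm_sub_rev]) hK₀.le hK₁.le
    hK₂.le (hR _ hb _ hx).1 (hR _ hb _ hx).2 (hd' _ hb _ hx) (fun w => ?_) (by linarith) hC.le he
    hTe ?_ (h.standing.norm_remainder_le_of_derivBound h.derivBound hb (Or.inl rfl))
  · have h1 := hd' _ hx _ hb w
    rwa [← neg_sub (P.iter m yδ k), map_neg, norm_neg, norm_neg] at h1
  · refine le_trans ?_ hsmall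
    refine mul_le_mul_of_nonneg_right ?_ (by positivity)
    rw [structConst]
    have : 0 ≤ m * structError m γ := by positivity
    have : (0 : ℝ) ≤ m := by positivity
    linarith

-- Here `K` is the first index with `γ √α_K ‖e0‖ ≤ δ`. Before it, `δ/√α_k` is below `γ ‖e0‖`, so all
-- errors stay within a fixed multiple of `‖e0‖`, which the radius condition keeps inside the ball.
set_option maxHeartbeats 1000000 in
theorem StrongAssumptions.exists_isStop {η₁ K₀ K₁ K₂ : ℝ}
    (h : P.StrongAssumptions m r γ η₁ K₀ K₁ K₂)
    (hm : 1 ≤ m) (hr : 1 < r) (hτ : 1 < τ) (hγ : c₃ m * √r / (τ - 1) < γ)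
    (hη₁ : structConst m r γ * η₁ ≤ structBound m r τ γ) (hδ : 0 < δ) (hy : ‖yδ - P.y‖ ≤ δ) :
    ∃ k, P.IsStop m τ δ yδ k ∧
      ‖P.F' P.xdag (P.iter m yδ k - P.xdag)‖ ≤ 2 * (τ + 1) * δ ∧ ∃ (z : X) (D : ℝ),
      StoppedError m (2 * r * (τ + 6 + √m)) τ δ (P.F' P.xdag) P.e0
        (P.iter m yδ k - P.xdag) z D := by
  have hm' : (1 : ℝ) ≤ m := by exact_mod_cast hm
  have hr0 : 0 < r := by linarith
  obtain ⟨hγ0, hθ⟩ := pos_of_c₃_mul_lt hm hr hτ hγ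
  have hs := h.standing
  have hα := hs.admissibleParameters hr
  obtain ⟨hK₀, -⟩ := id h.rangeInvariance
  obtain ⟨hK₁, hK₂, -⟩ := id h.derivBound
  have hstep := @StrongAssumptions.step _ _ _ _ _ _ _ _ _ _ P m r δ γ yδ η₁ K₀ K₁ K₂ h hm hr hγ0 hy
  have hM0 := structError_pos hm hγ0.le
  have hM2 := two_add_le_structError hm hγ0.le
  have hmγ : 0 ≤ √(m : ℝ) * γ := by positivity
  have hC0 := structImage_pos hr hγ0.le
  have hconst := structConst_pos hm hr hγ0.le
  set T := P.F' P.xdag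
  set e : ℕ → X := fun k => P.iter m yδ k - P.xdag with he
  set R : ℕ → Y := fun k => P.F (P.iter m yδ k) - yδ with hR
  set ξ := P.y - yδ with hξdef
  have hξ : ‖ξ‖ ≤ δ := by rwa [hξdef, norm_sub_rev]
  set M := structError m γ with hM
  set C := structImage r γ with hC
  set η := (K₀ + K₁ + K₂) * ‖P.e0‖ with hη
  have hη0 : 0 ≤ η := by positivity
  set ε := structConst m r γ * η with hε
  have hε0 : 0 ≤ ε := by positivity
  have hεb : ε ≤ structBound m r τ γ := le_trans (by rw [hε]; gcongr; exact h.small) hη₁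
  have hε1 : ε ≤ perturbationBound m r τ := hεb.trans (min_le_left _ _)
  have hε2 : ε * (M + C) ≤ 1 := by
    rw [← le_div_iff₀ (by positivity)]
    exact hεb.trans ((min_le_right _ _).trans (min_le_left _ _))
  have hε3 : ε * (1 + (1 + r) * (M + C) / γ) ≤ τ - 1 - c₃ m * √r / γ := by
    rw [← le_div_iff₀ (by positivity)]
    exact hεb.trans ((min_le_right _ _).trans (min_le_right _ _))
  have hε4 : ε ≤ 1 := by
    refine le_trans (le_mul_of_one_le_right hε0 ?_) hε2
    linarith
  have hMη : 5 * (M * η) ≤ ε := by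
    rw [hε, structConst, ← hM, ← hC]
    have : 0 ≤ m * η := by positivity
    have : 0 ≤ m * (M * η) := by positivity
    have : 0 ≤ m * (C * η) := by positivity
    linarith
  have hsp (k : ℕ) : 0 < √(P.α k) := Real.sqrt_pos.2 (hα.pos k)
  have hsr (k : ℕ) : √(P.α k) ≤ r * √(P.α (k + 1)) :=
    (hα.sqrt_le k).trans (by gcongr; exact sqrt_le_self_of_one_le hr.le)
  have hest : ∀ k, P.iter m yδ k ∈ P.ball → ‖e k‖ ≤ M * ‖P.e0‖ →
      ‖T (e k)‖ ≤ C * √(P.α k) * ‖P.e0‖ →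
      √(P.α k) * ‖e (k + 1) - resOp m (P.α k) T P.e0‖ ≤ ε * scaledNorm T (P.α k) (e k) + √m * δ ∧
      ‖T (e (k + 1) - resOp m (P.α k) T P.e0) + ξ‖ ≤
        ε * scaledNorm T (P.α k) (e k) + (1 + ε) * δ :=
    fun k hb hek hTek => hstep hε4 hb hek hTek
  have hres : ∀ k, P.iter m yδ k ∈ P.ball → ‖e k‖ ≤ M * ‖P.e0‖ →
      ‖R k - ξ - T (e k)‖ ≤ M * η * ‖T (e k)‖ := by
    intro k hb hek
    have h1 := hs.norm_remainder_le_of_derivBound h.derivBound hb (Or.inr rfl)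
    have h2 : R k - ξ - T (e k) = P.F (P.iter m yδ k) - P.y - T (e k) := by
      change P.F (P.iter m yδ k) - yδ - (P.y - yδ) - T (e k) = _
      abel
    rw [h2]
    refine h1.trans (mul_le_mul_of_nonneg_right ?_ (norm_nonneg _))
    calc (K₁ + K₂) * ‖e k‖ ≤ (K₀ + K₁ + K₂) * (M * ‖P.e0‖) := by gcongr; linarith
      _ = _ := by rw [hη]; ring
  have hex : ∃ k, γ * (√(P.α k) * ‖P.e0‖) ≤ δ := by
    have h1 : Tendsto (fun k => γ * (√(P.α k) * ‖P.e0‖)) atTop (𝓝 (γ * (√0 * ‖P.e0‖))) :=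
      (((Real.continuous_sqrt.tendsto 0).comp hs.alpha_tendsto).mul_const _).const_mul _
    rw [Real.sqrt_zero, zero_mul, mul_zero] at h1
    obtain ⟨k, hk⟩ := (h1.eventually_lt_const hδ).exists
    exact ⟨k, hk.le⟩
  classical
  set K := Nat.find hex
  have hKu : γ * (√(P.α K) * ‖P.e0‖) ≤ δ := Nat.find_spec hex
  have hmem : ∀ k, ‖e k‖ ≤ M * ‖P.e0‖ → P.iter m yδ k ∈ P.ball := fun k hk =>
    mem_ball_iff.2 (hk.trans_lt h.radius)
  have hσ : ∀ k, ‖e k‖ ≤ M * ‖P.e0‖ → ‖T (e k)‖ ≤ C * √(P.α k) * ‖P.e0‖ →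
      scaledNorm T (P.α k) (e k) ≤ (M + C) * (√(P.α k) * ‖P.e0‖) := by
    intro k h1 h2
    have h3 := mul_le_mul_of_nonneg_left h1 (hsp k).le
    rw [scaledNorm]
    linarith
  have hind : ∀ k ≤ K, ‖e k‖ ≤ M * ‖P.e0‖ ∧ ‖T (e k)‖ ≤ C * √(P.α k) * ‖P.e0‖ := by
    intro k
    induction k with
    | zero =>
      intro _
      have he0 : e 0 = P.e0 := rfl
      rw [he0]
      refine ⟨le_mul_of_one_le_left (norm_nonneg _) (by linarith), ?_⟩
      refine le_of_opNorm_le _ (hs.norm_deriv_le.trans ?_) _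
      refine mul_le_mul_of_nonneg_right ((c₃_le_one hm).trans ?_) (Real.sqrt_nonneg _)
      rw [hC, structImage]
      nlinarith
    | succ k ih =>
      intro hk
      obtain ⟨hek, hTek⟩ := ih (by lia)
      have hlt : δ < γ * (√(P.α k) * ‖P.e0‖) := not_le.1 (Nat.find_min hex (by lia))
      obtain ⟨h1, h2⟩ := hest k (hmem k hek) hek hTek
      have hq : ε * scaledNorm T (P.α k) (e k) ≤ √(P.α k) * ‖P.e0‖ := by
        calc _ ≤ ε * ((M + C) * (√(P.α k) * ‖P.e0‖)) :=
              mul_le_mul_of_nonneg_left (hσ k hek hTek) hε0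
          _ = ε * (M + C) * (√(P.α k) * ‖P.e0‖) := by ring
          _ ≤ _ := mul_le_of_le_one_left (by positivity) hε2
      have h5 := norm_resOp_apply_le T (hα.pos k) m P.e0
      have h6 : ‖T (resOp m (P.α k) T P.e0)‖ ≤ √(P.α k) * ‖P.e0‖ :=
        norm_apply_resOp_le T (hα.pos k) hm P.e0
      set z := resOp m (P.α k) T P.e0
      have h3 : ‖e (k + 1)‖ ≤ ‖e (k + 1) - z‖ + ‖z‖ := by
        simpa using norm_add_le (e (k + 1) - z) z
      constructor
      · have h3' := mul_le_mul_of_nonneg_left h3 (hsp k).le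
        have h5' := mul_le_mul_of_nonneg_left h5 (hsp k).le
        have h7 : √m * δ ≤ √m * (γ * (√(P.α k) * ‖P.e0‖)) := by gcongr
        have h8 : √(P.α k) * ‖e (k + 1)‖ ≤ √(P.α k) * ((2 + √m * γ) * ‖P.e0‖) := by linarith
        refine (le_of_mul_le_mul_left h8 (hsp k)).trans ?_
        gcongr
      · have h4 : ‖T (e (k + 1))‖ ≤ ‖T (e (k + 1) - z) + ξ‖ + ‖ξ‖ + ‖T z‖ := by
          have : T (e (k + 1)) = (T (e (k + 1) - z) + ξ) - ξ + T z := by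
            rw [map_sub T (e (k + 1))]; abel
          conv_lhs => rw [this]
          exact (norm_add_le _ _).trans (add_le_add (norm_sub_le _ _) le_rfl)
        have h7 : ε * δ ≤ 1 * δ := by gcongr
        -- The linear part and the perturbation each contribute `√α_k ‖e0‖`; the data error
        -- contributes at most `3 δ`, below `3 γ √α_k ‖e0‖` before `K`.
        calc ‖T (e (k + 1))‖ ≤ (2 + 3 * γ) * (√(P.α k) * ‖P.e0‖) := by linarith
          _ ≤ (2 + 3 * γ) * (r * √(P.α (k + 1)) * ‖P.e0‖) := by gcongr; exact hsr k
          _ = _ := by rw [hC, structImage]; ring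
  have hn : NearLinear m T P.α P.e0 ξ δ ε K e R := by
    refine ⟨hξ, rfl, fun k hk => ?_, fun k hk => ?_, fun k hk => ?_⟩
    · obtain ⟨hek, hTek⟩ := hind k hk.le
      exact (hest k (hmem k hek) hek hTek).1
    · obtain ⟨hek, hTek⟩ := hind k hk.le
      exact (hest k (hmem k hek) hek hTek).2
    · obtain ⟨hek, hTek⟩ := hind k hk
      refine (hres k (hmem k hek) hek).trans ?_
      have : 0 ≤ M * η := by positivity
      refine mul_le_mul (by linarith) ?_ (norm_nonneg _) hε0
      rw [scaledNorm]
      exact le_add_of_nonneg_left (by positivity)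
  have hdisc : ‖R K‖ ≤ τ * δ := by
    have hc3 := c₃_pos hm
    have hKq : √(P.α K) * ‖P.e0‖ ≤ δ / γ := by rw [le_div_iff₀ hγ0]; linarith
    have hr1 : 1 ≤ √r := by rw [Real.one_le_sqrt]; exact hr.le
    have hfin : (1 + ε * (1 + (1 + r) * (M + C) / γ) + c₃ m * √r / γ) * δ ≤ τ * δ := by
      gcongr; linarith
    refine le_trans ?_ hfin
    have hexp : (1 + ε * (1 + (1 + r) * (M + C) / γ) + c₃ m * √r / γ) * δ
        = (1 + ε) * δ + ε * ((M + C) * (δ / γ)) + ε * ((M + C) * (r * (δ / γ)))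
          + c₃ m * (√r * (δ / γ)) := by ring
    rw [hexp]
    have hδγ : 0 < δ / γ := by positivity
    have hεσ : ε * scaledNorm T (P.α K) (e K) ≤ ε * ((M + C) * (δ / γ)) := by
      obtain ⟨hek, hTek⟩ := hind K le_rfl
      refine mul_le_mul_of_nonneg_left ((hσ K hek hTek).trans ?_) hε0
      gcongr
    generalize hKn : K = n at *
    cases n with
    | zero =>
      have h1 := hn.norm_residual_zero_le
      have h2 : ‖T P.e0‖ ≤ c₃ m * (√r * (δ / γ)) := by
        refine (le_of_opNorm_le _ hs.norm_deriv_le _).trans ?_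
        rw [mul_assoc]
        refine mul_le_mul_of_nonneg_left (hKq.trans ?_) hc3.le
        exact le_mul_of_one_le_left hδγ.le hr1
      have h3 : 0 ≤ ε * ((M + C) * (r * (δ / γ))) := by positivity
      have h4 : 0 ≤ ε * δ := by positivity
      change ε * scaledNorm T (P.α 0) P.e0 ≤ _ at hεσ
      linarith
    | succ k =>
      obtain ⟨hek, hTek⟩ := hind k (by lia)
      have h1 := hn.norm_residual_succ_le (Nat.lt_succ_self k)
      have h2 : √(P.α k) * ‖P.e0‖ ≤ √r * (δ / γ) := by
        calc √(P.α k) * ‖P.e0‖ ≤ √r * √(P.α (k + 1)) * ‖P.e0‖ := by gcongr; exact hα.sqrt_le k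
          _ = √r * (√(P.α (k + 1)) * ‖P.e0‖) := by ring
          _ ≤ _ := by gcongr
      have h3 : ‖T (resOp m (P.α k) T P.e0)‖ ≤ c₃ m * (√r * (δ / γ)) := by
        refine (norm_apply_resOp_le_c₃ T (hα.pos k) hm P.e0).trans ?_
        rw [mul_assoc]
        exact mul_le_mul_of_nonneg_left h2 hc3.le
      have h4 : ε * scaledNorm T (P.α k) (e k) ≤ ε * ((M + C) * (r * (δ / γ))) := by
        refine mul_le_mul_of_nonneg_left ((hσ k hek hTek).trans ?_) hε0
        refine mul_le_mul_of_nonneg_left (h2.trans ?_) (by positivity)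
        gcongr
        exact sqrt_le_self_of_one_le hr.le
      linarith
  obtain ⟨k, hk, hs', hz⟩ := exists_isStop_of_nearLinear hs hr hτ hε0 hε1
    (fun k hk => hmem k (hind k hk).1) hn hdisc
  refine ⟨k, hs', ?_, hz⟩
  obtain ⟨hek, hTek⟩ := hind k hk
  have h1 := hres k (hmem k hek) hek
  have h2 : ‖R k‖ ≤ τ * δ := hs'.2.1
  have h3 : ‖T (e k)‖ ≤ ‖R k - ξ - T (e k)‖ + ‖R k‖ + ‖ξ‖ := by
    have : T (e k) = R k - (R k - ξ - T (e k)) - ξ := by abel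
    conv_lhs => rw [this]
    exact (norm_sub_le _ _).trans (add_le_add ((norm_sub_le _ _).trans (add_comm _ _).le) le_rfl)
  -- The remainder is relative to `‖T e‖` and can be absorbed, so `‖T e‖ = O(δ)`. A Lipschitz
  -- condition alone does not give this.
  have h4 : M * η * ‖T (e k)‖ ≤ 1 / 2 * ‖T (e k)‖ := by gcongr; linarith
  change ‖T (e k)‖ ≤ _
  linarith

end NewtonData

theorem StoppedError.noise_nonneg {𝕜 : Type u} {X : Type v} {Y : Type w} [RCLike 𝕜]
    [NormedAddCommGroup X] [InnerProductSpace 𝕜 X] [CompleteSpace X]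
    [NormedAddCommGroup Y] [InnerProductSpace 𝕜 Y] [CompleteSpace Y]
    {m : ℕ} {C τ δ D : ℝ} {T : X →L[𝕜] Y} {e0 x h : X}
    (H : StoppedError m C τ δ T e0 x h D) (hδ : 0 ≤ δ) : 0 ≤ D := by
  rcases H.noise with h | ⟨a, ha, h, -⟩
  · exact h.ge
  · rw [h]; positivity

/-! ### Error estimates at the stopping index. -/

namespace NewtonData

open ContinuousLinearMap

variable {𝕜 : Type u} {X : Type v} {Y : Type w} [RCLike 𝕜]
  [NormedAddCommGroup X] [InnerProductSpace 𝕜 X] [CompleteSpace X]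
  [NormedAddCommGroup Y] [InnerProductSpace 𝕜 Y] [CompleteSpace Y]
  {P : NewtonData 𝕜 X Y} {m : ℕ} {r τ δ γ ν μ : ℝ} {yδ : Y} {ω : X}

theorem HolderSource.e0_eq_zero (h : P.HolderSource ν 0) : P.e0 = 0 := by
  rw [h, map_zero]

/-- Factor `t^ν = √t t^(ν - 1/2)` and apply the polar decomposition. -/
theorem HolderSource.existsUnique_isSourceElement (h : P.HolderSource ν ω) (hν : 1 / 2 ≤ ν) :
    ∃! z : Y, P.IsSourceElement z := by
  have hs : 0 ≤ ν - 1 / 2 := by linarith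
  obtain ⟨z, hz, hz'⟩ := exists_adjoint_eq_sqrt (P.F' P.xdag)
    (opFun (fun t => t ^ (ν - 1 / 2)) (gram (P.F' P.xdag)) ω)
  have he : P.e0 = adjoint (P.F' P.xdag) z := by
    rw [hz', ← opFun_mul_apply (gram_isPositive _) (f := fun t => √t)
      (g := fun t => t ^ (ν - 1 / 2)) Real.continuous_sqrt.continuousOn (continuousOn_rpow hs _), h]
    congr 1
    refine opFun_congr fun t ht => ?_
    rw [Real.sqrt_eq_rpow]
    rcases ht.1.eq_or_lt with rfl | ht0
    · rw [Real.zero_rpow (by linarith), Real.zero_rpow (by norm_num), zero_mul]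
    · rw [← Real.rpow_add ht0]; congr 1; ring
  exact ⟨z, ⟨hz, he⟩, fun z' h' =>
    adjoint_injOn_orthogonal_ker h'.1 hz (h'.2.symm.trans he)⟩

/-- The constant in the error estimate at the stopping index under a Lipschitz condition. -/
def lipRateConst (m : ℕ) (r τ : ℝ) : ℝ :=
  2 * (τ + 1) * (1 + 2 * √m * (1 + 2 * r * (τ + 6 + √m))) + 2 * (2 * r * (τ + 6 + √m)) + 1

/-- The constant in the error estimate at the stopping index under the structure conditions. -/
def structRateConst (m : ℕ) (r τ : ℝ) : ℝ :=
  2 * (1 + √m * (2 * (τ + 1)) + 2 * r * (τ + 6 + √m))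

theorem lipRateConst_pos (m : ℕ) (hr : 1 < r) (hτ : 1 < τ) : 0 < lipRateConst m r τ := by
  have : 0 < r := by linarith
  have : 0 < τ := by linarith
  rw [lipRateConst]; positivity

theorem structRateConst_pos (m : ℕ) (hr : 1 < r) (hτ : 1 < τ) : 0 < structRateConst m r τ := by
  have : 0 < r := by linarith
  have : 0 < τ := by linarith
  rw [structRateConst]; positivity

theorem rate_of_lipschitz (hm : 1 ≤ m) (hr : 1 < r) (hτ : 1 < τ) (h : P.Standing m r)
    {L : ℝ} (hL : 0 ≤ L) (hlip : P.LipschitzDeriv L) (hρ : 4 * ‖P.e0‖ < P.ρ)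
    (hν : 1 / 2 ≤ ν) (hνm : ν ≤ m - 1 / 2) (hω : P.HolderSource ν ω) {u : Y}
    (hu : P.IsSourceElement u) (hsmall : L * ‖u‖ ≤ lipBound m r τ / lipConst m r τ) (hδ : 0 < δ)
    (hδu : ‖u‖ * δ ≤ lipGamma r τ / (4 * m) * P.ρ ^ 2) (hy : ‖yδ - P.y‖ ≤ δ) :
    ∃ k, P.IsStop m τ δ yδ k ∧ ‖P.iter m yδ k - P.xdag‖ ≤
      lipRateConst m r τ * (2 + (8 / (τ - 1)) ^ (1 / (1 + 2 * ν))) * ‖ω‖ ^ (1 / (1 + 2 * ν))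
        * δ ^ (2 * ν / (1 + 2 * ν)) := by
  have hr0 : 0 < r := by linarith
  have hτ0 : 0 < τ - 1 := by linarith
  have hC := lipRateConst_pos m hr hτ
  have hc := lipConst_pos m hr hτ
  by_cases hω0 : ω = 0
  · rw [hω0] at hω
    obtain ⟨h1, h2⟩ := isStop_zero h hω.e0_eq_zero hτ hy
    refine ⟨0, h1, ?_⟩
    rw [h2, norm_zero]
    positivity
  have hsmall' : lipConst m r τ * (L * ‖u‖) ≤ lipBound m r τ := by
    rw [le_div_iff₀ hc] at hsmall; linarith
  have hLu : L * ‖u‖ ≤ 1 / 4 := by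
    have h1 : lipBound m r τ ≤ 1 := by
      refine ((min_le_right _ _).trans (min_le_left _ _)).trans ?_
      rw [div_le_one (by positivity)]
      linarith
    have h2 : 4 ≤ lipConst m r τ := by
      have hm' : (1 : ℝ) ≤ m := by exact_mod_cast hm
      have := lipError_pos m hr hτ
      have : 0 ≤ lipError m r τ * (2 + m) := by positivity
      rw [lipConst]; linarith
    have h3 : 4 * (L * ‖u‖) ≤ lipConst m r τ * (L * ‖u‖) := by gcongr
    linarith
  obtain ⟨k, hk, hb, z, D, H⟩ := exists_isStop_of_lipschitz hm hr hτ h hL hlip hρ hu.2 hsmall' hδ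
    hδu hy
  refine ⟨k, hk, H.holder_rate hτ hδ hω0 (by linarith) hνm hω hC.le fun β hβ => ?_⟩
  refine H.norm_le_of_source (by positivity) (H.noise_nonneg hδ.le) hδ.le hu.2
    (d := P.F (P.iter m yδ k) - P.y) (by linarith) ?_ ?_ hL hLu hβ (by positivity)
    (sqrt_mul_norm_resOp_le_of_holder hν hνm hβ hu.1 (hu.2.symm.trans hω))
  · rw [add_mul, one_mul]
    calc _ ≤ ‖P.F (P.iter m yδ k) - yδ‖ + ‖yδ - P.y‖ := norm_sub_le_norm_sub_add_norm_sub _ _ _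
      _ ≤ _ := add_le_add hk.2.1 hy
  · rw [norm_sub_rev]
    exact h.norm_remainder_le_of_lipschitz hL hlip hb (Or.inr rfl)

/-- Uniqueness of the stopping index transfers the information obtained for the constructed index to
an arbitrary one. -/
theorem StrongAssumptions.stoppedError {η₁ K₀ K₁ K₂ : ℝ}
    (h : P.StrongAssumptions m r γ η₁ K₀ K₁ K₂)
    (hm : 1 ≤ m) (hr : 1 < r) (hτ : 1 < τ) (hγ : c₃ m * √r / (τ - 1) < γ)
    (hη₁ : structConst m r γ * η₁ ≤ structBound m r τ γ) (hδ : 0 < δ) (hy : ‖yδ - P.y‖ ≤ δ)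
    {k : ℕ} (hk : P.IsStop m τ δ yδ k) :
    ∃ (z : X) (D : ℝ), StoppedError m (2 * r * (τ + 6 + √m)) τ δ (P.F' P.xdag) P.e0
        (P.iter m yδ k - P.xdag) z D ∧
      ∀ β > 0, ‖P.iter m yδ k - P.xdag‖ ≤
        structRateConst m r τ * (‖resOp m β (P.F' P.xdag) P.e0‖ + δ / √β + D) := by
  obtain ⟨l, hl, hT, z, D, H⟩ := h.exists_isStop hm hr hτ hγ hη₁ hδ hy
  obtain rfl := hk.unique hl
  have hr0 : 0 < r := by linarith
  exact ⟨z, D, H, fun β hβ => H.norm_le (by positivity) (H.noise_nonneg hδ.le) hδ.le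
    (by linarith) hT hβ⟩

end NewtonData

end

/-! ### Assembly of the constants. -/

open NewtonData

theorem corollary6p1 (m : ℕ) (hm : 1 ≤ m) (r τ : ℝ) (hr : 1 < r) (hτ : 1 < τ) :
    -- (i) Lipschitz continuous derivative
    (∃ η₀ > (0 : ℝ), ∃ κ₀ > (0 : ℝ), ∀ ν : ℝ, 1 / 2 ≤ ν → ν ≤ m - 1 / 2 →
      ∃ C > (0 : ℝ), ∀ (𝕜 : Type u) (X : Type v) (Y : Type w) [RCLike 𝕜]
        [NormedAddCommGroup X] [InnerProductSpace 𝕜 X] [CompleteSpace X]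
        [NormedAddCommGroup Y] [InnerProductSpace 𝕜 Y] [CompleteSpace Y]
        (P : NewtonData 𝕜 X Y) (L : ℝ) (ω : X),
        P.Standing m r → P.LipschitzDeriv L → 4 * ‖P.e0‖ < P.ρ → P.HolderSource ν ω →
        (∃! z : Y, P.IsSourceElement z) ∧
        ∀ z : Y, P.IsSourceElement z → L * ‖z‖ ≤ η₀ →
          ∀ (δ : ℝ) (yδ : Y), 0 < δ → ‖z‖ * δ ≤ κ₀ * P.ρ ^ 2 → ‖yδ - P.y‖ ≤ δ →
            ∃ k, P.IsStop m τ δ yδ k ∧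
              ‖P.iter m yδ k - P.xdag‖ ≤
                C * ‖ω‖ ^ (1 / (1 + 2 * ν)) * δ ^ (2 * ν / (1 + 2 * ν))) ∧
    -- (ii) structure conditions on the derivative
    (∀ γ₁ : ℝ, c₃ m * √r / (τ - 1) < γ₁ → ∃ η₁ > (0 : ℝ),
      -- well-definedness and convergence
      (∀ (𝕜 : Type u) (X : Type v) (Y : Type w) [RCLike 𝕜]
        [NormedAddCommGroup X] [InnerProductSpace 𝕜 X] [CompleteSpace X]
        [NormedAddCommGroup Y] [InnerProductSpace 𝕜 Y] [CompleteSpace Y]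
        (P : NewtonData 𝕜 X Y) (K₀ K₁ K₂ : ℝ), P.StrongAssumptions m r γ₁ η₁ K₀ K₁ K₂ →
        (∀ (δ : ℝ) (yδ : Y), 0 < δ → ‖yδ - P.y‖ ≤ δ → ∃ k, P.IsStop m τ δ yδ k) ∧
        ∀ ε > (0 : ℝ), ∃ δ₀ > (0 : ℝ), ∀ (δ : ℝ) (yδ : Y) (k : ℕ), 0 < δ → δ < δ₀ →
          ‖yδ - P.y‖ ≤ δ → P.IsStop m τ δ yδ k → ‖P.iter m yδ k - P.xdag‖ < ε) ∧
      -- rates under a Hölder source condition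
      (∀ ν : ℝ, 0 < ν → ν ≤ m - 1 / 2 →
        ∃ C > (0 : ℝ), ∀ (𝕜 : Type u) (X : Type v) (Y : Type w) [RCLike 𝕜]
          [NormedAddCommGroup X] [InnerProductSpace 𝕜 X] [CompleteSpace X]
          [NormedAddCommGroup Y] [InnerProductSpace 𝕜 Y] [CompleteSpace Y]
          (P : NewtonData 𝕜 X Y) (K₀ K₁ K₂ : ℝ) (ω : X),
          P.StrongAssumptions m r γ₁ η₁ K₀ K₁ K₂ → P.HolderSource ν ω →
          ∀ (δ : ℝ) (yδ : Y) (k : ℕ), 0 < δ → ‖yδ - P.y‖ ≤ δ → P.IsStop m τ δ yδ k →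
            ‖P.iter m yδ k - P.xdag‖ ≤
              C * ‖ω‖ ^ (1 / (1 + 2 * ν)) * δ ^ (2 * ν / (1 + 2 * ν))) ∧
      -- rates under a logarithmic source condition
      (∀ μ : ℝ, 0 < μ →
        ∃ C > (0 : ℝ), ∀ (𝕜 : Type u) (X : Type v) (Y : Type w) [RCLike 𝕜]
          [NormedAddCommGroup X] [InnerProductSpace 𝕜 X] [CompleteSpace X]
          [NormedAddCommGroup Y] [InnerProductSpace 𝕜 Y] [CompleteSpace Y]
          (P : NewtonData 𝕜 X Y) (K₀ K₁ K₂ : ℝ) (ω : X),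
          P.StrongAssumptions m r γ₁ η₁ K₀ K₁ K₂ → P.LogSource μ ω →
          ∀ (δ : ℝ) (yδ : Y) (k : ℕ), 0 < δ → δ ≤ ‖ω‖ → ‖yδ - P.y‖ ≤ δ →
            P.IsStop m τ δ yδ k →
            ‖P.iter m yδ k - P.xdag‖ ≤
              C * ‖ω‖ * (1 + |Real.log (δ / ‖ω‖)|) ^ (-μ))) := by
  have hm' : (1 : ℝ) ≤ m := by exact_mod_cast hm
  have hτ0 : 0 < τ - 1 := by linarith
  refine ⟨⟨lipBound m r τ / lipConst m r τ, div_pos (lipBound_pos m hr hτ) (lipConst_pos m hr hτ),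
    lipGamma r τ / (4 * m), div_pos (lipGamma_pos hr hτ) (by linarith), fun ν hν hνm => ?_⟩,
    fun γ₁ hγ => ?_⟩
  · have hC := lipRateConst_pos m hr hτ
    refine ⟨lipRateConst m r τ * (2 + (8 / (τ - 1)) ^ (1 / (1 + 2 * ν))), by positivity, ?_⟩
    intro 𝕜 X Y _ _ _ _ _ _ _ P L ω h hlip hρ hω
    refine ⟨hω.existsUnique_isSourceElement hν, fun z hz hLz δ yδ hδ hδz hy => ?_⟩
    -- The sign of `L` is not prescribed, so the nonnegative Lipschitz constant `max L 0` is used;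
    -- the smallness condition survives because the threshold is positive.
    refine rate_of_lipschitz hm hr hτ h (le_max_right L 0) (fun x hx x' hx' => ?_) hρ hν hνm hω hz
      ?_ hδ hδz hy
    · exact (hlip x hx x' hx').trans (by gcongr; exact le_max_left _ _)
    · rw [max_mul_of_nonneg _ _ (norm_nonneg z), zero_mul]
      exact max_le hLz (div_pos (lipBound_pos m hr hτ) (lipConst_pos m hr hτ)).le
  · obtain ⟨hγ0, -⟩ := pos_of_c₃_mul_lt hm hr hτ hγ
    have hK := structConst_pos hm hr hγ0.le
    have hC := structRateConst_pos m hr hτ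
    have hη : structConst m r γ₁ * (structBound m r τ γ₁ / structConst m r γ₁)
        ≤ structBound m r τ γ₁ := (mul_div_cancel₀ _ hK.ne').le
    refine ⟨structBound m r τ γ₁ / structConst m r γ₁, div_pos (structBound_pos hm hr hτ hγ) hK,
      ?_, fun ν hν hνm => ?_, fun μ hμ => ?_⟩
    · intro 𝕜 X Y _ _ _ _ _ _ _ P K₀ K₁ K₂ h
      refine ⟨fun δ yδ hδ hy => ?_, fun ε hε => ?_⟩
      · obtain ⟨k, hk, -⟩ := h.exists_isStop hm hr hτ hγ hη hδ hy
        exact ⟨k, hk⟩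
      · obtain ⟨δ₀, hδ₀, hlt⟩ := exists_norm_lt_of_stoppedError (C := 2 * r * (τ + 6 + √m))
          hm hτ hC h.orthogonal hε
        refine ⟨δ₀, hδ₀, fun δ yδ k hδ hδlt hy hk => ?_⟩
        obtain ⟨z, D, H, hx⟩ := h.stoppedError hm hr hτ hγ hη hδ hy hk
        exact hlt δ _ z D hδ hδlt H hx
    · refine ⟨structRateConst m r τ * (2 + (8 / (τ - 1)) ^ (1 / (1 + 2 * ν))), by positivity, ?_⟩
      intro 𝕜 X Y _ _ _ _ _ _ _ P K₀ K₁ K₂ ω h hω δ yδ k hδ hy hk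
      by_cases hω0 : ω = 0
      · rw [hω0] at hω
        obtain ⟨h1, h2⟩ := isStop_zero h.standing hω.e0_eq_zero hτ hy
        rw [hk.unique h1, h2, norm_zero]
        positivity
      obtain ⟨z, D, H, hx⟩ := h.stoppedError hm hr hτ hγ hη hδ hy hk
      refine H.holder_rate hτ hδ hω0 hν hνm hω hC.le fun β hβ => (hx β hβ).trans ?_
      gcongr
      exact (scaledNorm_resOp_le_of_holder hν.le hνm hβ hω).1
    · have hL := logConst_pos hμ
      refine ⟨structRateConst m r τ * (logConst μ + 2 * (1 + 4 * μ) ^ μ + 8 / (τ - 1) * logConst μ),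
        by positivity, ?_⟩
      intro 𝕜 X Y _ _ _ _ _ _ _ P K₀ K₁ K₂ ω h hω δ yδ k hδ hδω hy hk
      obtain ⟨z, D, H, hx⟩ := h.stoppedError hm hr hτ hγ hη hδ hy hk
      exact H.log_rate hm hτ hδ hδω hμ h.standing.norm_gram_le hω hC.le hx
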